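/- **Setting.** Let $H$ be an $n$-qubit Hamiltonian with eigendecomposition $H=\sum_{i} E_i|\psi_i\rangle\langle\psi_i|$, $E_0\le E_1\le\cdots$. For $\Delta>0$ it is called $\Delta$-gapped if $E_i-E_0\ge\Delta$ for all $i\ge 1$; then $|\psi_0\rangle$ is its unique ground state. Let $A$ be a Hermitian observable with $\|A\|\le 1$ (operator norm). A block-encoding of $A$ with $b$ ancilla qubits is a unitary $V$ on $b+n$ qubits with $(\langle 0^b|\otimes I)\,V\,(|0^b\rangle\otimes I)=A$. A *protocol* has the following registers, besides the $n$-qubit system: a workspace of $w$ qubits, a time register of $k+1$ qubits whose basis states are labelled by the times $\bar t\in S=\{-2^k t_0,\dots,-t_0,0,t_0,\dots,(2^k-1)t_0\}$ for some $t_0>0$, and the $b$ ancilla qubits of the block-encoding. All ancilla registers start in $|0\cdots 0\rangle$ and the system starts in one copy of $|\psi_0\rangle$. The protocol is a finite sequence of steps. Each step is either a fixed unitary on the ancilla registers only, or a *call* $$\sum_{\bar t\in S}|\bar t\rangle\langle\bar t|\otimes e^{iH\bar t}\,V^{\pm1}\,e^{-iH\bar t},$$ where $V^{\pm 1}$ is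 applied to the block-encoding ancillas and the system, controlled on a prescribed set of computational basis states of the workspace. A call counts as one call to the block-encoding and uses controlled Heisenberg evolution time $2\max_{\bar t\in S}|\bar t|=2^{k+1}t_0$. At the end the workspace is measured in the computational basis, a real number that is a fixed function of the outcome is reported, and the system register is returned, all other registers being traced out. **Theorem (Catalytic ground state tomography).** There is an absolute constant $C>0$ such that for all $n,b\ge 0$, $\Delta>0$, $L\in\mathbb R$, $0<\varepsilon\le1$ and $0<\delta\le\tfrac12$ there is a protocol, depending on these parameters only, which uses total controlled Heisenberg evolution time at most $$C\,\frac{\log(1/\delta)\bigl(\log(1/\delta)+\log(1/\varepsilon)\bigr)}{\Delta\,\varepsilon}$$ and at most $$C\,\frac{\log(1/\delta)}{\varepsilon}$$ calls to the block-encoding, and which has the following property. For every $n$-qubit $\Delta$-gapped Hamiltonian $H$ with ground state $|\psi_0\rangle$, every Hermitian observable $A$ with $\|A\|\le1$ and $\|[A,H]\|\le L$, and every block-encoding $V$ of $A$ with $b$ ancilla qubits, the protocol run on one copy of $|\psi_0\rangle$ reports a number within $\varepsilon$ of $\langle\psi_0|A|\psi_0\rangle$ with probability at least $1-\delta$, and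 the returned state $\rho$ of the system satisfies $\tfrac12\bigl\|\rho-|\psi_0\rangle\langle\psi_0|\bigr\|_1\le\delta$. The resource bounds do not depend on $L$, $n$ or $b$. -/

import Mathlib

open scoped Matrix Kronecker Matrix.Norms.L2Operator

noncomputable section

namespace CatalyticTomography

/-- Computational basis labels of an `m`-qubit register; the label `0` is `|0^m⟩`. -/
abbrev Reg (m : ℕ) : Type := Fin (2 ^ m)

/-- Operators on the space with orthonormal basis `ι`. Their norm is the `ℓ²` operator norm. -/
abbrev Op (ι : Type) : Type := Matrix ι ι ℂ

/-! ### Hamiltonians, expectation values, block-encodings -/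

/-- `ψ` is the ground state of a `Δ`-gapped Hamiltonian `H` on `n` qubits: there is an
eigendecomposition `H = ∑ i, E i |v i⟩⟨v i|` with `E 0 ≤ E 1 ≤ …` and `ψ = v 0`, in which every
level but the first lies at least `Δ` above `E 0`. -/
def IsGappedGroundState {n : ℕ} (H : Op (Reg n)) (Δ : ℝ) (ψ : EuclideanSpace ℂ (Reg n)) : Prop :=
  ∃ (E : Reg n → ℝ) (v : OrthonormalBasis (Reg n) ℂ (EuclideanSpace ℂ (Reg n))),
    Monotone E ∧
    (∀ i, Matrix.toEuclideanLin H (v i) = (E i : ℂ) • v i) ∧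
    v 0 = ψ ∧
    ∀ i, i ≠ 0 → Δ ≤ E i - E 0

/-- `⟨ψ|A|ψ⟩` (the real part is taken only to land in `ℝ`; `A` will be Hermitian). -/
def expectation {n : ℕ} (A : Op (Reg n)) (ψ : EuclideanSpace ℂ (Reg n)) : ℝ :=
  (inner ℂ ψ (Matrix.toEuclideanLin A ψ)).re

/-- `V` is a block-encoding of `A` with `b` ancilla qubits: a unitary with
`(⟨0^b| ⊗ I) V (|0^b⟩ ⊗ I) = A`. -/
def IsBlockEncoding {n b : ℕ} (V : Op (Reg b × Reg n)) (A : Op (Reg n)) : Prop :=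
  V ∈ Matrix.unitaryGroup (Reg b × Reg n) ℂ ∧ ∀ i j, V (0, i) (0, j) = A i j

/-- The Hamiltonian evolution `e^{i H t}`. -/
def evolution {n : ℕ} (H : Op (Reg n)) (t : ℝ) : Op (Reg n) :=
  NormedSpace.exp ((Complex.I * (t : ℂ)) • H)

/-! ### Trace distance -/

/-- The trace norm `‖M‖₁ = tr √(Mᴴ M)`, the sum of the singular values. -/
def traceNorm {ι : Type} [Fintype ι] [DecidableEq ι] (M : Op ι) : ℝ :=
  ∑ i, Real.sqrt ((Matrix.isHermitian_conjTranspose_mul_self M).eigenvalues i)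

/-- The trace distance `½ ‖ρ - σ‖₁`. -/
def traceDist {ι : Type} [Fintype ι] [DecidableEq ι] (ρ σ : Op ι) : ℝ :=
  traceNorm (ρ - σ) / 2

/-- The pure state `|ψ⟩⟨ψ|`. -/
def pureState {n : ℕ} (ψ : EuclideanSpace ℂ (Reg n)) : Op (Reg n) :=
  Matrix.of fun i j => ψ i * star (ψ j)

/-! ### Protocols with black-box access to the evolution and to the block-encoding -/

/-- Ancilla registers: `w` workspace qubits, a time register of `k + 1` qubits, and the `b` ancilla
qubits of the block-encoding. -/
abbrev Anc (w k b : ℕ) : Type := Reg w × Reg (k + 1) × Reg b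

/-- The time in `{-2^k t₀, …, -t₀, 0, t₀, …, (2^k - 1) t₀}` labelled by a state of the time
register. -/
def timeValue (k : ℕ) (t₀ : ℝ) (j : Reg (k + 1)) : ℝ := t₀ * ((j.val : ℝ) - 2 ^ k)

/-- One step of a protocol: a unitary on the ancilla registers (it does not touch the system), or
one Heisenberg-evolved call of the block-encoding, or of its inverse, executed on the branches
on which the workspace satisfies `ctrl`. -/
inductive Step (w k b : ℕ) : Type
  | ancilla (U : Matrix.unitaryGroup (Anc w k b) ℂ)
  | call (ctrl : Reg w → Bool) (inverse : Bool)

/-- A measurement protocol. Its data mention neither the Hamiltonian nor the observable. It runs its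
steps in the order of the list, measures the workspace in the computational basis, reports the
number `estimate x` on outcome `x`, and returns the system register. -/
structure Protocol (b : ℕ) : Type where
  /-- number of workspace qubits -/
  w : ℕ
  /-- the time register has `k + 1` qubits -/
  k : ℕ
  /-- the time step -/
  t₀ : ℝ
  t₀_pos : 0 < t₀
  steps : List (Step w k b)
  estimate : Reg w → ℝ

section Gates

variable {w k b n : ℕ}

/-- The controlled evolution `∑ t, |t⟩⟨t| ⊗ e^{i s H t}`, where `s` is `1` or `-1`. -/
def evolutionGate (t₀ : ℝ) (H : Op (Reg n)) (s : ℝ) : Op (Anc w k b × Reg n) :=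
  Matrix.of fun p q =>
    if p.1 = q.1 then evolution H (s * timeValue k t₀ p.1.2.1) p.2 q.2 else 0

/-- `V` on the block-encoding register and the system, controlled by the workspace. -/
def controlledGate (V : Op (Reg b × Reg n)) (ctrl : Reg w → Bool) : Op (Anc w k b × Reg n) :=
  Matrix.of fun p q =>
    if p.1.1 = q.1.1 ∧ p.1.2.1 = q.1.2.1 then
      (if ctrl p.1.1 then V else 1) (p.1.2.2, p.2) (q.1.2.2, q.2)
    else 0

/-- The unitary of one step. A call is
`∑ t, |t⟩⟨t| ⊗ e^{i H t} V e^{-i H t}` (with `Vᴴ` for `V` if `inverse` is set). -/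
def Step.unitary (t₀ : ℝ) (H : Op (Reg n)) (V : Op (Reg b × Reg n)) :
    Step w k b → Op (Anc w k b × Reg n)
  | .ancilla U => (U : Op (Anc w k b)) ⊗ₖ (1 : Op (Reg n))
  | .call ctrl inverse =>
      evolutionGate t₀ H 1 * controlledGate (if inverse then Vᴴ else V) ctrl *
        evolutionGate t₀ H (-1)

/-- The number of calls to the block-encoding made by a step. -/
def Step.calls : Step w k b → ℕ
  | .ancilla _ => 0
  | .call _ _ => 1

/-- The Hamiltonian evolution time used by a step: the largest `|t|` in the time register, once for
the backward and once for the forward evolution. -/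
def Step.time (t₀ : ℝ) : Step w k b → ℝ
  | .ancilla _ => 0
  | .call _ _ => 2 * (t₀ * 2 ^ k)

end Gates

namespace Protocol

variable {b n : ℕ}

/-- Total number of calls to the block-encoding and its inverse. -/
def calls (P : Protocol b) : ℕ := (P.steps.map Step.calls).sum

/-- Total controlled Heisenberg evolution time. -/
def time (P : Protocol b) : ℝ := (P.steps.map (Step.time P.t₀)).sum

/-- All ancillas in `|0⟩` and the system in the given state. -/
def initial (P : Protocol b) (ψ : EuclideanSpace ℂ (Reg n)) : Anc P.w P.k b × Reg n → ℂ :=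
  fun p => if p.1 = (0, 0, 0) then ψ p.2 else 0

/-- The state vector after all steps, before the measurement. -/
def final (P : Protocol b) (H : Op (Reg n)) (V : Op (Reg b × Reg n))
    (ψ : EuclideanSpace ℂ (Reg n)) : Anc P.w P.k b × Reg n → ℂ :=
  P.steps.foldl (fun φ s => s.unitary P.t₀ H V *ᵥ φ) (P.initial ψ)

open Classical in
/-- The probability that the reported number is within `ε` of `a`. -/
def probWithin (P : Protocol b) (H : Op (Reg n)) (V : Op (Reg b × Reg n))
    (ψ : EuclideanSpace ℂ (Reg n)) (a ε : ℝ) : ℝ :=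
  ∑ p : Anc P.w P.k b × Reg n,
    if |P.estimate p.1.1 - a| ≤ ε then ‖P.final H V ψ p‖ ^ 2 else 0

/-- The returned state: the reduced density matrix of the system. -/
def returned (P : Protocol b) (H : Op (Reg n)) (V : Op (Reg b × Reg n))
    (ψ : EuclideanSpace ℂ (Reg n)) : Op (Reg n) :=
  Matrix.of fun i j => ∑ a, P.final H V ψ (a, i) * star (P.final H V ψ (a, j))

end Protocol

end CatalyticTomography

end

/-!
The expectation value `a = ⟨ψ|A|ψ⟩` is read off from a walk operator that rotates a plane containing
the ground state `ψ` by an angle depending on `a`. Measuring in this plane is harmless, because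
a few more rotations and measurements lead back to `ψ`.

*Filtering.* In general `ψ` is not an eigenvector of `A`. Average the Heisenberg evolution
`e^{iHt} A e^{-iHt}` over a distribution of times whose Fourier transform is tiny on `[Δ, ∞)`.
The component of `A ψ` at excitation energy `ω` is multiplied by the Fourier transform at `ω`, so
`ψ` is almost an eigenvector of the average, with eigenvalue `a` (`norm_filtered_sub_le`).
A sum of `2 ^ q` independent uniform times of length about `1 / Δ` will do (`exists_timeFilter`).
Since time is discrete, the filter fails at energies beyond `π / t₀`; the bound on the commutator
makes the weight there small, at the price of a small `t₀`, not of a large total time.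

*Walk.* A call with the time register in the square root of this distribution block-encodes the
average. A selector qubit mixes it with the identity, so that the eigenvalue becomes
`shifted a = cos θ` with `θ` well inside `(π / 4, π / 2)` (`signalProj_stepOp_embed`). Alternating
a call, the reflection about the initial state of the ancillas, the inverse call and again the
reflection rotates the plane of `ψ` and one further vector `f` by `2 θ`, up to the error of the
filter (`walk_rotation`, `walkOp_rotation`). The vector `f` is orthogonal to all states with the
ancillas in their initial state, so `ψ` and `f` are told apart by a flag that does not involve the
system.

*Measurement.* A round applies the walk operator `m` times and records in a fresh workspace bit
whether the flag has changed. A change has probability `sin² (2 m θ)` whether the flag was raised or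
not, so the recorded bits are independent (`recordAmp`, `program_error`) and obey a Chernoff bound
(`record_tail_le`). The powers `m = 2 ^ j` and `m = 2 ^ j + 1` for `j ≤ J`, each with constant
accuracy, determine `a` up to `2 ^ (-J)` (`decode`). Taking of order `(J - j + 1) log (1 / δ)`
rounds at level `j` makes the failure probabilities summable (`sum_not_consistent_le`) and keeps the
number of calls of order `2 ^ J log (1 / δ)` (`sum_roundPower_le`).

*Return.* Finally, of order `log (1 / δ)` rounds with `m = 1` act only while the flag is raised.
Each of them lowers it with a probability bounded below, because `cos² (2 θ)` is bounded away from
`1` (`sum_recordAmp_parity_le`, `cos_two_angle_sq_le`). With the flag lowered, the system is in the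
state `ψ` up to the accumulated error of the filter (`traceDist_of_close`).
-/

set_option linter.unusedSectionVars false

noncomputable section

namespace CatalyticTomography

/-! ### The classical record of the measured flags -/

section Record

variable {ι : Type} [DecidableEq ι]

/-- The bit string `x` with its `i`-th bit negated. -/
def flipBit (i : ι) (x : ι → Bool) : ι → Bool := Function.update x i (!x i)

@[simp] lemma flipBit_same (i : ι) (x : ι → Bool) : flipBit i x i = !x i := by
  simp [flipBit]

lemma flipBit_of_ne {i j : ι} (h : j ≠ i) (x : ι → Bool) : flipBit i x j = x j := by
  simp [flipBit, h]

lemma flipBit_involutive (i : ι) : Function.Involutive (flipBit i) := by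
  intro x
  ext j
  by_cases h : j = i
  · subst h; simp
  · simp [flipBit_of_ne h]

@[simp] lemma flipBit_flipBit (i : ι) (x : ι → Bool) : flipBit i (flipBit i x) = x :=
  flipBit_involutive i x

/-- The parity of a bit string. When the bits record the changes of a two-valued flag that starts
as `false`, this is the current value of the flag. -/
def parity {ι : Type} [Fintype ι] (x : ι → Bool) : Bool := decide ((∑ i, (x i).toNat) % 2 = 1)

@[simp] lemma parity_false {ι : Type} [Fintype ι] : parity (fun _ : ι => false) = false := by
  simp [parity]

variable [Fintype ι]

@[simp] lemma parity_flipBit (i : ι) (x : ι → Bool) : parity (flipBit i x) = !parity x := by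
  have h1 := Finset.add_sum_erase Finset.univ (fun j => (x j).toNat) (Finset.mem_univ i)
  have h2 := Finset.add_sum_erase Finset.univ (fun j => (flipBit i x j).toNat) (Finset.mem_univ i)
  have h3 : ∑ j ∈ Finset.univ.erase i, (flipBit i x j).toNat
      = ∑ j ∈ Finset.univ.erase i, (x j).toNat :=
    Finset.sum_congr rfl fun j hj => by rw [flipBit_of_ne (Finset.ne_of_mem_erase hj)]
  rw [h3] at h2
  simp only [flipBit_same] at h1 h2
  unfold parity
  rw [← h1, ← h2]
  generalize ∑ j ∈ Finset.univ.erase i, (x j).toNat = s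
  have : s % 2 = 0 ∨ s % 2 = 1 := by omega
  cases x i <;> rcases this with h | h <;> simp [Nat.add_mod, h]

lemma sum_flipBit {M : Type*} [AddCommMonoid M] (i : ι) (f : (ι → Bool) → M) :
    ∑ x, f (flipBit i x) = ∑ x, f x :=
  Equiv.sum_comp (flipBit_involutive i).toPerm f

/-- One round of the record on amplitudes: the flag is rotated by the angle `ϑ x`, which may depend
on the record `x` so far, and bit `i`, still `false`, records whether the flag has changed. -/
def stepAmp (ϑ : (ι → Bool) → ℝ) (i : ι) (a : (ι → Bool) → ℝ) : (ι → Bool) → ℝ := fun x =>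
  if x i then (if parity x then 1 else -1) * Real.sin (ϑ (flipBit i x)) * a (flipBit i x)
  else Real.cos (ϑ x) * a x

/-- The amplitude of the record after the rounds listed in `l`. -/
def recordAmp (ϑ : ι → (ι → Bool) → ℝ) (l : List ι) : (ι → Bool) → ℝ :=
  l.foldl (fun a i => stepAmp (ϑ i) i a) (fun x => if x = fun _ => false then 1 else 0)

lemma recordAmp_concat (ϑ : ι → (ι → Bool) → ℝ) (l : List ι) (i : ι) :
    recordAmp ϑ (l ++ [i]) = stepAmp (ϑ i) i (recordAmp ϑ l) := by
  simp [recordAmp]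

lemma recordAmp_eq_zero (ϑ : ι → (ι → Bool) → ℝ) (l : List ι) :
    ∀ {i : ι} {x : ι → Bool}, i ∉ l → x i = true → recordAmp ϑ l x = 0 := by
  induction l using List.reverseRecOn with
  | nil =>
    intro i x _ hx
    have : x ≠ fun _ => false := fun h => by simp [h] at hx
    simp [recordAmp, this]
  | append_singleton l j ih =>
    intro i x hi hx
    simp only [List.mem_append, List.mem_singleton, not_or] at hi
    have h1 := ih hi.1 hx
    have h2 : recordAmp ϑ l (flipBit j x) = 0 := ih hi.1 (by rw [flipBit_of_ne hi.2, hx])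
    rw [recordAmp_concat]
    simp [stepAmp, h1, h2]

/-- The expectation of `F` after a round, as an expectation before it. -/
lemma sum_stepAmp_sq (ϑ : (ι → Bool) → ℝ) (i : ι) (a F : (ι → Bool) → ℝ)
    (ha : ∀ x, x i = true → a x = 0) :
    ∑ x, stepAmp ϑ i a x ^ 2 * F x
      = ∑ x, a x ^ 2 * (Real.cos (ϑ x) ^ 2 * F x + Real.sin (ϑ x) ^ 2 * F (flipBit i x)) := by
  have h1 : ∀ x, stepAmp ϑ i a x ^ 2 * F x
      = a x ^ 2 * (Real.cos (ϑ x) ^ 2 * F x)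
        + (fun y => a y ^ 2 * (Real.sin (ϑ y) ^ 2 * F (flipBit i y))) (flipBit i x) := by
    intro x
    simp only [flipBit_flipBit]
    cases hx : x i
    · have : a (flipBit i x) = 0 := ha _ (by simp [hx])
      simp [stepAmp, hx, this]; ring
    · have : a x = 0 := ha _ hx
      simp only [stepAmp, hx, this]
      split_ifs <;> ring
  rw [Finset.sum_congr rfl fun x _ => h1 x, Finset.sum_add_distrib,
    sum_flipBit i (fun y => a y ^ 2 * (Real.sin (ϑ y) ^ 2 * F (flipBit i y))),
    ← Finset.sum_add_distrib]
  exact Finset.sum_congr rfl fun x _ => by ring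

lemma sum_recordAmp_concat (ϑ : ι → (ι → Bool) → ℝ) (l : List ι) (i : ι) (hi : i ∉ l)
    (F : (ι → Bool) → ℝ) :
    ∑ x, recordAmp ϑ (l ++ [i]) x ^ 2 * F x
      = ∑ x, recordAmp ϑ l x ^ 2 *
        (Real.cos (ϑ i x) ^ 2 * F x + Real.sin (ϑ i x) ^ 2 * F (flipBit i x)) := by
  rw [recordAmp_concat]
  exact sum_stepAmp_sq _ _ _ _ fun x hx => recordAmp_eq_zero ϑ l hi hx

lemma sum_recordAmp_sq (ϑ : ι → (ι → Bool) → ℝ) (l : List ι) (hl : l.Nodup) :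
    ∑ x, recordAmp ϑ l x ^ 2 = 1 := by
  induction l using List.reverseRecOn with
  | nil => simp [recordAmp]
  | append_singleton l j ih =>
    rw [List.nodup_append] at hl
    have hj : j ∉ l := fun h => hl.2.2 j h j (by simp) rfl
    have := sum_recordAmp_concat ϑ l j hj (fun _ => 1)
    simp only [mul_one, Real.cos_sq_add_sin_sq] at this
    rw [this, ih hl.1]

/-- The moment generating function of a centred Bernoulli variable. -/
lemma bernoulli_exp_le {p h : ℝ} (hp0 : 0 ≤ p) (hp1 : p ≤ 1) (hh : |h| ≤ 1) :
    (1 - p) * Real.exp (h * (0 - p)) + p * Real.exp (h * (1 - p)) ≤ Real.exp (h ^ 2) := by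
  have key : ∀ u : ℝ, |u| ≤ 1 → Real.exp u ≤ 1 + u + u ^ 2 := by
    intro u hu
    have := Real.abs_exp_sub_one_sub_id_le hu
    linarith [le_abs_self (Real.exp u - 1 - u)]
  have h1 : |h * (0 - p)| ≤ 1 := by
    rw [abs_mul, zero_sub, abs_neg, abs_of_nonneg hp0]
    exact mul_le_one₀ hh hp0 hp1
  have h2 : |h * (1 - p)| ≤ 1 := by
    rw [abs_mul, abs_of_nonneg (sub_nonneg.2 hp1)]
    exact mul_le_one₀ hh (sub_nonneg.2 hp1) (by linarith)
  have h3 := mul_le_mul_of_nonneg_left (key _ h1) (sub_nonneg.2 hp1)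
  have h4 := mul_le_mul_of_nonneg_left (key _ h2) hp0
  have h5 : h ^ 2 + 1 ≤ Real.exp (h ^ 2) := Real.add_one_le_exp _
  have h6 : h ^ 2 * (p * (1 - p)) ≤ h ^ 2 * 1 :=
    mul_le_mul_of_nonneg_left (by nlinarith) (sq_nonneg h)
  nlinarith

/-- The exponential moment of a weighted sum of centred bits. The weight vanishes on every bit whose
rotation angle depends on the earlier record. -/
lemma sum_recordAmp_exp_le (ϑ : ι → (ι → Bool) → ℝ) (h p : ι → ℝ) (hh : ∀ i, |h i| ≤ 1)
    (hp : ∀ i, h i = 0 ∨ ∀ x, Real.sin (ϑ i x) ^ 2 = p i) (l : List ι) (hl : l.Nodup) :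
    ∑ x, recordAmp ϑ l x ^ 2 * Real.exp (∑ i ∈ l.toFinset, h i * ((x i).toNat - p i))
      ≤ Real.exp (∑ i ∈ l.toFinset, h i ^ 2) := by
  induction l using List.reverseRecOn with
  | nil => simp [recordAmp]
  | append_singleton l j ih =>
    rw [List.nodup_append] at hl
    have hj : j ∉ l := fun h => hl.2.2 j h j (by simp) rfl
    have hj' : j ∉ l.toFinset := by simpa using hj
    have hins : (l ++ [j]).toFinset = insert j l.toFinset := by
      ext; simp
    rw [sum_recordAmp_concat ϑ l j hj, hins, Finset.sum_insert hj', Real.exp_add]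
    calc _ ≤ ∑ x, Real.exp (h j ^ 2) *
          (recordAmp ϑ l x ^ 2 * Real.exp (∑ i ∈ l.toFinset, h i * ((x i).toNat - p i))) := ?_
      _ ≤ _ := by
        rw [← Finset.mul_sum]
        exact mul_le_mul_of_nonneg_left (ih hl.1) (Real.exp_nonneg _)
    refine Finset.sum_le_sum fun x _ => ?_
    cases hx : x j with
    | true => simp [recordAmp_eq_zero ϑ l hj hx]
    | false =>
      have hfl : ∑ i ∈ l.toFinset, h i * (((flipBit j x i).toNat : ℝ) - p i)
          = ∑ i ∈ l.toFinset, h i * (((x i).toNat : ℝ) - p i) :=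
        Finset.sum_congr rfl fun i hi => by
          rw [flipBit_of_ne (ne_of_mem_of_not_mem hi hj')]
      simp only [Finset.sum_insert hj', Real.exp_add, hfl, flipBit_same, hx, Bool.toNat_false,
        Bool.not_false, Bool.toNat_true, Nat.cast_zero, Nat.cast_one]
      have hb : Real.cos (ϑ j x) ^ 2 * Real.exp (h j * (0 - p j))
          + Real.sin (ϑ j x) ^ 2 * Real.exp (h j * (1 - p j)) ≤ Real.exp (h j ^ 2) := by
        rcases hp j with h0 | h0
        · simp [h0]
        · rw [Real.cos_sq', h0 x]
          refine bernoulli_exp_le ?_ ?_ (hh j)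
          · rw [← h0 x]; positivity
          · rw [← h0 x]; exact Real.sin_sq_le_one _
      have hnn : 0 ≤ recordAmp ϑ l x ^ 2
          * Real.exp (∑ i ∈ l.toFinset, h i * (((x i).toNat : ℝ) - p i)) := by positivity
      nlinarith [mul_le_mul_of_nonneg_right hb hnn]

/-- A Chernoff bound for the record: the sum of the bits in `S`, each of which flips with
probability `p`, exceeds its mean by `t |S|` with exponentially small probability. The sign `s`
selects the upper or the lower tail. -/
lemma record_tail_le (ϑ : ι → (ι → Bool) → ℝ) (S : Finset ι) (p t s : ℝ) (ht0 : 0 ≤ t)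
    (ht1 : t ≤ 1) (hs : s = 1 ∨ s = -1) (hp : ∀ i ∈ S, ∀ x, Real.sin (ϑ i x) ^ 2 = p)
    (l : List ι) (hl : l.Nodup) (hS : ∀ i ∈ S, i ∈ l) :
    ∑ x with t * S.card < s * (∑ i ∈ S, (x i).toNat - p * S.card), recordAmp ϑ l x ^ 2
      ≤ Real.exp (-(t ^ 2 / 4 * S.card)) := by
  classical
  have hs2 : s ^ 2 = 1 := by rcases hs with rfl | rfl <;> norm_num
  have hsa : |s| = 1 := by rcases hs with rfl | rfl <;> norm_num
  -- `h = t / 2` optimizes the exponent `h ^ 2 - h t`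
  have main := sum_recordAmp_exp_le ϑ (fun i => if i ∈ S then s * (t / 2) else 0) (fun _ => p)
    (fun i => by
      split_ifs
      · rw [abs_mul, hsa, abs_of_nonneg (by linarith)]; linarith
      · simp)
    (fun i => by
      by_cases hi : i ∈ S
      · exact Or.inr (hp i hi)
      · exact Or.inl (if_neg hi)) l hl
  have hsub : l.toFinset.filter (· ∈ S) = S := by
    ext i; simpa using hS i
  have hvar : ∑ i ∈ l.toFinset, (if i ∈ S then s * (t / 2) else 0) ^ 2
      = t ^ 2 / 4 * S.card := by
    simp_rw [ite_pow]
    rw [zero_pow two_ne_zero, ← Finset.sum_filter, hsub, Finset.sum_const, mul_pow, hs2,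
      nsmul_eq_mul]
    ring
  have hlin : ∀ x : ι → Bool,
      ∑ i ∈ l.toFinset, (if i ∈ S then s * (t / 2) else 0) * (((x i).toNat : ℝ) - p)
        = t / 2 * (s * (∑ i ∈ S, (x i).toNat - p * S.card)) := by
    intro x
    simp_rw [ite_mul, zero_mul]
    rw [← Finset.sum_filter, hsub, ← Finset.mul_sum, Finset.sum_sub_distrib, Finset.sum_const,
      nsmul_eq_mul]
    push_cast
    ring
  simp only [hvar, hlin] at main
  have hge : Real.exp (t ^ 2 / 2 * S.card) *
      ∑ x with t * S.card < s * (∑ i ∈ S, (x i).toNat - p * S.card), recordAmp ϑ l x ^ 2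
      ≤ Real.exp (t ^ 2 / 4 * S.card) := by
    refine le_trans ?_ main
    rw [Finset.mul_sum]
    refine le_trans (Finset.sum_le_sum fun x hx => ?_)
      (Finset.sum_le_sum_of_subset_of_nonneg (Finset.filter_subset _ _)
        fun x _ _ => by positivity)
    rw [mul_comm]
    refine mul_le_mul_of_nonneg_left (Real.exp_le_exp.2 ?_) (sq_nonneg _)
    have := (Finset.mem_filter.1 hx).2
    push_cast
    nlinarith
  have : Real.exp (-(t ^ 2 / 4 * S.card))
      = Real.exp (t ^ 2 / 4 * S.card) / Real.exp (t ^ 2 / 2 * S.card) := by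
    rw [← Real.exp_sub]; congr 1; ring
  rw [this, le_div_iff₀ (Real.exp_pos _), mul_comm]
  exact hge

/-- Rounds that rotate the flag by `φ` exactly when it is raised lower it again, except with
probability `cos² φ` per round. -/
lemma sum_recordAmp_parity_le (ϑ : ι → (ι → Bool) → ℝ) (φ : ℝ) (l r : List ι)
    (hl : (l ++ r).Nodup) (hr : ∀ i ∈ r, ∀ x, ϑ i x = if parity x then φ else 0) :
    ∑ x with parity x = true, recordAmp ϑ (l ++ r) x ^ 2 ≤ (Real.cos φ ^ 2) ^ r.length := by
  have hE : ∀ l : List ι, ∑ x with parity x = true, recordAmp ϑ l x ^ 2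
      = ∑ x, recordAmp ϑ l x ^ 2 * (if parity x then 1 else 0) := fun l => by
    simp [Finset.sum_filter]
  induction r using List.reverseRecOn with
  | nil =>
    simp only [List.append_nil] at hl ⊢
    rw [List.length_nil, pow_zero, ← sum_recordAmp_sq ϑ l hl]
    exact Finset.sum_le_sum_of_subset_of_nonneg (Finset.filter_subset _ _)
      fun x _ _ => sq_nonneg _
  | append_singleton r j ih =>
    rw [← List.append_assoc] at hl ⊢
    have hl' := hl
    rw [List.nodup_append] at hl'
    have hj : j ∉ l ++ r := fun h => hl'.2.2 j h j (by simp) rfl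
    rw [hE, sum_recordAmp_concat ϑ (l ++ r) j hj]
    have ih' := ih hl'.1 fun i hi => hr i (by simp [hi])
    rw [hE] at ih'
    rw [List.length_append, List.length_singleton, pow_succ]
    refine le_trans (le_of_eq ?_) (mul_le_mul_of_nonneg_right ih' (sq_nonneg _))
    rw [Finset.sum_mul]
    refine Finset.sum_congr rfl fun x _ => ?_
    rw [hr j (by simp) x, parity_flipBit]
    cases parity x <;> simp

end Record

/-! ### Decoding the angle -/

section Decoding

/-- If `sin (K σ)` and `sin ((K + 1) σ)` are both small, then so is `sin σ`. Hence the difference of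
two candidate angles is visible at one of two consecutive multiples. -/
lemma abs_sin_le_add (K σ : ℝ) : |Real.sin σ| ≤ |Real.sin (K * σ)| + |Real.sin ((K + 1) * σ)| := by
  have h : Real.sin σ = Real.sin ((K + 1) * σ) * Real.cos (K * σ)
      - Real.cos ((K + 1) * σ) * Real.sin (K * σ) := by
    rw [← Real.sin_sub]; congr 1; ring
  rw [h]
  refine (abs_sub _ _).trans ?_
  rw [abs_mul, abs_mul, add_comm]
  have h1 := mul_le_of_le_one_left (abs_nonneg (Real.sin (K * σ)))
    (Real.abs_cos_le_one ((K + 1) * σ))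
  have h2 := mul_le_of_le_one_right (abs_nonneg (Real.sin ((K + 1) * σ)))
    (Real.abs_cos_le_one (K * σ))
  exact add_le_add h1 h2

lemma abs_le_of_abs_sin_le {u v : ℝ} (hu : |u| ≤ Real.pi / 2) (h : |Real.sin u| ≤ v) :
    |u| ≤ 8 / 5 * v := by
  have h1 : |Real.sin u| = Real.sin |u| := by
    rcases abs_cases u with ⟨h, h'⟩ | ⟨h, h'⟩
    · rw [h, abs_of_nonneg (Real.sin_nonneg_of_nonneg_of_le_pi h' (by
        rw [h] at hu; linarith [Real.pi_pos]))]
    · rw [h, Real.sin_neg, abs_of_nonpos (Real.sin_nonpos_of_nonpos_of_neg_pi_le h'.le (by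
        rw [h] at hu; linarith [Real.pi_pos]))]
  have h2 := Real.mul_le_sin (abs_nonneg u) hu
  rw [← h1] at h2
  have h3 : 2 / Real.pi * |u| ≤ v := h2.trans h
  have h4 : |u| * 2 ≤ v * Real.pi := by
    have := mul_le_mul_of_nonneg_right h3 Real.pi_pos.le
    rwa [mul_right_comm, div_mul_cancel₀ _ Real.pi_pos.ne', mul_comm] at this
  have hv : 0 ≤ v := (abs_nonneg _).trans h
  nlinarith [Real.pi_lt_d2]

/-- Two candidate angles `y`, `z` whose multiples by `1, 2, 4, …, 2 ^ J` and by the successors of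
these numbers have nearly the same cosines differ by at most `2⁻¹ 2 ^ (-J)`. -/
lemma angle_close {y z : ℝ} (J : ℕ) (hσ : 1 / 4 ≤ |Real.sin ((y + z) / 2)|)
    (hD : |y - z| ≤ Real.pi)
    (h : ∀ j ≤ J, ∀ b : Bool, |Real.cos (((2 ^ j + b.toNat : ℕ) : ℝ) * y)
      - Real.cos (((2 ^ j + b.toNat : ℕ) : ℝ) * z)| ≤ 1 / 26) :
    ∀ j ≤ J, |(2 : ℝ) ^ j * (y - z)| ≤ 1 / 2 := by
  have hprod : ∀ K : ℝ, |Real.cos (K * y) - Real.cos (K * z)| ≤ 1 / 26 →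
      |Real.sin (K * ((y + z) / 2))| * |Real.sin (K * ((y - z) / 2))| ≤ 1 / 52 := by
    intro K hK
    rw [Real.cos_sub_cos, abs_mul, abs_mul] at hK
    rw [show K * ((y + z) / 2) = (K * y + K * z) / 2 by ring,
      show K * ((y - z) / 2) = (K * y - K * z) / 2 by ring]
    norm_num at hK
    linarith
  have hdiv : ∀ s c u : ℝ, c ≤ |s| → 0 < c → |s| * |Real.sin u| ≤ 1 / 52 →
      |Real.sin u| ≤ 1 / 52 / c := by
    intro s c u hs hc hsu
    rw [le_div_iff₀ hc]
    nlinarith [abs_nonneg (Real.sin u)]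
  intro j
  induction j with
  | zero =>
    -- `hD` excludes wrap-around at the coarsest scale
    intro _
    have h0 := hprod 1 (by simpa using h 0 (Nat.zero_le _) false)
    rw [one_mul, one_mul] at h0
    have h1 := hdiv _ _ _ hσ (by norm_num) h0
    have h2 := abs_le_of_abs_sin_le (u := (y - z) / 2) (by
      rw [abs_div, abs_two]; linarith) h1
    rw [abs_div, abs_two] at h2
    rw [pow_zero, one_mul]
    linarith
  | succ j ih =>
    intro hj
    have ih' := ih (by omega)
    rw [abs_mul, abs_of_pos (by positivity : (0 : ℝ) < 2 ^ j)] at ih'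
    have hp1 : (1 : ℝ) ≤ 2 ^ j := one_le_pow₀ (by norm_num)
    have hA := hprod (2 ^ (j + 1)) (by simpa using h (j + 1) hj false)
    have hB := hprod (2 ^ (j + 1) + 1) (by simpa using h (j + 1) hj true)
    have hsin := abs_sin_le_add (2 ^ (j + 1)) ((y + z) / 2)
    have hpi := Real.pi_gt_three
    have habs : ∀ K : ℝ, 0 < K → |K * ((y - z) / 2)| = K * |y - z| / 2 := by
      intro K hK
      rw [abs_mul, abs_div, abs_two, abs_of_pos hK]; ring
    -- By induction the angle `2 ^ (j + 1) (y - z) / 2` is at most `1 / 2`, so that its sine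
    -- controls it. One of the two powers has a sine of the half-sum of at least `1 / 8`.
    have hgoal : |(2 : ℝ) ^ (j + 1) * ((y - z) / 2)| ≤ 1 / 4 := by
      rcases le_total (1 / 8) |Real.sin (2 ^ (j + 1) * ((y + z) / 2))| with hc | hc
      · have h1 := hdiv _ _ _ hc (by norm_num) hA
        have h2 := abs_le_of_abs_sin_le (by
          rw [habs _ (by positivity), pow_succ]; nlinarith) h1
        linarith
      · have h1 := hdiv _ (1 / 8) _ (by linarith) (by norm_num) hB
        have h2 := abs_le_of_abs_sin_le (by
          rw [habs _ (by positivity), pow_succ]; nlinarith [abs_nonneg (y - z)]) h1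
        rw [habs _ (by positivity)] at h2 ⊢
        nlinarith [abs_nonneg (y - z)]
    rw [habs _ (by positivity)] at hgoal
    rw [abs_mul, abs_of_pos (by positivity)]
    linarith

/-- The expectation value `a ∈ [-1, 1]` of the observable, compressed into an interval in the
interior of `(0, 1 / √2)`. Then `4 θ`, for the angle `θ` with this cosine, lies in the interior of
`(π, 2 π)`, where the cosine is injective, so that there is no ambiguity at the coarsest scale. -/
def shifted (a : ℝ) : ℝ := (200 + 108 * a) / 533

/-- The angle `θ` with `cos θ = shifted a`. -/
def angle (a : ℝ) : ℝ := Real.arccos (shifted a)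

lemma shifted_mem {a : ℝ} (ha : |a| ≤ 1) : 17 / 100 ≤ shifted a ∧ shifted a ≤ 29 / 50 := by
  obtain ⟨h1, h2⟩ := abs_le.1 ha
  unfold shifted
  constructor <;> linarith

lemma cos_angle {a : ℝ} (ha : |a| ≤ 1) : Real.cos (angle a) = shifted a := by
  obtain ⟨h1, h2⟩ := shifted_mem ha
  exact Real.cos_arccos (by linarith) (by linarith)

lemma angle_mem {a : ℝ} (ha : |a| ≤ 1) :
    Real.pi / 4 + 1 / 10 ≤ angle a ∧ angle a ≤ Real.pi / 2 - 1 / 10 := by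
  obtain ⟨h1, h2⟩ := shifted_mem ha
  have hc := cos_angle ha
  have h0 : 0 ≤ angle a := Real.arccos_nonneg _
  have hle : angle a ≤ Real.pi / 2 := Real.arccos_le_pi_div_two.2 (by linarith)
  constructor
  · have h4 : Real.cos (Real.pi / 4) - Real.cos (angle a) ≤ |Real.pi / 4 - angle a| :=
      (le_abs_self _).trans (by
        simpa [Real.dist_eq] using Real.lipschitzWith_cos.dist_le_mul (Real.pi / 4) (angle a))
    rw [Real.cos_pi_div_four, hc] at h4
    have h5 : (1.4 : ℝ) ≤ √2 := Real.le_sqrt_of_sq_le (by norm_num)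
    have h6 : Real.pi / 4 ≤ angle a := by
      by_contra hlt
      push Not at hlt
      have := Real.cos_le_cos_of_nonneg_of_le_pi h0 (by linarith [Real.pi_pos]) hlt.le
      rw [hc, Real.cos_pi_div_four] at this
      linarith
    rw [abs_of_nonpos (by linarith)] at h4
    linarith
  · have h3 : Real.sin (Real.pi / 2 - angle a) ≤ Real.pi / 2 - angle a :=
      Real.sin_le (by linarith)
    rw [Real.sin_pi_div_two_sub, hc] at h3
    linarith

/-- Flip frequencies at all the powers `2 ^ j`, `2 ^ j + 1` determine the expectation value. -/
lemma decode {a a' : ℝ} (ha : |a| ≤ 1) (ha' : |a'| ≤ 1) (J : ℕ)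
    (h : ∀ j ≤ J, ∀ b : Bool,
      |Real.sin (((2 ^ j + b.toNat : ℕ) : ℝ) * (2 * angle a)) ^ 2
        - Real.sin (((2 ^ j + b.toNat : ℕ) : ℝ) * (2 * angle a')) ^ 2| ≤ 1 / 52) :
    |a - a'| ≤ 1 / 2 ^ J := by
  obtain ⟨h1, h2⟩ := angle_mem ha
  obtain ⟨h1', h2'⟩ := angle_mem ha'
  have hpi := Real.pi_gt_three
  have hpi' := Real.pi_lt_d2
  have hclose := angle_close (y := 4 * angle a) (z := 4 * angle a') J ?_ ?_ ?_ J le_rfl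
  · rw [← mul_sub, abs_mul, abs_of_pos (by positivity), abs_mul] at hclose
    have hlip : |shifted a - shifted a'| ≤ |angle a - angle a'| := by
      rw [← cos_angle ha, ← cos_angle ha']
      simpa [Real.dist_eq] using Real.lipschitzWith_cos.dist_le_mul (angle a) (angle a')
    have hsh : |a - a'| = 533 / 108 * |shifted a - shifted a'| := by
      rw [show a - a' = 533 / 108 * (shifted a - shifted a') by unfold shifted; ring, abs_mul]
      norm_num
    rw [le_div_iff₀ (by positivity), hsh]
    norm_num at hclose
    have hp : (0 : ℝ) < 2 ^ J := by positivity
    nlinarith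
  · rw [show (4 * angle a + 4 * angle a') / 2
      = (2 * (angle a + angle a') - Real.pi) + Real.pi by ring, Real.sin_add_pi, abs_neg]
    set u := 2 * (angle a + angle a') - Real.pi with hu
    have hu1 : 2 / 5 ≤ u := by linarith
    have hu2 : u ≤ Real.pi - 2 / 5 := by linarith
    have hj : ∀ v : ℝ, 2 / 5 ≤ v → v ≤ Real.pi / 2 → 1 / 4 ≤ Real.sin v := by
      intro v hv1 hv2
      refine le_trans ?_ (Real.mul_le_sin (by linarith) hv2)
      rw [div_mul_eq_mul_div, le_div_iff₀ Real.pi_pos]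
      linarith
    refine le_trans ?_ (le_abs_self _)
    rcases le_total u (Real.pi / 2) with h | h
    · exact hj u hu1 h
    · rw [← Real.sin_pi_sub]
      exact hj _ (by linarith) (by linarith)
  · rw [abs_le]; constructor <;> linarith
  · intro j hj b
    have := h j hj b
    rw [Real.sin_sq_eq_half_sub, Real.sin_sq_eq_half_sub] at this
    rw [show ∀ x : ℝ, x * (4 * angle a) = 2 * (x * (2 * angle a)) from fun x => by ring,
      show ∀ x : ℝ, x * (4 * angle a') = 2 * (x * (2 * angle a')) from fun x => by ring,
      ← abs_neg]
    rw [show ∀ x y : ℝ, (1 / 2 - x / 2 - (1 / 2 - y / 2)) = -(x - y) / 2 from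
      fun x y => by ring, abs_div, abs_two] at this
    linarith

/-- A reset round succeeds with constant probability. -/
lemma cos_two_angle_sq_le {a : ℝ} (ha : |a| ≤ 1) : Real.cos (2 * angle a) ^ 2 ≤ 93 / 100 := by
  obtain ⟨h1, h2⟩ := shifted_mem ha
  rw [Real.cos_two_mul, cos_angle ha]
  have h3 : |2 * shifted a ^ 2 - 1| ≤ 19 / 20 := abs_le.2 ⟨by nlinarith, by nlinarith⟩
  have h4 := pow_le_pow_left₀ (abs_nonneg _) h3 2
  rw [sq_abs] at h4
  linarith

end Decoding

/-! ### Trace norms of sums of rank-one operators -/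

section TraceNorm

variable {ι : Type} [Fintype ι] [DecidableEq ι]

lemma ofLp_toEuclideanLin {κ : Type} [Fintype κ] [DecidableEq κ] (M : Matrix κ κ ℂ)
    (v : EuclideanSpace ℂ κ) : (Matrix.toEuclideanLin M v).ofLp = M *ᵥ v.ofLp := rfl

open scoped ComplexOrder in
/-- The triangle inequality for the trace norm in the form needed here. The trace norm of `M` is
`∑ ⟨w i, M (u i)⟩` for the right singular vectors `u` and the left singular vectors `w`, and
Bessel's inequality bounds the contribution of each rank-one term. -/
lemma traceNorm_le_of_eq_sum {α : Type} [Fintype α] (M : Op ι) (x y : α → EuclideanSpace ℂ ι)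
    (hM : ∀ v, Matrix.toEuclideanLin M v = ∑ a, inner ℂ (y a) v • x a) :
    traceNorm M ≤ ∑ a, ‖x a‖ * ‖y a‖ := by
  classical
  have hH := Matrix.isHermitian_conjTranspose_mul_self M
  set u := hH.eigenvectorBasis with hu
  set T := Matrix.toEuclideanLin M with hT
  set σ : ι → ℝ := fun i => √(hH.eigenvalues i) with hσ
  have hinner : ∀ i j, inner ℂ (T (u i)) (T (u j)) = if i = j then ((σ i ^ 2 : ℝ) : ℂ) else 0 := by
    intro i j
    rw [← LinearMap.adjoint_inner_right, hT, ← Matrix.toEuclideanLin_conjTranspose_eq_adjoint]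
    have h1 : Matrix.toEuclideanLin Mᴴ (Matrix.toEuclideanLin M (u j))
        = ((hH.eigenvalues j : ℝ) : ℂ) • u j := by
      have h2 := hH.mulVec_eigenvectorBasis j
      apply (WithLp.ofLp_injective 2)
      simp only [ofLp_toEuclideanLin, Matrix.mulVec_mulVec, WithLp.ofLp_smul]
      rw [hu, h2]
      ext; simp
    rw [h1, inner_smul_right, orthonormal_iff_ite.1 u.orthonormal i j]
    have hnn : 0 ≤ hH.eigenvalues j :=
      (Matrix.posSemidef_conjTranspose_mul_self M).eigenvalues_nonneg j
    split_ifs with hij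
    · subst hij; rw [hσ]; simp [Real.sq_sqrt hnn]
    · simp
  let s := {i : ι // σ i ≠ 0}
  let w : s → EuclideanSpace ℂ ι := fun i => ((σ i.1 : ℂ)⁻¹) • T (u i.1)
  have hw : Orthonormal ℂ w := by
    rw [orthonormal_iff_ite]
    intro i j
    simp only [w, inner_smul_left, inner_smul_right, hinner]
    have h0 : (σ i.1 : ℂ) ≠ 0 := by exact_mod_cast i.2
    by_cases hij : i = j
    · subst hij
      simp
      field_simp
    · have : i.1 ≠ j.1 := fun h => hij (Subtype.ext h)
      simp [hij, this]
  have hval : ∀ i : s, σ i.1 ≤ ∑ a, ‖inner ℂ (w i) (x a)‖ * ‖inner ℂ (y a) (u i.1)‖ := by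
    intro i
    have h0 : (σ i.1 : ℂ) ≠ 0 := by exact_mod_cast i.2
    have h1 : inner ℂ (w i) (T (u i.1)) = (σ i.1 : ℂ) := by
      simp only [w, inner_smul_left, hinner]
      simp
      field_simp
    have h2 : (σ i.1 : ℝ) = ‖inner ℂ (w i) (T (u i.1))‖ := by
      rw [h1, Complex.norm_real, Real.norm_of_nonneg (Real.sqrt_nonneg _)]
    rw [h2, hM, inner_sum]
    refine (norm_sum_le _ _).trans (Finset.sum_le_sum fun a _ => ?_)
    rw [inner_smul_right, norm_mul, mul_comm]
  have htr : traceNorm M = ∑ i : s, σ i.1 := by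
    have h1 : traceNorm M = ∑ i, σ i := rfl
    rw [h1, ← Finset.sum_filter_ne_zero]
    exact Finset.sum_subtype _ (fun i => by simp) _
  rw [htr]
  refine (Finset.sum_le_sum fun i _ => hval i).trans ?_
  rw [Finset.sum_comm]
  refine Finset.sum_le_sum fun a _ => ?_
  refine (Real.sum_mul_le_sqrt_mul_sqrt _ _ _).trans ?_
  refine mul_le_mul ?_ ?_ (Real.sqrt_nonneg _) (norm_nonneg _)
  · rw [← Real.sqrt_sq (norm_nonneg (x a))]
    exact Real.sqrt_le_sqrt (hw.sum_inner_products_le (x a) (s := Finset.univ))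
  · rw [← Real.sqrt_sq (norm_nonneg (y a))]
    refine Real.sqrt_le_sqrt ?_
    rw [← u.sum_sq_norm_inner_left (y a)]
    rw [← Finset.sum_subtype (Finset.univ.filter fun i => σ i ≠ 0) (fun i => by simp)
      (fun i => ‖inner ℂ (y a) (u i)‖ ^ 2)]
    exact Finset.sum_le_sum_of_subset_of_nonneg (Finset.filter_subset _ _)
      fun _ _ _ => sq_nonneg _

end TraceNorm

/-! ### The time filter -/

section Filter

lemma norm_geom_sum_exp_le (M : ℕ) {u : ℝ} (hu : 0 < u) (huπ : u ≤ Real.pi) :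
    ‖∑ i ∈ Finset.range M, Complex.exp (Complex.I * u) ^ i‖ ≤ Real.pi / u := by
  set z := Complex.exp (Complex.I * u) with hz
  have hz1 : ‖z‖ = 1 := by rw [hz, mul_comm]; exact Complex.norm_exp_ofReal_mul_I u
  have hlow : 2 * u / Real.pi ≤ ‖z - 1‖ := by
    rw [hz, Complex.norm_exp_I_mul_ofReal_sub_one, Real.norm_eq_abs]
    refine le_trans ?_ (le_abs_self _)
    have := Real.mul_le_sin (x := u / 2) (by linarith) (by linarith)
    calc 2 * u / Real.pi = 2 * (2 / Real.pi * (u / 2)) := by ring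
      _ ≤ _ := by linarith
  have hpos : 0 < ‖z - 1‖ := lt_of_lt_of_le (by positivity) hlow
  have hne : z ≠ 1 := fun h => by simp [h] at hpos
  rw [geom_sum_eq hne, norm_div, div_le_iff₀ hpos]
  have h2 : ‖z ^ M - 1‖ ≤ 2 := by
    refine (norm_sub_le _ _).trans ?_
    rw [norm_pow, hz1]; norm_num
  refine h2.trans ?_
  calc (2 : ℝ) = Real.pi / u * (2 * u / Real.pi) := by field_simp
    _ ≤ _ := mul_le_mul_of_nonneg_left hlow (by positivity)

/-- A probability distribution on the times whose Fourier transform is small on `[Δ, ∞)`: the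
distribution of a sum of `r` independent uniform variables, each with `2 ^ p` values. Its Fourier
transform is the `r`-th power of a Dirichlet kernel; the second summand pays for the
frequencies beyond `π / t₀`, where it fails to be small because the time is discrete. -/
lemma exists_timeFilter {Δ : ℝ} (hΔ : 0 < Δ) {p q k : ℕ} (hk : p + q = k + 1) :
    ∃ c : Reg (k + 1) → ℝ, (∀ j, 0 ≤ c j) ∧ ∑ j, c j = 1 ∧ ∀ ω, Δ ≤ ω →
      ‖∑ j, (c j : ℂ) * Complex.exp (Complex.I *
        ((ω * timeValue k (2 * Real.pi / (Δ * 2 ^ p)) j : ℝ) : ℂ))‖ ^ 2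
        ≤ (1 / 4) ^ 2 ^ q + (ω * (2 * Real.pi / (Δ * 2 ^ p))) ^ 2 := by
  set t₀ := 2 * Real.pi / (Δ * 2 ^ p) with ht₀
  have ht₀pos : 0 < t₀ := by positivity
  let P : Polynomial ℕ := (∑ i ∈ Finset.range (2 ^ p), Polynomial.X ^ i) ^ 2 ^ q
  have hdeg : P.natDegree < 2 ^ (k + 1) := by
    have h1 : (∑ i ∈ Finset.range (2 ^ p), (Polynomial.X : Polynomial ℕ) ^ i).natDegree
        ≤ 2 ^ p - 1 := by
      refine Polynomial.natDegree_sum_le_of_forall_le _ _ fun i hi => ?_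
      rw [Polynomial.natDegree_X_pow]
      have := Finset.mem_range.1 hi
      omega
    have h2 : P.natDegree ≤ 2 ^ q * (2 ^ p - 1) :=
      Polynomial.natDegree_pow_le.trans (Nat.mul_le_mul_left _ h1)
    have h3 : 2 ^ (k + 1) = 2 ^ q * 2 ^ p := by rw [← hk, pow_add, mul_comm]
    rw [h3]
    refine lt_of_le_of_lt h2 (Nat.mul_lt_mul_of_pos_left ?_ (by positivity))
    have : 0 < 2 ^ p := by positivity
    omega
  have heval : ∀ {K : Type} [Field K] [CharZero K] (z : K),
      ∑ j : Reg (k + 1), ((P.coeff j.val : K) / (2 ^ p) ^ 2 ^ q) * z ^ j.val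
        = ((∑ i ∈ Finset.range (2 ^ p), z ^ i) / 2 ^ p) ^ 2 ^ q := by
    intro K _ _ z
    have h1 := Polynomial.eval₂_eq_sum_range' (Nat.castRingHom K) hdeg z
    rw [← Fin.sum_univ_eq_sum_range (fun j => (Nat.castRingHom K) (P.coeff j) * z ^ j)] at h1
    have h2 : Polynomial.eval₂ (Nat.castRingHom K) z P
        = (∑ i ∈ Finset.range (2 ^ p), z ^ i) ^ 2 ^ q := by
      simp [P, Polynomial.eval₂_pow, Polynomial.eval₂_finsetSum]
    rw [div_pow, ← h2, h1, Finset.sum_div]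
    exact Finset.sum_congr rfl fun j _ => by simp; ring
  refine ⟨fun j => (P.coeff j.val : ℝ) / (2 ^ p) ^ 2 ^ q, fun j => by positivity, ?_, ?_⟩
  · have := heval (K := ℝ) 1
    simpa using this
  · intro ω hω
    have hωpos : 0 < ω := hΔ.trans_le hω
    set z := Complex.exp (Complex.I * ((ω * t₀ : ℝ) : ℂ)) with hz
    have hz1 : ‖z‖ = 1 := by rw [hz, mul_comm]; exact Complex.norm_exp_ofReal_mul_I _
    have hsum : ∑ j : Reg (k + 1), (((P.coeff j.val : ℝ) / (2 ^ p) ^ 2 ^ q : ℝ) : ℂ)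
          * Complex.exp (Complex.I * ((ω * timeValue k t₀ j : ℝ) : ℂ))
        = Complex.exp (((-(ω * t₀ * 2 ^ k) : ℝ) : ℂ) * Complex.I) *
          ((∑ i ∈ Finset.range (2 ^ p), z ^ i) / 2 ^ p) ^ 2 ^ q := by
      rw [← heval z, Finset.mul_sum]
      refine Finset.sum_congr rfl fun j _ => ?_
      have h3 : Complex.exp (Complex.I * ((ω * timeValue k t₀ j : ℝ) : ℂ))
          = Complex.exp (((-(ω * t₀ * 2 ^ k) : ℝ) : ℂ) * Complex.I) * z ^ j.val := by
        rw [hz, ← Complex.exp_nat_mul, ← Complex.exp_add]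
        congr 1
        unfold timeValue
        push_cast
        ring
      rw [h3]
      push_cast
      ring
    rw [hsum, norm_mul, Complex.norm_exp_ofReal_mul_I, one_mul, norm_pow, norm_div, norm_pow,
      Complex.norm_ofNat]
    rcases le_total (ω * t₀) Real.pi with hle | hge
    · have h4 := norm_geom_sum_exp_le (2 ^ p) (mul_pos hωpos ht₀pos) hle
      have h5 : ‖∑ i ∈ Finset.range (2 ^ p), z ^ i‖ / 2 ^ p ≤ 1 / 2 := by
        rw [div_le_iff₀ (by positivity)]
        refine h4.trans ?_
        rw [div_le_iff₀ (by positivity), ht₀]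
        calc Real.pi = 1 / 2 * 2 ^ p * (Δ * (2 * Real.pi / (Δ * 2 ^ p))) := by field_simp
          _ ≤ _ := by gcongr
      have h6 := pow_le_pow_left₀ (by positivity) h5 (2 ^ q * 2)
      rw [← pow_mul]
      refine h6.trans ?_
      rw [mul_comm (2 ^ q) 2, pow_mul]
      norm_num
      positivity
    · have h5 : ‖∑ i ∈ Finset.range (2 ^ p), z ^ i‖ / 2 ^ p ≤ 1 := by
        rw [div_le_one (by positivity)]
        refine (norm_sum_le _ _).trans ?_
        simp [hz1]
      have h6 := pow_le_one₀ (n := 2 ^ q * 2) (by positivity) h5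
      rw [← pow_mul]
      refine h6.trans ?_
      have h7 : 1 ≤ ω * t₀ := by linarith [Real.pi_gt_three]
      have : (0 : ℝ) ≤ (1 / 4) ^ 2 ^ q := by positivity
      nlinarith

end Filter

/-! ### The filtered observable -/

section Filtered

variable {κ : Type} [Fintype κ] [DecidableEq κ]

lemma toEuclideanLin_mul_apply (M N : Matrix κ κ ℂ) (v : EuclideanSpace ℂ κ) :
    Matrix.toEuclideanLin (M * N) v = Matrix.toEuclideanLin M (Matrix.toEuclideanLin N v) := by
  apply WithLp.ofLp_injective 2
  simp [Matrix.mulVec_mulVec]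

lemma toEuclideanLin_one_apply (v : EuclideanSpace ℂ κ) :
    Matrix.toEuclideanLin (1 : Matrix κ κ ℂ) v = v := by
  apply WithLp.ofLp_injective 2
  simp

lemma inner_toEuclideanLin_right (M : Matrix κ κ ℂ) (x y : EuclideanSpace ℂ κ) :
    inner ℂ x (Matrix.toEuclideanLin M y) = inner ℂ (Matrix.toEuclideanLin Mᴴ x) y := by
  rw [Matrix.toEuclideanLin_conjTranspose_eq_adjoint, LinearMap.adjoint_inner_left]

lemma norm_toEuclideanLin_le (M : Matrix κ κ ℂ) (x : EuclideanSpace ℂ κ) :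
    ‖Matrix.toEuclideanLin M x‖ ≤ ‖M‖ * ‖x‖ := by
  exact M.l2_opNorm_mulVec x

lemma norm_toEuclideanLin_of_mem_unitary {U : Matrix κ κ ℂ} (hU : U ∈ Matrix.unitaryGroup κ ℂ)
    (x : EuclideanSpace ℂ κ) : ‖Matrix.toEuclideanLin U x‖ = ‖x‖ := by
  have h : inner ℂ (Matrix.toEuclideanLin U x) (Matrix.toEuclideanLin U x) = inner ℂ x x := by
    rw [inner_toEuclideanLin_right, ← toEuclideanLin_mul_apply, ← Matrix.star_eq_conjTranspose,
      Matrix.mem_unitaryGroup_iff'.1 hU, toEuclideanLin_one_apply]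
  rw [inner_self_eq_norm_sq_to_K, inner_self_eq_norm_sq_to_K] at h
  have h2 : ‖Matrix.toEuclideanLin U x‖ ^ 2 = ‖x‖ ^ 2 := by exact_mod_cast h
  exact (pow_left_inj₀ (norm_nonneg _) (norm_nonneg _) two_ne_zero).1 h2

variable {n : ℕ}

lemma evolution_apply_of_eigenvector (H : Op (Reg n)) (t E : ℝ) (v : EuclideanSpace ℂ (Reg n))
    (hv : Matrix.toEuclideanLin H v = (E : ℂ) • v) :
    Matrix.toEuclideanLin (evolution H t) v = Complex.exp (Complex.I * ((E * t : ℝ) : ℂ)) • v := by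
  set c : ℂ := Complex.I * (t : ℂ) with hc
  let Φ : Op (Reg n) →ₗ[ℂ] EuclideanSpace ℂ (Reg n) :=
    { toFun := fun M => Matrix.toEuclideanLin M v
      map_add' := fun M N => by simp
      map_smul' := fun a M => by simp }
  have hcont : Continuous Φ := LinearMap.continuous_of_finiteDimensional Φ
  have h1 : HasSum (fun m : ℕ => ((m.factorial : ℂ)⁻¹) • (c • H) ^ m) (evolution H t) :=
    NormedSpace.exp_series_hasSum_exp' (𝕂 := ℂ) (c • H)
  have h2 := h1.map Φ hcont
  have h3 : HasSum (fun m : ℕ => ((m.factorial : ℂ)⁻¹) • (c * E) ^ m) (Complex.exp (c * E)) := by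
    rw [Complex.exp_eq_exp_ℂ]
    exact NormedSpace.exp_series_hasSum_exp' (𝕂 := ℂ) (c * (E : ℂ))
  have h4 := h3.smul_const v
  have hpow : ∀ m : ℕ, Φ ((c • H) ^ m) = (c * E) ^ m • v := by
    intro m
    induction m with
    | zero => simp [Φ]
    | succ m ih =>
      have : Φ ((c • H) ^ (m + 1)) = Matrix.toEuclideanLin (c • H) (Φ ((c • H) ^ m)) := by
        rw [pow_succ']; exact toEuclideanLin_mul_apply _ _ _
      rw [this, ih, map_smul, map_smul, LinearMap.smul_apply, hv, smul_smul, smul_smul, pow_succ,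
        mul_assoc]
  have h5 : (Φ ∘ fun m : ℕ => ((m.factorial : ℂ)⁻¹) • (c • H) ^ m)
      = fun m : ℕ => (((m.factorial : ℂ)⁻¹) • (c * E) ^ m) • v := by
    ext1 m
    simp only [Function.comp_apply, map_smul, hpow, smul_assoc]
  rw [h5] at h2
  have h6 : Φ (evolution H t) = Complex.exp (c * E) • v := h2.unique h4
  have h7 : c * E = Complex.I * ((E * t : ℝ) : ℂ) := by rw [hc]; push_cast; ring
  rw [← h7]
  exact h6

lemma conjTranspose_evolution {H : Op (Reg n)} (hH : H.IsHermitian) (t : ℝ) :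
    (evolution H t)ᴴ = evolution H (-t) := by
  unfold evolution
  rw [← Matrix.exp_conjTranspose, Matrix.conjTranspose_smul, hH.eq]
  congr 2
  simp

lemma evolution_mul_evolution_neg (H : Op (Reg n)) (t : ℝ) :
    evolution H t * evolution H (-t) = 1 := by
  unfold evolution
  rw [← Matrix.exp_add_of_commute _ _ ((Commute.refl H).smul_left _ |>.smul_right _), ← add_smul]
  simp

lemma evolution_neg_mul_evolution (H : Op (Reg n)) (t : ℝ) :
    evolution H (-t) * evolution H t = 1 := by
  simpa using evolution_mul_evolution_neg H (-t)

lemma inner_toEuclideanLin_self {A : Op (Reg n)} (hA : A.IsHermitian)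
    (ψ : EuclideanSpace ℂ (Reg n)) :
    inner ℂ ψ (Matrix.toEuclideanLin A ψ) = (expectation A ψ : ℂ) := by
  have h : (starRingEnd ℂ) (inner ℂ ψ (Matrix.toEuclideanLin A ψ))
      = inner ℂ ψ (Matrix.toEuclideanLin A ψ) := by
    rw [inner_conj_symm, inner_toEuclideanLin_right, hA.eq]
  exact (Complex.conj_eq_iff_re.1 h).symm

lemma abs_expectation_le_one {A : Op (Reg n)} (hA1 : ‖A‖ ≤ 1) {ψ : EuclideanSpace ℂ (Reg n)}
    (hψ : ‖ψ‖ = 1) : |expectation A ψ| ≤ 1 := by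
  refine (Complex.abs_re_le_norm _).trans ((norm_inner_le_norm _ _).trans ?_)
  have := norm_toEuclideanLin_le A ψ
  rw [hψ] at *
  linarith

lemma IsGappedGroundState.norm_eq_one {H : Op (Reg n)} {Δ : ℝ} {ψ : EuclideanSpace ℂ (Reg n)}
    (h : IsGappedGroundState H Δ ψ) : ‖ψ‖ = 1 := by
  obtain ⟨E, v, -, -, hv0, -⟩ := h
  rw [← hv0, v.orthonormal.1]

/-- Filtering the Heisenberg evolution of `A` turns the ground state into an approximate
eigenvector: in the energy basis the component of `A ψ` at excitation energy `ω ≥ Δ` is multiplied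
by the Fourier transform of the filter. The commutator bounds the components at high energy. -/
lemma norm_filtered_sub_le {H A : Op (Reg n)} (hH : H.IsHermitian) (hA : A.IsHermitian)
    (hA1 : ‖A‖ ≤ 1) {L Δ : ℝ} (hL : ‖A * H - H * A‖ ≤ L) {ψ : EuclideanSpace ℂ (Reg n)}
    (hψ : IsGappedGroundState H Δ ψ) {T : Type} [Fintype T] (c : T → ℝ) (τ : T → ℝ)
    (hc1 : ∑ j, c j = 1) {B t₀ : ℝ} (hB : 0 ≤ B)
    (hfilter : ∀ ω, Δ ≤ ω →
      ‖∑ j, (c j : ℂ) * Complex.exp (Complex.I * ((ω * τ j : ℝ) : ℂ))‖ ^ 2 ≤ B + (ω * t₀) ^ 2) :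
    ‖(∑ j, (c j : ℂ) • Matrix.toEuclideanLin (evolution H (τ j) * A * evolution H (-τ j)) ψ)
      - (expectation A ψ : ℂ) • ψ‖ ^ 2 ≤ B + (t₀ * L) ^ 2 := by
  have hψ1 := hψ.norm_eq_one
  obtain ⟨E, v, -, hE, hv0, hgap⟩ := hψ
  set y := Matrix.toEuclideanLin A ψ with hy
  have hcoef : ∀ i j, inner ℂ (v i)
      (Matrix.toEuclideanLin (evolution H (τ j) * A * evolution H (-τ j)) ψ)
      = Complex.exp (Complex.I * (((E i - E 0) * τ j : ℝ) : ℂ)) * inner ℂ (v i) y := by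
    intro i j
    have h0 := evolution_apply_of_eigenvector H (-τ j) (E 0) ψ (by rw [← hv0]; exact hE 0)
    have hi := evolution_apply_of_eigenvector H (-τ j) (E i) (v i) (hE i)
    rw [toEuclideanLin_mul_apply, toEuclideanLin_mul_apply, h0, map_smul, map_smul,
      inner_smul_right, inner_toEuclideanLin_right, conjTranspose_evolution hH, hi,
      inner_smul_left, ← mul_assoc, ← Complex.exp_conj, ← Complex.exp_add]
    congr 2
    simp only [map_mul, Complex.conj_I, Complex.conj_ofReal]
    push_cast
    ring
  have hcomm : ∀ i, inner ℂ (v i) (Matrix.toEuclideanLin (A * H - H * A) ψ)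
      = ((E 0 - E i : ℝ) : ℂ) * inner ℂ (v i) y := by
    intro i
    have h0 : Matrix.toEuclideanLin H ψ = (E 0 : ℂ) • ψ := by rw [← hv0]; exact hE 0
    rw [map_sub, LinearMap.sub_apply, toEuclideanLin_mul_apply, toEuclideanLin_mul_apply, h0,
      map_smul, inner_sub_right, inner_smul_right, inner_toEuclideanLin_right H, hH.eq, hE i,
      inner_smul_left, Complex.conj_ofReal]
    push_cast
    ring
  have hterm : ∀ i, ‖inner ℂ (v i)
      ((∑ j, (c j : ℂ) • Matrix.toEuclideanLin (evolution H (τ j) * A * evolution H (-τ j)) ψ)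
      - (expectation A ψ : ℂ) • ψ)‖ ^ 2 ≤ B * ‖inner ℂ (v i) y‖ ^ 2
        + t₀ ^ 2 * ‖inner ℂ (v i) (Matrix.toEuclideanLin (A * H - H * A) ψ)‖ ^ 2 := by
    intro i
    simp only [inner_sub_right, inner_sum, inner_smul_right, hcoef, ← mul_assoc]
    rw [← Finset.sum_mul]
    by_cases hi : i = 0
    · subst hi
      have h1 : (∑ j, (c j : ℂ) * Complex.exp (Complex.I * (((E 0 - E 0) * τ j : ℝ) : ℂ))) = 1 := by
        simp only [sub_self, zero_mul, Complex.ofReal_zero, mul_zero, Complex.exp_zero, mul_one]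
        exact_mod_cast hc1
      rw [h1, hv0, hy, inner_toEuclideanLin_self hA, inner_self_eq_norm_sq_to_K, hψ1]
      simp only [one_mul, Complex.coe_algebraMap, Complex.ofReal_one, one_pow, mul_one, sub_self,
        norm_zero, ne_eq, OfNat.ofNat_ne_zero, not_false_eq_true, zero_pow]
      exact add_nonneg (mul_nonneg hB (sq_nonneg _)) (mul_nonneg (sq_nonneg _) (sq_nonneg _))
    · have h0 : inner ℂ (v i) ψ = 0 := by
        rw [← hv0]; exact v.orthonormal.2 hi
      rw [h0, mul_zero, sub_zero, norm_mul, mul_pow, hcomm, norm_mul, mul_pow, Complex.norm_real,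
        Real.norm_eq_abs, sq_abs]
      have := mul_le_mul_of_nonneg_right (hfilter _ (hgap i hi)) (sq_nonneg ‖inner ℂ (v i) y‖)
      refine this.trans (le_of_eq ?_)
      ring
  rw [← v.sum_sq_norm_inner_right]
  refine (Finset.sum_le_sum fun i _ => hterm i).trans ?_
  rw [Finset.sum_add_distrib, ← Finset.mul_sum, ← Finset.mul_sum, v.sum_sq_norm_inner_right,
    v.sum_sq_norm_inner_right, mul_pow]
  have hy1 : ‖y‖ ≤ 1 := by
    have := norm_toEuclideanLin_le A ψ
    rw [hψ1] at this
    linarith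
  have hc2 : ‖Matrix.toEuclideanLin (A * H - H * A) ψ‖ ≤ L := by
    have := norm_toEuclideanLin_le (A * H - H * A) ψ
    rw [hψ1] at this
    linarith
  refine add_le_add ?_ ?_
  · exact mul_le_of_le_one_right hB (pow_le_one₀ (norm_nonneg _) hy1)
  · exact mul_le_mul_of_nonneg_left (pow_le_pow_left₀ (norm_nonneg _) hc2 2) (sq_nonneg _)

end Filtered

/-! ### The walk operator of an approximate eigenvector -/

section Walk

variable {E : Type*} [NormedAddCommGroup E] [NormedSpace ℂ E]

/-- The walk `G = R W' R W`, where `R = 2 P - 1`. If `e` is fixed by `P` and is an approximate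
eigenvector, with eigenvalue `cos θ`, of both `P W` and `P W'`, then up to a small error `G` rotates
the plane spanned by `e` and `-(1 - P) W' e / sin θ` by the angle `2 θ`. -/
lemma walk_rotation (W W' P : E →ₗ[ℂ] E) (hW : ∀ x, ‖W x‖ ≤ ‖x‖) (hW' : ∀ x, ‖W' x‖ ≤ ‖x‖)
    (hWW' : ∀ x, W (W' x) = x) (hW'W : ∀ x, W' (W x) = x) (hP : ∀ x, P (P x) = P x)
    (hR : ∀ x, ‖(2 : ℂ) • P x - x‖ ≤ ‖x‖) {e : E} (hPe : P e = e) {θ η : ℝ}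
    (hθ : 1 / 2 ≤ Real.sin θ) (h : ‖P (W e) - (Real.cos θ : ℂ) • e‖ ≤ η)
    (h' : ‖P (W' e) - (Real.cos θ : ℂ) • e‖ ≤ η) (G : E →ₗ[ℂ] E)
    (hG : ∀ x, G x = (2 : ℂ) • P (W' ((2 : ℂ) • P (W x) - W x))
      - W' ((2 : ℂ) • P (W x) - W x)) (f : E)
    (hf : f = -((Real.sin θ : ℂ)⁻¹ • (W' e - P (W' e)))) :
    ‖G e - ((Real.cos (2 * θ) : ℂ) • e + (Real.sin (2 * θ) : ℂ) • f)‖ ≤ 16 * η ∧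
    ‖G f - (-(Real.sin (2 * θ) : ℂ) • e + (Real.cos (2 * θ) : ℂ) • f)‖ ≤ 16 * η := by
  set a : ℂ := (Real.cos θ : ℂ) with ha
  set s : ℂ := (Real.sin θ : ℂ) with hs
  have hs0 : s ≠ 0 := by
    rw [hs]
    have : Real.sin θ ≠ 0 := by linarith
    exact_mod_cast this
  have hnorm : ∀ z : ℝ, ‖(z : ℂ)‖ = |z| := fun z => by rw [Complex.norm_real, Real.norm_eq_abs]
  have ha1 : ‖a‖ ≤ 1 := by rw [ha, hnorm]; exact Real.abs_cos_le_one θ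
  have hs2 : s ^ 2 = 1 - a ^ 2 := by
    rw [hs, ha]; exact_mod_cast Real.sin_sq θ
  have hc2 : (Real.cos (2 * θ) : ℂ) = 2 * a ^ 2 - 1 := by
    rw [ha]; exact_mod_cast Real.cos_two_mul θ
  have hsin2 : (Real.sin (2 * θ) : ℂ) = 2 * s * a := by
    rw [ha, hs]; exact_mod_cast Real.sin_two_mul θ
  set r := P (W e) - a • e with hr
  set r' := P (W' e) - a • e with hr'
  have hη : 0 ≤ η := (norm_nonneg _).trans h
  have hPW : P (W e) = a • e + r := by rw [hr]; module
  have hPW' : P (W' e) = a • e + r' := by rw [hr']; module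
  have hPr : P r = r := by rw [hr]; simp [hP, hPe]
  have hPr' : P r' = r' := by rw [hr']; simp [hP, hPe]
  have hW'e : W' e = a • e + r' - s • f := by
    rw [hf, hPW', smul_neg, smul_smul, mul_inv_cancel₀ hs0]
    module
  have hPf : P f = 0 := by
    rw [hf]; simp [hP]
  have hRW'r : ‖(2 : ℂ) • P (W' r) - W' r‖ ≤ η := (hR _).trans ((hW' _).trans h)
  constructor
  · have key : G e - ((Real.cos (2 * θ) : ℂ) • e + (Real.sin (2 * θ) : ℂ) • f)
        = (2 * a) • r' + (2 : ℂ) • ((2 : ℂ) • P (W' r) - W' r) := by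
      rw [hG, hPW, hc2, hsin2]
      simp only [map_sub, map_add, map_smul, hW'W, hW'e, hPe, hPr', hPf]
      module
    rw [key]
    refine (norm_add_le _ _).trans ?_
    rw [norm_smul, norm_smul, norm_mul, Complex.norm_ofNat]
    nlinarith [norm_nonneg r', mul_le_mul ha1 h' (norm_nonneg _) zero_le_one]
  · have hsf : s • f = a • e + r' - W' e := by rw [hW'e]; module
    have hWf : W f = s⁻¹ • (a • W e + W r' - e) := by
      have : s • W f = a • W e + W r' - e := by
        rw [← map_smul, hsf]; simp [hWW']
      rw [← this, smul_smul, inv_mul_cancel₀ hs0, one_smul]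
    set q := W r' - (2 : ℂ) • P (W r') with hq
    have hq1 : ‖q‖ ≤ η := by
      rw [hq, ← norm_neg, neg_sub]
      exact (hR _).trans ((hW _).trans h')
    have key : G f - (-(Real.sin (2 * θ) : ℂ) • e + (Real.cos (2 * θ) : ℂ) • f)
        = s⁻¹ • (((2 * a ^ 2 - 1) : ℂ) • r'
          + (2 * a) • ((2 : ℂ) • P (W' r) - W' r) - ((2 : ℂ) • P (W' q) - W' q)) := by
      have h2 : (-(Real.sin (2 * θ) : ℂ) • e + (Real.cos (2 * θ) : ℂ) • f)
          = s⁻¹ • (-(2 * s ^ 2 * a) • e + (2 * a ^ 2 - 1) • (s • f)) := by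
        rw [hc2, hsin2, smul_add, smul_smul, smul_smul, smul_smul]
        congr 2 <;> field_simp
      rw [h2, hG, hWf, hs2]
      simp only [map_sub, map_add, map_smul, hPW, hPe, hq, hW'W, hW'e, hPr', hPf, smul_sub,
        smul_add]
      module
    rw [key, norm_smul, norm_inv, hs, hnorm, abs_of_pos (by linarith)]
    have h3 : ‖((2 * a ^ 2 - 1) : ℂ)‖ ≤ 1 := by
      rw [← hc2, hnorm]; exact Real.abs_cos_le_one _
    have h4 : ‖((2 * a ^ 2 - 1) : ℂ) • r'
          + (2 * a) • ((2 : ℂ) • P (W' r) - W' r) - ((2 : ℂ) • P (W' q) - W' q)‖ ≤ 4 * η := by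
      refine (norm_sub_le _ _).trans ?_
      have h5 := norm_add_le (((2 * a ^ 2 - 1) : ℂ) • r')
        ((2 * a) • ((2 : ℂ) • P (W' r) - W' r))
      rw [norm_smul, norm_smul, norm_mul, Complex.norm_ofNat] at h5
      have h6 : ‖(2 : ℂ) • P (W' q) - W' q‖ ≤ η := (hR _).trans ((hW' _).trans hq1)
      have h7 := mul_le_mul h3 h' (norm_nonneg _) zero_le_one
      have h8 := mul_le_mul ha1 hRW'r (norm_nonneg _) zero_le_one
      nlinarith
    have h9 : (Real.sin θ)⁻¹ ≤ 2 := by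
      rw [inv_le_comm₀ (by linarith) two_pos]; linarith
    calc (Real.sin θ)⁻¹ * _ ≤ 2 * (4 * η) :=
          mul_le_mul h9 h4 (norm_nonneg _) zero_le_two
      _ ≤ _ := by linarith

/-- Powers of an approximate rotation. -/
lemma pow_rotation (G : E →ₗ[ℂ] E) (hG : ∀ x, ‖G x‖ ≤ ‖x‖) {e f : E} {φ κ : ℝ}
    (he : ‖G e - ((Real.cos φ : ℂ) • e + (Real.sin φ : ℂ) • f)‖ ≤ κ)
    (hf : ‖G f - (-(Real.sin φ : ℂ) • e + (Real.cos φ : ℂ) • f)‖ ≤ κ) (m : ℕ) (α : ℝ) :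
    ‖(G ^ m) ((Real.cos α : ℂ) • e + (Real.sin α : ℂ) • f)
      - ((Real.cos (α + m * φ) : ℂ) • e + (Real.sin (α + m * φ) : ℂ) • f)‖ ≤ m * (2 * κ) := by
  induction m with
  | zero => simp
  | succ m ih =>
    have h1 : (G ^ (m + 1)) ((Real.cos α : ℂ) • e + (Real.sin α : ℂ) • f)
        = G ((G ^ m) ((Real.cos α : ℂ) • e + (Real.sin α : ℂ) • f)) := by
      rw [pow_succ']; rfl
    set β := α + m * φ with hβ
    have hβ' : α + ((m + 1 : ℕ) : ℝ) * φ = β + φ := by rw [hβ]; push_cast; ring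
    rw [h1, hβ']
    clear_value β
    have h2 : G ((G ^ m) ((Real.cos α : ℂ) • e + (Real.sin α : ℂ) • f))
        - ((Real.cos (β + φ) : ℂ) • e + (Real.sin (β + φ) : ℂ) • f)
        = G ((G ^ m) ((Real.cos α : ℂ) • e + (Real.sin α : ℂ) • f)
            - ((Real.cos β : ℂ) • e + (Real.sin β : ℂ) • f))
          + ((Real.cos β : ℂ) • (G e - ((Real.cos φ : ℂ) • e + (Real.sin φ : ℂ) • f))
          + (Real.sin β : ℂ) • (G f - (-(Real.sin φ : ℂ) • e + (Real.cos φ : ℂ) • f))) := by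
      rw [Real.cos_add, Real.sin_add]
      simp only [map_sub, map_add, map_smul, Complex.ofReal_add, Complex.ofReal_sub,
        Complex.ofReal_mul]
      module
    rw [h2]
    refine (norm_add_le _ _).trans ?_
    have h3 := (hG _).trans ih
    have h4 := norm_add_le
      ((Real.cos β : ℂ) • (G e - ((Real.cos φ : ℂ) • e + (Real.sin φ : ℂ) • f)))
      ((Real.sin β : ℂ) • (G f - (-(Real.sin φ : ℂ) • e + (Real.cos φ : ℂ) • f)))
    rw [norm_smul, norm_smul, Complex.norm_real, Complex.norm_real, Real.norm_eq_abs,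
      Real.norm_eq_abs] at h4
    have h5 := mul_le_mul (Real.abs_cos_le_one β) he (norm_nonneg _) zero_le_one
    have h6 := mul_le_mul (Real.abs_sin_le_one β) hf (norm_nonneg _) zero_le_one
    rw [Nat.cast_succ]
    linarith

end Walk

/-! ### Block-diagonal operators and unitaries with a prescribed first column -/

section BlockOp

variable {α κ σ : Type} [Fintype α] [Fintype κ] [Fintype σ] [DecidableEq α] [DecidableEq κ]
  [DecidableEq σ]

/-- The operator on the space with basis `α ≃ κ × σ` that acts as `g s` on the sector `s : σ`. -/
def blockOp (e : α ≃ κ × σ) (g : σ → Matrix κ κ ℂ) : Matrix α α ℂ :=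
  (Matrix.blockDiagonal g).submatrix e e

lemma blockOp_apply (e : α ≃ κ × σ) (g : σ → Matrix κ κ ℂ) (p q : α) :
    blockOp e g p q = if (e p).2 = (e q).2 then g (e p).2 (e p).1 (e q).1 else 0 := rfl

lemma blockOp_mul (e : α ≃ κ × σ) (g h : σ → Matrix κ κ ℂ) :
    blockOp e g * blockOp e h = blockOp e (fun s => g s * h s) := by
  unfold blockOp
  rw [Matrix.submatrix_mul_equiv, ← Matrix.blockDiagonal_mul]

lemma blockOp_one (e : α ≃ κ × σ) : blockOp e (fun _ => 1) = 1 := by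
  unfold blockOp
  rw [show (fun _ : σ => (1 : Matrix κ κ ℂ)) = 1 from rfl, Matrix.blockDiagonal_one,
    Matrix.submatrix_one_equiv]

lemma conjTranspose_blockOp (e : α ≃ κ × σ) (g : σ → Matrix κ κ ℂ) :
    (blockOp e g)ᴴ = blockOp e (fun s => (g s)ᴴ) := by
  unfold blockOp
  rw [Matrix.conjTranspose_submatrix, Matrix.blockDiagonal_conjTranspose]

lemma blockOp_mem_unitaryGroup (e : α ≃ κ × σ) {g : σ → Matrix κ κ ℂ}
    (hg : ∀ s, g s ∈ Matrix.unitaryGroup κ ℂ) : blockOp e g ∈ Matrix.unitaryGroup α ℂ := by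
  rw [Matrix.mem_unitaryGroup_iff, Matrix.star_eq_conjTranspose, conjTranspose_blockOp,
    blockOp_mul, ← blockOp_one e]
  congr 1
  ext1 s
  exact Matrix.mem_unitaryGroup_iff.1 (hg s)

lemma blockOp_mulVec (e : α ≃ κ × σ) (g : σ → Matrix κ κ ℂ) (φ : α → ℂ) (p : α) :
    (blockOp e g *ᵥ φ) p
      = (g (e p).2 *ᵥ fun a => φ (e.symm (a, (e p).2))) (e p).1 := by
  simp only [Matrix.mulVec, dotProduct, blockOp_apply]
  rw [← Equiv.sum_comp e.symm, Fintype.sum_prod_type_right,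
    Finset.sum_eq_single (e p).2 (fun s _ hs => by simp [hs.symm]) (by simp)]
  simp

lemma exists_unitary_column (i₀ : α) (u : α → ℂ) (hu : ∑ i, ‖u i‖ ^ 2 = 1) :
    ∃ U ∈ Matrix.unitaryGroup α ℂ, ∀ i, U i i₀ = u i := by
  have hnorm : ‖(WithLp.toLp 2 u : EuclideanSpace ℂ α)‖ = 1 := by
    rw [EuclideanSpace.norm_eq]; simp [hu]
  have hv : Orthonormal ℂ
      (({i₀} : Set α).domRestrict fun _ => (WithLp.toLp 2 u : EuclideanSpace ℂ α)) := by
    constructor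
    · intro i; exact hnorm
    · intro i j hij; exact absurd (Subsingleton.elim i j) hij
  obtain ⟨b, hb⟩ := hv.exists_orthonormalBasis_extension_of_card_eq (by simp)
  refine ⟨_, (EuclideanSpace.basisFun α ℂ).toMatrix_orthonormalBasis_mem_unitary b, fun i => ?_⟩
  rw [Module.Basis.toMatrix_apply, hb i₀ rfl, OrthonormalBasis.coe_toBasis_repr_apply,
    EuclideanSpace.basisFun_repr]

end BlockOp

/-! ### The signal register -/

section Signal

variable {k b n : ℕ}

/-- Labels of the ancillas on which the walk acts: a qubit that selects between the identity and
the observable, the time register, and the ancillas of the block-encoding. -/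
abbrev Signal (k b : ℕ) : Type := Bool × Reg (k + 1) × Reg b

/-- The initial label of the signal register. -/
def signalZero (k b : ℕ) : Signal k b := (false, 0, 0)

/-- The Heisenberg evolution of an operator on the block-encoding ancillas and the system. -/
def heisenberg (H : Op (Reg n)) (t : ℝ) (V : Op (Reg b × Reg n)) : Op (Reg b × Reg n) :=
  ((1 : Op (Reg b)) ⊗ₖ evolution H t) * V * ((1 : Op (Reg b)) ⊗ₖ evolution H (-t))

lemma heisenberg_one (H : Op (Reg n)) (t : ℝ) :
    heisenberg H t (1 : Op (Reg b × Reg n)) = 1 := by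
  unfold heisenberg
  rw [mul_one, ← Matrix.mul_kronecker_mul, one_mul, evolution_mul_evolution_neg,
    Matrix.one_kronecker_one]

lemma heisenberg_mul (H : Op (Reg n)) (t : ℝ) (V V' : Op (Reg b × Reg n)) :
    heisenberg H t V * heisenberg H t V' = heisenberg H t (V * V') := by
  have h : ((1 : Op (Reg b)) ⊗ₖ evolution H (-t)) * ((1 : Op (Reg b)) ⊗ₖ evolution H t) = 1 := by
    rw [← Matrix.mul_kronecker_mul, one_mul, evolution_neg_mul_evolution, Matrix.one_kronecker_one]
  unfold heisenberg
  calc _ = ((1 : Op (Reg b)) ⊗ₖ evolution H t) * V *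
        (((1 : Op (Reg b)) ⊗ₖ evolution H (-t)) * ((1 : Op (Reg b)) ⊗ₖ evolution H t)) * V' *
          ((1 : Op (Reg b)) ⊗ₖ evolution H (-t)) := by simp only [mul_assoc]
    _ = _ := by rw [h, mul_one]; simp only [mul_assoc]

lemma conjTranspose_heisenberg {H : Op (Reg n)} (hH : H.IsHermitian) (t : ℝ)
    (V : Op (Reg b × Reg n)) : (heisenberg H t V)ᴴ = heisenberg H t Vᴴ := by
  unfold heisenberg
  rw [Matrix.conjTranspose_mul, Matrix.conjTranspose_mul, Matrix.conjTranspose_kronecker,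
    Matrix.conjTranspose_kronecker, conjTranspose_evolution hH, conjTranspose_evolution hH,
    Matrix.conjTranspose_one, neg_neg, mul_assoc]

lemma heisenberg_mem_unitaryGroup {H : Op (Reg n)} (hH : H.IsHermitian) (t : ℝ)
    {V : Op (Reg b × Reg n)} (hV : V ∈ Matrix.unitaryGroup (Reg b × Reg n) ℂ) :
    heisenberg H t V ∈ Matrix.unitaryGroup (Reg b × Reg n) ℂ := by
  rw [Matrix.mem_unitaryGroup_iff, Matrix.star_eq_conjTranspose] at hV ⊢
  rw [conjTranspose_heisenberg hH, heisenberg_mul, hV, heisenberg_one]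

lemma heisenberg_zero_zero (H A : Op (Reg n)) (t : ℝ) {V : Op (Reg b × Reg n)}
    (hV : ∀ i j, V (0, i) (0, j) = A i j) (i j : Reg n) :
    heisenberg H t V (0, i) (0, j) = (evolution H t * A * evolution H (-t)) i j := by
  unfold heisenberg
  simp only [Matrix.mul_apply, Matrix.kronecker_apply, Fintype.sum_prod_type, Matrix.one_apply,
    ite_mul, one_mul, zero_mul, mul_ite, mul_zero, Finset.sum_ite_irrel, Finset.sum_const_zero,
    Finset.sum_ite_eq, Finset.sum_ite_eq', Finset.mem_univ, if_true, hV]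

/-- The sectors of the signal register, labelled by the selector and the time. -/
def signalSectors (k b n : ℕ) :
    Signal k b × Reg n ≃ (Reg b × Reg n) × (Bool × Reg (k + 1)) where
  toFun p := ((p.1.2.2, p.2), (p.1.1, p.1.2.1))
  invFun p := ((p.2.1, p.2.2, p.1.1), p.1.2)
  left_inv _ := rfl
  right_inv _ := rfl

/-- A call of the block-encoding, executed on the branch on which the selector is set. -/
def callOp (k : ℕ) (t₀ : ℝ) (H : Op (Reg n)) (V : Op (Reg b × Reg n)) :
    Op (Signal k b × Reg n) :=
  blockOp (signalSectors k b n) fun s =>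
    if s.1 then heisenberg H (timeValue k t₀ s.2) V else 1

lemma callOp_mem_unitaryGroup (t₀ : ℝ) {H : Op (Reg n)} (hH : H.IsHermitian)
    {V : Op (Reg b × Reg n)} (hV : V ∈ Matrix.unitaryGroup (Reg b × Reg n) ℂ) :
    callOp k t₀ H V ∈ Matrix.unitaryGroup (Signal k b × Reg n) ℂ := by
  refine blockOp_mem_unitaryGroup _ fun s => ?_
  split_ifs
  · exact heisenberg_mem_unitaryGroup hH _ hV
  · exact one_mem _

lemma callOp_conjTranspose (t₀ : ℝ) {H : Op (Reg n)} (hH : H.IsHermitian)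
    (V : Op (Reg b × Reg n)) : callOp k t₀ H Vᴴ = (callOp k t₀ H V)ᴴ := by
  unfold callOp
  rw [conjTranspose_blockOp]
  congr 1
  ext1 s
  split_ifs
  · rw [conjTranspose_heisenberg hH]
  · rw [Matrix.conjTranspose_one]

/-- The system state `ψ` with the signal register in its initial state. -/
def embed (k b : ℕ) : EuclideanSpace ℂ (Reg n) →ₗ[ℂ] EuclideanSpace ℂ (Signal k b × Reg n) where
  toFun ψ := WithLp.toLp 2 fun p => if p.1 = signalZero k b then ψ p.2 else 0
  map_add' x y := by ext p; by_cases h : p.1 = signalZero k b <;> simp [h]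
  map_smul' c x := by ext p; by_cases h : p.1 = signalZero k b <;> simp [h]

lemma embed_apply (ψ : EuclideanSpace ℂ (Reg n)) (p : Signal k b × Reg n) :
    embed k b ψ p = if p.1 = signalZero k b then ψ p.2 else 0 := rfl

lemma norm_embed (ψ : EuclideanSpace ℂ (Reg n)) : ‖embed k b ψ‖ = ‖ψ‖ := by
  rw [EuclideanSpace.norm_eq, EuclideanSpace.norm_eq]
  congr 1
  rw [Fintype.sum_prod_type, Finset.sum_eq_single (signalZero k b)
    (fun q _ hq => by simp [embed_apply, hq]) (by simp)]
  simp [embed_apply]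

/-- The projection onto the initial state of the signal register. -/
def signalProj (k b n : ℕ) :
    EuclideanSpace ℂ (Signal k b × Reg n) →ₗ[ℂ] EuclideanSpace ℂ (Signal k b × Reg n) where
  toFun x := WithLp.toLp 2 fun p => if p.1 = signalZero k b then x p else 0
  map_add' x y := by ext p; by_cases h : p.1 = signalZero k b <;> simp [h]
  map_smul' c x := by ext p; by_cases h : p.1 = signalZero k b <;> simp [h]

lemma signalProj_apply (x : EuclideanSpace ℂ (Signal k b × Reg n)) (p : Signal k b × Reg n) :
    signalProj k b n x p = if p.1 = signalZero k b then x p else 0 := rfl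

/-- The reflection about the initial state of the signal register. -/
def signalReflection (k b : ℕ) : Op (Signal k b) :=
  Matrix.diagonal fun q => if q = signalZero k b then 1 else -1

lemma signalReflection_mem_unitaryGroup :
    signalReflection k b ∈ Matrix.unitaryGroup (Signal k b) ℂ := by
  rw [Matrix.mem_unitaryGroup_iff, Matrix.star_eq_conjTranspose, signalReflection,
    Matrix.diagonal_conjTranspose, Matrix.diagonal_mul_diagonal, ← Matrix.diagonal_one]
  congr 1
  ext1 q
  by_cases h : q = signalZero k b <;> simp [h]

lemma kronecker_one_mem_unitaryGroup {U : Op (Signal k b)}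
    (hU : U ∈ Matrix.unitaryGroup (Signal k b) ℂ) :
    U ⊗ₖ (1 : Op (Reg n)) ∈ Matrix.unitaryGroup (Signal k b × Reg n) ℂ :=
  Matrix.kronecker_mem_unitary hU (one_mem _)

lemma kronecker_one_mulVec {κ : Type} [Fintype κ] (U : Op κ) (φ : κ × Reg n → ℂ)
    (q : κ) (i : Reg n) : ((U ⊗ₖ (1 : Op (Reg n))) *ᵥ φ) (q, i) = ∑ q', U q q' * φ (q', i) := by
  simp [Matrix.mulVec, dotProduct, Fintype.sum_prod_type, Matrix.one_apply]

lemma signalReflection_apply (x : EuclideanSpace ℂ (Signal k b × Reg n)) :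
    Matrix.toEuclideanLin (signalReflection k b ⊗ₖ (1 : Op (Reg n))) x
      = (2 : ℂ) • signalProj k b n x - x := by
  ext ⟨q, i⟩
  rw [ofLp_toEuclideanLin, kronecker_one_mulVec, Finset.sum_eq_single q
    (fun q' _ hq' => by simp [signalReflection, hq'.symm]) (by simp)]
  by_cases h : q = signalZero k b
  · simp [signalReflection, signalProj_apply, h]; ring
  · simp [signalReflection, signalProj_apply, h]

/-- The state of the signal register in which the selector has the amplitudes `α` and the time the
distribution `c`. -/
def signalState (k b : ℕ) (α : Bool → ℝ) (c : Reg (k + 1) → ℝ) : Signal k b → ℂ :=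
  fun q => if q.2.2 = 0 then ((α q.1 * √(c q.2.1) : ℝ) : ℂ) else 0

lemma sum_norm_signalState {α : Bool → ℝ} (hα : α false ^ 2 + α true ^ 2 = 1)
    {c : Reg (k + 1) → ℝ} (hc : ∀ j, 0 ≤ c j) (hc1 : ∑ j, c j = 1) :
    ∑ q, ‖signalState k b α c q‖ ^ 2 = 1 := by
  have h : ∀ l t, ∑ β : Reg b, ‖signalState k b α c (l, t, β)‖ ^ 2 = α l ^ 2 * c t := by
    intro l t
    rw [Finset.sum_eq_single 0 (fun β _ hβ => by simp [signalState, hβ]) (by simp)]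
    simp only [signalState, if_true]
    rw [Complex.norm_real, Real.norm_eq_abs, sq_abs, mul_pow, Real.sq_sqrt (hc t)]
  simp only [Fintype.sum_prod_type, h, ← Finset.mul_sum, hc1, Fintype.univ_bool]
  simp
  linarith

/-- The walk step `(U'ᴴ ⊗ 1) · call · (U ⊗ 1)`. -/
def stepOp (U U' : Op (Signal k b)) (t₀ : ℝ) (H : Op (Reg n)) (V : Op (Reg b × Reg n)) :
    Op (Signal k b × Reg n) :=
  (U'ᴴ ⊗ₖ (1 : Op (Reg n))) * callOp k t₀ H V * (U ⊗ₖ (1 : Op (Reg n)))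

lemma conjTranspose_mem_unitaryGroup {κ : Type} [Fintype κ] [DecidableEq κ] {U : Op κ}
    (hU : U ∈ Matrix.unitaryGroup κ ℂ) : Uᴴ ∈ Matrix.unitaryGroup κ ℂ :=
  Unitary.star_mem hU

lemma stepOp_mem_unitaryGroup {U U' : Op (Signal k b)}
    (hU : U ∈ Matrix.unitaryGroup (Signal k b) ℂ) (hU' : U' ∈ Matrix.unitaryGroup (Signal k b) ℂ)
    (t₀ : ℝ) {H : Op (Reg n)} (hH : H.IsHermitian)
    {V : Op (Reg b × Reg n)} (hV : V ∈ Matrix.unitaryGroup (Reg b × Reg n) ℂ) :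
    stepOp U U' t₀ H V ∈ Matrix.unitaryGroup (Signal k b × Reg n) ℂ :=
  mul_mem (mul_mem (kronecker_one_mem_unitaryGroup (conjTranspose_mem_unitaryGroup hU'))
    (callOp_mem_unitaryGroup t₀ hH hV)) (kronecker_one_mem_unitaryGroup hU)

lemma stepOp_conjTranspose (U U' : Op (Signal k b)) (t₀ : ℝ) {H : Op (Reg n)}
    (hH : H.IsHermitian) (V : Op (Reg b × Reg n)) :
    stepOp U' U t₀ H Vᴴ = (stepOp U U' t₀ H V)ᴴ := by
  unfold stepOp
  rw [callOp_conjTranspose t₀ hH]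
  simp only [Matrix.conjTranspose_mul, Matrix.conjTranspose_kronecker,
    Matrix.conjTranspose_conjTranspose, Matrix.conjTranspose_one, mul_assoc]

/-- The block of a walk step in the initial state of the signal register: a linear combination of
the identity and of the filtered observable. -/
lemma signalProj_stepOp_embed {U U' : Op (Signal k b)} {α α' : Bool → ℝ} {c : Reg (k + 1) → ℝ}
    (hc : ∀ j, 0 ≤ c j) (hc1 : ∑ j, c j = 1)
    (hU : ∀ q, U q (signalZero k b) = signalState k b α c q)
    (hU' : ∀ q, U' q (signalZero k b) = signalState k b α' c q) (t₀ : ℝ) (H A : Op (Reg n))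
    {V : Op (Reg b × Reg n)} (hV : ∀ i j, V (0, i) (0, j) = A i j)
    (ψ : EuclideanSpace ℂ (Reg n)) :
    signalProj k b n (Matrix.toEuclideanLin (stepOp U U' t₀ H V) (embed k b ψ))
      = embed k b (((α' false * α false : ℝ) : ℂ) • ψ + ((α' true * α true : ℝ) : ℂ) •
          ∑ j, (c j : ℂ) • Matrix.toEuclideanLin (evolution H (timeValue k t₀ j) * A *
            evolution H (-timeValue k t₀ j)) ψ) := by
  ext ⟨q, i⟩
  rw [signalProj_apply, embed_apply]
  by_cases hq : q = signalZero k b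
  swap
  · simp [hq]
  simp only [hq, if_true]
  -- the state after the preparation of the signal register
  have h1 : ∀ q' j, Matrix.toEuclideanLin (U ⊗ₖ (1 : Op (Reg n))) (embed k b ψ) (q', j)
      = signalState k b α c q' * ψ j := by
    intro q' j
    rw [ofLp_toEuclideanLin, kronecker_one_mulVec, Finset.sum_eq_single (signalZero k b)
      (fun q'' _ hq'' => by simp [embed_apply, hq'']) (by simp), hU]
    simp [embed_apply]
  -- the state after the call, where the block-encoding ancillas are again in their initial state
  have h2 : ∀ l t, Matrix.toEuclideanLin (callOp k t₀ H V)
        (Matrix.toEuclideanLin (U ⊗ₖ (1 : Op (Reg n))) (embed k b ψ)) ((l, t, 0), i)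
      = ((α l * √(c t) : ℝ) : ℂ) * (if l then Matrix.toEuclideanLin
          (evolution H (timeValue k t₀ t) * A * evolution H (-timeValue k t₀ t)) ψ i else ψ i) := by
    intro l t
    rw [ofLp_toEuclideanLin, callOp, blockOp_mulVec]
    simp only [signalSectors, Equiv.coe_fn_mk, Equiv.coe_fn_symm_mk, h1, Matrix.mulVec, dotProduct,
      Fintype.sum_prod_type]
    rw [Finset.sum_eq_single 0 (fun β _ hβ => by simp [signalState, hβ]) (by simp)]
    cases l
    · simp only [Bool.false_eq_true, if_false]
      rw [Finset.sum_eq_single i (fun j _ hj => by simp [hj.symm]) (by simp)]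
      simp [signalState]
    · simp only [if_true, ofLp_toEuclideanLin, Matrix.mulVec,
        dotProduct, Finset.mul_sum]
      refine Finset.sum_congr rfl fun j _ => ?_
      change heisenberg H (timeValue k t₀ t) V (0, i) (0, j) * _ = _
      rw [heisenberg_zero_zero H A _ hV]
      simp only [signalState, if_true]
      ring
  rw [stepOp, toEuclideanLin_mul_apply, toEuclideanLin_mul_apply, ofLp_toEuclideanLin,
    kronecker_one_mulVec]
  simp only [Matrix.conjTranspose_apply, hU', Fintype.sum_prod_type]
  have h3 : ∀ l t, ∑ β : Reg b, star (signalState k b α' c (l, t, β)) *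
      Matrix.toEuclideanLin (callOp k t₀ H V)
        (Matrix.toEuclideanLin (U ⊗ₖ (1 : Op (Reg n))) (embed k b ψ)) ((l, t, β), i)
      = ((α' l * α l : ℝ) : ℂ) * ((c t : ℂ) * (if l then Matrix.toEuclideanLin
          (evolution H (timeValue k t₀ t) * A * evolution H (-timeValue k t₀ t)) ψ i
          else ψ i)) := by
    intro l t
    rw [Finset.sum_eq_single 0 (fun β _ hβ => by simp [signalState, hβ]) (by simp), h2]
    have h4 : ((√(c t) : ℝ) : ℂ) * ((√(c t) : ℝ) : ℂ) = (c t : ℂ) := by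
      rw [← Complex.ofReal_mul, Real.mul_self_sqrt (hc t)]
    simp only [signalState, if_true, Complex.star_def, Complex.conj_ofReal]
    rw [← h4]
    push_cast
    ring
  simp only [h3, ← Finset.mul_sum, Fintype.univ_bool]
  have h5 : (∑ t, (c t : ℂ)) = 1 := by exact_mod_cast hc1
  simp [← Finset.sum_mul, h5]
  ring

end Signal

/-! ### The walk on the signal register -/

section SignalWalk

variable {k b n : ℕ}

/-- The amplitudes with which the selector is prepared before a call of the block-encoding; for the
inverse the roles of `walkIn` and `walkOut` are exchanged. The products `200 / 533` and `108 / 533`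
of the two are the coefficients of `shifted`; the numbers come from the Pythagorean triples
`(5, 12, 13)` and `(9, 40, 41)`. -/
def walkIn (l : Bool) : ℝ := if l then 12 / 13 else 5 / 13

/-- The amplitudes of the state from which the selector is uncomputed after a call; see `walkIn`. -/
def walkOut (l : Bool) : ℝ := if l then 9 / 41 else 40 / 41

/-- The walk operator: two walk steps, the second with the inverse block-encoding, each followed by
the reflection about the initial state of the signal register. -/
def walkOp (U U' : Op (Signal k b)) (t₀ : ℝ) (H : Op (Reg n)) (V : Op (Reg b × Reg n)) :
    Op (Signal k b × Reg n) :=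
  (signalReflection k b ⊗ₖ (1 : Op (Reg n))) * stepOp U' U t₀ H Vᴴ *
    (signalReflection k b ⊗ₖ (1 : Op (Reg n))) * stepOp U U' t₀ H V

lemma walkOp_mem_unitaryGroup {U U' : Op (Signal k b)}
    (hU : U ∈ Matrix.unitaryGroup (Signal k b) ℂ) (hU' : U' ∈ Matrix.unitaryGroup (Signal k b) ℂ)
    (t₀ : ℝ) {H : Op (Reg n)} (hH : H.IsHermitian)
    {V : Op (Reg b × Reg n)} (hV : V ∈ Matrix.unitaryGroup (Reg b × Reg n) ℂ) :
    walkOp U U' t₀ H V ∈ Matrix.unitaryGroup (Signal k b × Reg n) ℂ := by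
  have hR := kronecker_one_mem_unitaryGroup (n := n) (signalReflection_mem_unitaryGroup (k := k)
    (b := b))
  exact mul_mem (mul_mem (mul_mem hR (stepOp_mem_unitaryGroup hU' hU t₀ hH
    (conjTranspose_mem_unitaryGroup hV))) hR) (stepOp_mem_unitaryGroup hU hU' t₀ hH hV)

/-- The walk operator approximately rotates a plane that contains the ground state, by twice the
angle that encodes the expectation value. -/
lemma walkOp_rotation {U U' : Op (Signal k b)} (hUu : U ∈ Matrix.unitaryGroup (Signal k b) ℂ)
    (hUu' : U' ∈ Matrix.unitaryGroup (Signal k b) ℂ) {c : Reg (k + 1) → ℝ}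
    (hc : ∀ j, 0 ≤ c j) (hc1 : ∑ j, c j = 1)
    (hU : ∀ q, U q (signalZero k b) = signalState k b walkIn c q)
    (hU' : ∀ q, U' q (signalZero k b) = signalState k b walkOut c q) (t₀ : ℝ) {H A : Op (Reg n)}
    (hH : H.IsHermitian) (hA : A.IsHermitian) {V : Op (Reg b × Reg n)}
    (hV : IsBlockEncoding V A) {ψ : EuclideanSpace ℂ (Reg n)} (hψ : ‖ψ‖ = 1) {a η : ℝ}
    (ha : |a| ≤ 1)
    (hη : ‖(∑ j, (c j : ℂ) • Matrix.toEuclideanLin (evolution H (timeValue k t₀ j) * A *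
      evolution H (-timeValue k t₀ j)) ψ) - (a : ℂ) • ψ‖ ≤ η) :
    ∃ f : EuclideanSpace ℂ (Signal k b × Reg n), ‖f‖ ≤ 2 ∧ signalProj k b n f = 0 ∧
      ‖Matrix.toEuclideanLin (walkOp U U' t₀ H V) (embed k b ψ)
        - ((Real.cos (2 * angle a) : ℂ) • embed k b ψ + (Real.sin (2 * angle a) : ℂ) • f)‖
        ≤ 16 * η ∧
      ‖Matrix.toEuclideanLin (walkOp U U' t₀ H V) f
        - (-(Real.sin (2 * angle a) : ℂ) • embed k b ψ + (Real.cos (2 * angle a) : ℂ) • f)‖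
        ≤ 16 * η := by
  obtain ⟨hVu, hVb⟩ := hV
  have hVb' : ∀ i j, Vᴴ (0, i) (0, j) = A i j := by
    intro i j
    rw [Matrix.conjTranspose_apply, hVb, ← Matrix.conjTranspose_apply, hA.eq]
  set x := ∑ j, (c j : ℂ) • Matrix.toEuclideanLin (evolution H (timeValue k t₀ j) * A *
      evolution H (-timeValue k t₀ j)) ψ with hx
  set W := stepOp U U' t₀ H V with hWdef
  have hWu : W ∈ Matrix.unitaryGroup (Signal k b × Reg n) ℂ :=
    stepOp_mem_unitaryGroup hUu hUu' t₀ hH hVu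
  have hW' : stepOp U' U t₀ H Vᴴ = Wᴴ := stepOp_conjTranspose U U' t₀ hH V
  have hR : ∀ y : EuclideanSpace ℂ (Signal k b × Reg n),
      ‖(2 : ℂ) • signalProj k b n y - y‖ ≤ ‖y‖ := fun y => by
    rw [← signalReflection_apply]
    exact (norm_toEuclideanLin_of_mem_unitary
      (kronecker_one_mem_unitaryGroup signalReflection_mem_unitaryGroup) y).le
  have hη0 : 0 ≤ η := (norm_nonneg _).trans hη
  have hblock : ∀ {y : EuclideanSpace ℂ (Signal k b × Reg n)} (p q : ℝ),
      p = 200 / 533 → q = 108 / 533 → y = embed k b ((p : ℂ) • ψ + (q : ℂ) • x) →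
      ‖y - (Real.cos (angle a) : ℂ) • embed k b ψ‖ ≤ η := by
    intro y p q hp hq hy
    have h1 : y - (Real.cos (angle a) : ℂ) • embed k b ψ
        = embed k b ((q : ℂ) • (x - (a : ℂ) • ψ)) := by
      rw [hy, cos_angle ha, ← map_smul, ← map_sub, hp, hq]
      congr 1
      unfold shifted
      push_cast
      module
    rw [h1, norm_embed, norm_smul, hq, Complex.norm_real, Real.norm_of_nonneg (by norm_num)]
    linarith
  have hsin : 1 / 2 ≤ Real.sin (angle a) := by
    obtain ⟨h1, h2⟩ := shifted_mem ha
    have h3 : 0 ≤ Real.sin (angle a) :=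
      Real.sin_nonneg_of_nonneg_of_le_pi (Real.arccos_nonneg _) (Real.arccos_le_pi _)
    have h4 := Real.sin_sq (angle a)
    rw [cos_angle ha] at h4
    nlinarith
  set e := embed k b ψ with he
  have hPe : signalProj k b n e = e := by
    ext p; rw [signalProj_apply, he, embed_apply]; split_ifs <;> rfl
  have hPP : ∀ y, signalProj k b n (signalProj k b n y) = signalProj k b n y := fun y => by
    ext p; simp only [signalProj_apply]; split_ifs <;> rfl
  have hW1 := hblock _ _ (by norm_num [walkIn, walkOut]) (by norm_num [walkIn, walkOut])
    (signalProj_stepOp_embed hc hc1 hU hU' t₀ H A hVb ψ)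
  have hW2 := hblock _ _ (by norm_num [walkIn, walkOut]) (by norm_num [walkIn, walkOut])
    (signalProj_stepOp_embed hc hc1 hU' hU t₀ H A hVb' ψ)
  rw [hW', ← he] at hW2
  refine ⟨-((Real.sin (angle a) : ℂ)⁻¹ • (Matrix.toEuclideanLin Wᴴ e
    - signalProj k b n (Matrix.toEuclideanLin Wᴴ e))), ?_, ?_, ?_⟩
  · set y := Matrix.toEuclideanLin Wᴴ e with hy
    have hy1 : ‖y‖ = 1 := by
      rw [hy, norm_toEuclideanLin_of_mem_unitary (conjTranspose_mem_unitaryGroup hWu), he,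
        norm_embed, hψ]
    have h1 : y - signalProj k b n y
        = (2 : ℂ)⁻¹ • (y - ((2 : ℂ) • signalProj k b n y - y)) := by module
    have h2 : ‖y - signalProj k b n y‖ ≤ 1 := by
      rw [h1, norm_smul, norm_inv, Complex.norm_ofNat]
      have := (norm_sub_le y ((2 : ℂ) • signalProj k b n y - y)).trans
        (add_le_add le_rfl (hR y))
      linarith
    rw [norm_neg, norm_smul, norm_inv, Complex.norm_real, Real.norm_eq_abs,
      abs_of_pos (by linarith)]
    have h3 : (Real.sin (angle a))⁻¹ ≤ 2 := by
      rw [inv_le_comm₀ (by linarith) two_pos]; linarith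
    calc _ ≤ 2 * 1 := mul_le_mul h3 h2 (norm_nonneg _) zero_le_two
      _ = 2 := by norm_num
  · simp [hPP]
  · refine walk_rotation (Matrix.toEuclideanLin W) (Matrix.toEuclideanLin Wᴴ) (signalProj k b n)
      (fun y => (norm_toEuclideanLin_of_mem_unitary hWu y).le)
      (fun y => (norm_toEuclideanLin_of_mem_unitary (conjTranspose_mem_unitaryGroup hWu) y).le)
      (fun y => ?_) (fun y => ?_) hPP hR hPe hsin hW1 hW2 _ (fun y => ?_) _ rfl
    · rw [← toEuclideanLin_mul_apply, ← Matrix.star_eq_conjTranspose,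
        Matrix.mem_unitaryGroup_iff.1 hWu, toEuclideanLin_one_apply]
    · rw [← toEuclideanLin_mul_apply, ← Matrix.star_eq_conjTranspose,
        Matrix.mem_unitaryGroup_iff'.1 hWu, toEuclideanLin_one_apply]
    · rw [walkOp, hW', toEuclideanLin_mul_apply, toEuclideanLin_mul_apply,
        toEuclideanLin_mul_apply, signalReflection_apply, signalReflection_apply]

end SignalWalk

/-! ### Steps of a protocol as operators on the record and the signal register -/

section Steps

variable {w k b n : ℕ} {ι : Type} [Fintype ι] [DecidableEq ι]

/-- The `ℓ²` norm of a state vector. -/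
def stateNorm {α : Type} [Fintype α] (φ : α → ℂ) : ℝ :=
  ‖(WithLp.toLp 2 φ : EuclideanSpace ℂ α)‖

lemma stateNorm_sq {α : Type} [Fintype α] (φ : α → ℂ) : stateNorm φ ^ 2 = ∑ p, ‖φ p‖ ^ 2 :=
  EuclideanSpace.norm_sq_eq _

lemma stateNorm_nonneg {α : Type} [Fintype α] (φ : α → ℂ) : 0 ≤ stateNorm φ := norm_nonneg _

lemma stateNorm_sub_le {α : Type} [Fintype α] (φ χ ω : α → ℂ) :
    stateNorm (φ - ω) ≤ stateNorm (φ - χ) + stateNorm (χ - ω) := by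
  unfold stateNorm
  simpa using norm_sub_le_norm_sub_add_norm_sub (WithLp.toLp 2 φ : EuclideanSpace ℂ α)
    (WithLp.toLp 2 χ) (WithLp.toLp 2 ω)

lemma stateNorm_mulVec {α : Type} [Fintype α] [DecidableEq α] {U : Op α}
    (hU : U ∈ Matrix.unitaryGroup α ℂ) (φ : α → ℂ) : stateNorm (U *ᵥ φ) = stateNorm φ :=
  norm_toEuclideanLin_of_mem_unitary hU (WithLp.toLp 2 φ)

/-- The sectors of all the registers on which a call acts separately. -/
def callSectors (w k b n : ℕ) :
    Anc w k b × Reg n ≃ (Reg b × Reg n) × (Reg w × Reg (k + 1)) where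
  toFun p := ((p.1.2.2, p.2), (p.1.1, p.1.2.1))
  invFun p := ((p.2.1, p.2.2, p.1.1), p.1.2)
  left_inv _ := rfl
  right_inv _ := rfl

lemma unitary_call (t₀ : ℝ) (H : Op (Reg n)) (V : Op (Reg b × Reg n)) (ctrl : Reg w → Bool)
    (inverse : Bool) :
    (Step.call ctrl inverse : Step w k b).unitary t₀ H V
      = blockOp (callSectors w k b n) fun s =>
          heisenberg H (timeValue k t₀ s.2)
            (if ctrl s.1 then (if inverse then Vᴴ else V) else 1) := by
  have h1 : ∀ s : ℝ, evolutionGate (w := w) (b := b) t₀ H s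
      = blockOp (callSectors w k b n) fun r =>
          (1 : Op (Reg b)) ⊗ₖ evolution H (s * timeValue k t₀ r.2) := by
    intro s
    ext ⟨⟨r, t, β⟩, i⟩ ⟨⟨r', t', β'⟩, j⟩
    simp only [evolutionGate, Matrix.of_apply, blockOp_apply, callSectors, Equiv.coe_fn_mk,
      Matrix.kronecker_apply, Matrix.one_apply, Prod.mk.injEq]
    by_cases hr : r = r' <;> by_cases ht : t = t' <;> by_cases hβ : β = β' <;> simp [hr, ht, hβ]
  have h2 : ∀ V : Op (Reg b × Reg n), controlledGate (k := k) V ctrl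
      = blockOp (callSectors w k b n) fun r => if ctrl r.1 then V else 1 := by
    intro V
    ext ⟨⟨r, t, β⟩, i⟩ ⟨⟨r', t', β'⟩, j⟩
    simp only [controlledGate, Matrix.of_apply, blockOp_apply, callSectors, Equiv.coe_fn_mk,
      Prod.mk.injEq]
  rw [Step.unitary, h1, h1, h2, blockOp_mul, blockOp_mul]
  simp only [heisenberg, one_mul, neg_mul]

lemma unitary_mem_unitaryGroup (t₀ : ℝ) {H : Op (Reg n)} (hH : H.IsHermitian)
    {V : Op (Reg b × Reg n)} (hV : V ∈ Matrix.unitaryGroup (Reg b × Reg n) ℂ)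
    (s : Step w k b) : s.unitary t₀ H V ∈ Matrix.unitaryGroup (Anc w k b × Reg n) ℂ := by
  cases s with
  | ancilla U => exact Matrix.kronecker_mem_unitary U.2 (one_mem _)
  | call ctrl inverse =>
    rw [unitary_call]
    refine blockOp_mem_unitaryGroup _ fun s => heisenberg_mem_unitaryGroup hH _ ?_
    split_ifs
    · exact conjTranspose_mem_unitaryGroup hV
    · exact hV
    · exact one_mem _

/-- The action of a list of steps on state vectors. -/
def runSteps (t₀ : ℝ) (H : Op (Reg n)) (V : Op (Reg b × Reg n)) (l : List (Step w k b))
    (φ : Anc w k b × Reg n → ℂ) : Anc w k b × Reg n → ℂ :=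
  l.foldl (fun φ s => s.unitary t₀ H V *ᵥ φ) φ

lemma runSteps_append (t₀ : ℝ) (H : Op (Reg n)) (V : Op (Reg b × Reg n))
    (l l' : List (Step w k b)) (φ : Anc w k b × Reg n → ℂ) :
    runSteps t₀ H V (l ++ l') φ = runSteps t₀ H V l' (runSteps t₀ H V l φ) :=
  List.foldl_append

lemma runSteps_nil (t₀ : ℝ) (H : Op (Reg n)) (V : Op (Reg b × Reg n))
    (φ : Anc w k b × Reg n → ℂ) : runSteps t₀ H V [] φ = φ := rfl

lemma runSteps_cons (t₀ : ℝ) (H : Op (Reg n)) (V : Op (Reg b × Reg n)) (s : Step w k b)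
    (l : List (Step w k b)) (φ : Anc w k b × Reg n → ℂ) :
    runSteps t₀ H V (s :: l) φ = runSteps t₀ H V l (s.unitary t₀ H V *ᵥ φ) := rfl

lemma stateNorm_runSteps_sub (t₀ : ℝ) {H : Op (Reg n)} (hH : H.IsHermitian)
    {V : Op (Reg b × Reg n)} (hV : V ∈ Matrix.unitaryGroup (Reg b × Reg n) ℂ)
    (l : List (Step w k b)) (φ χ : Anc w k b × Reg n → ℂ) :
    stateNorm (runSteps t₀ H V l φ - runSteps t₀ H V l χ) = stateNorm (φ - χ) := by
  induction l generalizing φ χ with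
  | nil => rfl
  | cons s l ih =>
    rw [runSteps_cons, runSteps_cons, ih, ← Matrix.mulVec_sub,
      stateNorm_mulVec (unitary_mem_unitaryGroup t₀ hH hV s)]

lemma stateNorm_runSteps (t₀ : ℝ) {H : Op (Reg n)} (hH : H.IsHermitian)
    {V : Op (Reg b × Reg n)} (hV : V ∈ Matrix.unitaryGroup (Reg b × Reg n) ℂ)
    (l : List (Step w k b)) (φ : Anc w k b × Reg n → ℂ) :
    stateNorm (runSteps t₀ H V l φ) = stateNorm φ := by
  induction l generalizing φ with
  | nil => rfl
  | cons s l ih =>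
    rw [runSteps_cons, ih, stateNorm_mulVec (unitary_mem_unitaryGroup t₀ hH hV s)]

/-- The ancillas as a signal register and a record, given an encoding `ρ` of a record and of the
selector qubit in the workspace. -/
def ancEquiv (ρ : Reg w ≃ (ι → Bool) × Bool) : Anc w k b ≃ Signal k b × (ι → Bool) where
  toFun p := (((ρ p.1).2, p.2.1, p.2.2), (ρ p.1).1)
  invFun q := (ρ.symm (q.2, q.1.1), q.1.2.1, q.1.2.2)
  left_inv p := by simp
  right_inv q := by simp

/-- All registers as the signal register, the system, and the record. -/
def fullEquiv (n : ℕ) (ρ : Reg w ≃ (ι → Bool) × Bool) :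
    Anc w k b × Reg n ≃ (Signal k b × Reg n) × (ι → Bool) where
  toFun p := (((ancEquiv ρ p.1).1, p.2), (ancEquiv ρ p.1).2)
  invFun q := ((ancEquiv ρ).symm (q.1.1, q.2), q.1.2)
  left_inv p := by simp
  right_inv q := by simp

lemma fullEquiv_mk (ρ : Reg w ≃ (ι → Bool) × Bool) (r : Reg w) (t : Reg (k + 1)) (β : Reg b)
    (i : Reg n) : fullEquiv n ρ ((r, t, β), i) = ((((ρ r).2, t, β), i), (ρ r).1) := rfl

/-- The state vector with the component `v x` on the record `x`. -/
def assemble (ρ : Reg w ≃ (ι → Bool) × Bool)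
    (v : (ι → Bool) → EuclideanSpace ℂ (Signal k b × Reg n)) : Anc w k b × Reg n → ℂ :=
  fun p => v (fullEquiv n ρ p).2 (fullEquiv n ρ p).1

lemma assemble_sub (ρ : Reg w ≃ (ι → Bool) × Bool)
    (u v : (ι → Bool) → EuclideanSpace ℂ (Signal k b × Reg n)) :
    assemble ρ u - assemble ρ v = assemble ρ (u - v) := rfl

lemma stateNorm_assemble_sq (ρ : Reg w ≃ (ι → Bool) × Bool)
    (v : (ι → Bool) → EuclideanSpace ℂ (Signal k b × Reg n)) :
    stateNorm (assemble ρ v) ^ 2 = ∑ x, ‖v x‖ ^ 2 := by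
  rw [stateNorm_sq, ← Equiv.sum_comp (fullEquiv n ρ).symm, Fintype.sum_prod_type_right]
  refine Finset.sum_congr rfl fun x _ => ?_
  rw [EuclideanSpace.norm_sq_eq]
  simp [assemble]

lemma blockOp_mulVec_assemble (ρ : Reg w ≃ (ι → Bool) × Bool)
    (g : (ι → Bool) → Op (Signal k b × Reg n))
    (v : (ι → Bool) → EuclideanSpace ℂ (Signal k b × Reg n)) :
    blockOp (fullEquiv n ρ) g *ᵥ assemble ρ v
      = assemble ρ fun x => Matrix.toEuclideanLin (g x) (v x) := by
  ext p
  rw [blockOp_mulVec]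
  simp [assemble]

/-- A step that applies a unitary, chosen by the record, to the signal register. -/
def signalStep (ρ : Reg w ≃ (ι → Bool) × Bool)
    (u : (ι → Bool) → Matrix.unitaryGroup (Signal k b) ℂ) : Step w k b :=
  Step.ancilla ⟨blockOp (ancEquiv ρ) fun x => (u x : Op (Signal k b)),
    blockOp_mem_unitaryGroup _ fun x => (u x).2⟩

lemma unitary_signalStep (ρ : Reg w ≃ (ι → Bool) × Bool)
    (u : (ι → Bool) → Matrix.unitaryGroup (Signal k b) ℂ) (t₀ : ℝ) (H : Op (Reg n))
    (V : Op (Reg b × Reg n)) :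
    (signalStep ρ u).unitary t₀ H V
      = blockOp (fullEquiv n ρ) fun x => (u x : Op (Signal k b)) ⊗ₖ (1 : Op (Reg n)) := by
  ext ⟨p, i⟩ ⟨q, j⟩
  simp only [signalStep, Step.unitary, blockOp_apply, Matrix.kronecker_apply, fullEquiv,
    Equiv.coe_fn_mk, ite_mul, zero_mul]

/-- A call controlled by the record and by the selector. -/
def callStep (ρ : Reg w ≃ (ι → Bool) × Bool) (κ : (ι → Bool) → Bool) (inverse : Bool) :
    Step w k b :=
  Step.call (fun r => κ (ρ r).1 && (ρ r).2) inverse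

lemma unitary_callStep (ρ : Reg w ≃ (ι → Bool) × Bool) (κ : (ι → Bool) → Bool) (inverse : Bool)
    (t₀ : ℝ) (H : Op (Reg n)) (V : Op (Reg b × Reg n)) :
    (callStep ρ κ inverse : Step w k b).unitary t₀ H V
      = blockOp (fullEquiv n ρ) fun x =>
          if κ x then callOp k t₀ H (if inverse then Vᴴ else V) else 1 := by
  rw [callStep, unitary_call]
  generalize (if inverse then Vᴴ else V) = V'
  ext ⟨⟨r, t, β⟩, i⟩ ⟨⟨r', t', β'⟩, j⟩
  rw [blockOp_apply, blockOp_apply, fullEquiv_mk, fullEquiv_mk]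
  obtain ⟨⟨x, l⟩, rfl⟩ := ρ.symm.surjective r
  obtain ⟨⟨x', l'⟩, rfl⟩ := ρ.symm.surjective r'
  simp only [callSectors, Equiv.coe_fn_mk, Equiv.apply_symm_apply, Prod.mk.injEq,
    EmbeddingLike.apply_eq_iff_eq]
  by_cases hx : x = x'
  swap
  · simp [hx]
  subst hx
  cases hκ : κ x
  · simp only [Bool.false_and, Bool.false_eq_true, if_false, heisenberg_one, if_true, true_and]
    by_cases hl : l = l' <;> by_cases ht : t = t' <;> simp [hl, ht, Matrix.one_apply]
  · simp only [Bool.true_and, if_true, true_and, callOp, blockOp_apply, signalSectors,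
      Equiv.coe_fn_mk, Prod.mk.injEq]
    cases l <;> simp [heisenberg_one]

/-- The steps of one use of the walk operator, controlled by the record. -/
def walkSteps (ρ : Reg w ≃ (ι → Bool) × Bool) (U U' : Matrix.unitaryGroup (Signal k b) ℂ)
    (κ : (ι → Bool) → Bool) : List (Step w k b) :=
  let R : Matrix.unitaryGroup (Signal k b) ℂ :=
    ⟨signalReflection k b, signalReflection_mem_unitaryGroup⟩
  [signalStep ρ fun x => if κ x then U else 1,
    callStep ρ κ false,
    signalStep ρ fun x => if κ x then U' * R * star U' else 1,
    callStep ρ κ true,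
    signalStep ρ fun x => if κ x then R * star U else 1]

lemma runSteps_walkSteps (ρ : Reg w ≃ (ι → Bool) × Bool)
    (U U' : Matrix.unitaryGroup (Signal k b) ℂ) (κ : (ι → Bool) → Bool) (t₀ : ℝ)
    (H : Op (Reg n)) (V : Op (Reg b × Reg n))
    (v : (ι → Bool) → EuclideanSpace ℂ (Signal k b × Reg n)) :
    runSteps t₀ H V (walkSteps ρ U U' κ) (assemble ρ v)
      = assemble ρ fun x => if κ x then
          Matrix.toEuclideanLin (walkOp (U : Op (Signal k b)) U' t₀ H V) (v x) else v x := by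
  simp only [walkSteps, runSteps_cons, unitary_signalStep, unitary_callStep,
    blockOp_mulVec_assemble, runSteps_nil]
  congr 1
  ext1 x
  cases hκ : κ x
  · simp
  · simp only [if_true, ← toEuclideanLin_mul_apply]
    congr 2
    have hmul : ∀ M N : Op (Signal k b), (M * N) ⊗ₖ (1 : Op (Reg n))
        = (M ⊗ₖ (1 : Op (Reg n))) * (N ⊗ₖ (1 : Op (Reg n))) := fun M N => by
      rw [← Matrix.mul_kronecker_mul, one_mul]
    simp only [walkOp, stepOp, Submonoid.coe_mul, Unitary.coe_star, hmul,
      Matrix.star_eq_conjTranspose, mul_assoc, Bool.false_eq_true, if_false]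

lemma runSteps_flatten_replicate (ρ : Reg w ≃ (ι → Bool) × Bool)
    (U U' : Matrix.unitaryGroup (Signal k b) ℂ) (κ : (ι → Bool) → Bool) (t₀ : ℝ)
    (H : Op (Reg n)) (V : Op (Reg b × Reg n)) (m : ℕ)
    (v : (ι → Bool) → EuclideanSpace ℂ (Signal k b × Reg n)) :
    runSteps t₀ H V (List.replicate m (walkSteps ρ U U' κ)).flatten (assemble ρ v)
      = assemble ρ fun x => if κ x then
          (Matrix.toEuclideanLin (walkOp (U : Op (Signal k b)) U' t₀ H V) ^ m) (v x)
          else v x := by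
  induction m generalizing v with
  | zero => simp [runSteps]
  | succ m ih =>
    rw [List.replicate_succ, List.flatten_cons, runSteps_append, runSteps_walkSteps, ih]
    congr 1
    ext1 x
    cases κ x
    · simp
    · simp only [if_true, pow_succ]; rfl

/-- The permutation that records a change of the flag in bit `i`: the bit is flipped if the flag,
which is raised unless the signal register is in its initial state, differs from the parity
of the other bits of the record. -/
def recordPerm (k b : ℕ) (i : ι) : Equiv.Perm (Signal k b × (ι → Bool)) :=
  Function.Involutive.toPerm
    (fun s => (s.1, if xor (decide (s.1 ≠ signalZero k b)) (xor (parity s.2) (s.2 i))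
      then flipBit i s.2 else s.2)) (by
    rintro ⟨q, x⟩
    by_cases h : xor (decide (q ≠ signalZero k b)) (xor (parity x) (x i)) = true
    · have h' : xor (decide (q ≠ signalZero k b))
          (xor (parity (flipBit i x)) (flipBit i x i)) = true := by
        rw [parity_flipBit, flipBit_same, Bool.not_xor_not]; exact h
      simp only [h, h', if_true, flipBit_flipBit]
    · simp only [h, if_false, Bool.false_eq_true])

/-- The effect of `recordPerm` on a state. -/
def recordState (i : ι) (v : (ι → Bool) → EuclideanSpace ℂ (Signal k b × Reg n)) :
    (ι → Bool) → EuclideanSpace ℂ (Signal k b × Reg n) :=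
  fun x => WithLp.toLp 2 fun p => v (recordPerm k b i (p.1, x)).2 p

/-- The step that records a change of the flag in bit `i`. -/
def recordStep (ρ : Reg w ≃ (ι → Bool) × Bool) (i : ι) : Step w k b :=
  Step.ancilla ⟨Equiv.Perm.permMatrix ℂ
      (((ancEquiv ρ).trans (recordPerm k b i)).trans (ancEquiv ρ).symm), by
    rw [Matrix.mem_unitaryGroup_iff, Matrix.star_eq_conjTranspose, Matrix.conjTranspose_permMatrix,
      ← Matrix.permMatrix_mul, inv_mul_cancel, Matrix.permMatrix_one]⟩

lemma unitary_recordStep_mulVec (ρ : Reg w ≃ (ι → Bool) × Bool) (i : ι) (t₀ : ℝ)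
    (H : Op (Reg n)) (V : Op (Reg b × Reg n))
    (v : (ι → Bool) → EuclideanSpace ℂ (Signal k b × Reg n)) :
    (recordStep ρ i : Step w k b).unitary t₀ H V *ᵥ assemble ρ v
      = assemble ρ (recordState i v) := by
  ext ⟨p, j⟩
  simp only [recordStep, Step.unitary]
  rw [kronecker_one_mulVec]
  have h := congrFun (Matrix.permMatrix_mulVec (R := ℂ)
    (σ := ((ancEquiv ρ).trans (recordPerm k b i)).trans (ancEquiv ρ).symm)
    (v := fun q => assemble ρ v (q, j))) p
  refine h.trans ?_
  simp only [assemble, recordState, fullEquiv, Function.comp_apply, Equiv.trans_apply,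
    Equiv.coe_fn_mk, Equiv.apply_symm_apply]
  rfl

end Steps

/-! ### Rounds of the measurement -/

section Rounds

variable {w k b n : ℕ} {ι : Type} [Fintype ι] [DecidableEq ι]

/-- The state in which the record `x` has amplitude `a x` and the signal register and the system are
in the state `f` or `e`, as the flag is raised or not. -/
def flagState (e f : EuclideanSpace ℂ (Signal k b × Reg n)) (a : (ι → Bool) → ℝ) :
    (ι → Bool) → EuclideanSpace ℂ (Signal k b × Reg n) :=
  fun x => (a x : ℂ) • if parity x then f else e

/-- The rotation of the plane spanned by `e` and `f` by the angles `ϑ x`, applied to a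
`flagState`. -/
def rotatedState (e f : EuclideanSpace ℂ (Signal k b × Reg n)) (ϑ : (ι → Bool) → ℝ)
    (a : (ι → Bool) → ℝ) : (ι → Bool) → EuclideanSpace ℂ (Signal k b × Reg n) :=
  fun x => (a x : ℂ) • if parity x
    then -(Real.sin (ϑ x) : ℂ) • e + (Real.cos (ϑ x) : ℂ) • f
    else (Real.cos (ϑ x) : ℂ) • e + (Real.sin (ϑ x) : ℂ) • f

lemma recordPerm_snd (i : ι) (q : Signal k b) (x : ι → Bool) :
    (recordPerm k b i (q, x)).2
      = if xor (decide (q ≠ signalZero k b)) (xor (parity x) (x i)) then flipBit i x else x := rfl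

/-- Recording the flag after a rotation acts on the amplitudes as `stepAmp`. -/
lemma recordState_rotatedState {e f : EuclideanSpace ℂ (Signal k b × Reg n)}
    (he : ∀ p, p.1 ≠ signalZero k b → e p = 0) (hf : ∀ p, p.1 = signalZero k b → f p = 0)
    (ϑ : (ι → Bool) → ℝ) (i : ι) {a : (ι → Bool) → ℝ} (ha : ∀ x, x i = true → a x = 0) :
    recordState i (rotatedState e f ϑ a) = flagState e f (stepAmp ϑ i a) := by
  ext x p
  change rotatedState e f ϑ a (recordPerm k b i (p.1, x)).2 p = _
  rw [recordPerm_snd]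
  have hfl : x i = false → a (flipBit i x) = 0 := fun h => ha _ (by simp [h])
  by_cases hp : p.1 = signalZero k b
  · have h0 := hf p hp
    cases hxi : x i <;> cases hpar : parity x <;>
      simp [hp, hxi, hpar, h0, rotatedState, flagState, stepAmp, hfl, ha]
    all_goals ring
  · have h0 := he p hp
    cases hxi : x i <;> cases hpar : parity x <;>
      simp [hp, hxi, hpar, h0, rotatedState, flagState, stepAmp, hfl, ha]
    all_goals ring

/-- The steps of one round: `m` uses of the walk operator, controlled by the record, and the
recording of the flag. -/
def roundSteps (ρ : Reg w ≃ (ι → Bool) × Bool) (U U' : Matrix.unitaryGroup (Signal k b) ℂ)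
    (m : ℕ) (κ : (ι → Bool) → Bool) (i : ι) : List (Step w k b) :=
  (List.replicate m (walkSteps ρ U U' κ)).flatten ++ [recordStep ρ i]

lemma runSteps_roundSteps (ρ : Reg w ≃ (ι → Bool) × Bool)
    (U U' : Matrix.unitaryGroup (Signal k b) ℂ) (m : ℕ) (κ : (ι → Bool) → Bool) (i : ι) (t₀ : ℝ)
    (H : Op (Reg n)) (V : Op (Reg b × Reg n))
    (v : (ι → Bool) → EuclideanSpace ℂ (Signal k b × Reg n)) :
    runSteps t₀ H V (roundSteps ρ U U' m κ i) (assemble ρ v)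
      = assemble ρ (recordState i fun x => if κ x then
          (Matrix.toEuclideanLin (walkOp (U : Op (Signal k b)) U' t₀ H V) ^ m) (v x)
          else v x) := by
  rw [roundSteps, runSteps_append, runSteps_flatten_replicate, runSteps_cons, runSteps_nil,
    unitary_recordStep_mulVec]

/-- The error of a single round, for a walk operator that rotates the plane of `e` and `f` by `φ` up
to an error `η`. -/
lemma round_error (ρ : Reg w ≃ (ι → Bool) × Bool)
    (U U' : Matrix.unitaryGroup (Signal k b) ℂ) (m : ℕ) (κ : (ι → Bool) → Bool) (i : ι) (t₀ : ℝ)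
    {H : Op (Reg n)} (hH : H.IsHermitian) {V : Op (Reg b × Reg n)}
    (hV : V ∈ Matrix.unitaryGroup (Reg b × Reg n) ℂ)
    {e f : EuclideanSpace ℂ (Signal k b × Reg n)}
    (he : ∀ p, p.1 ≠ signalZero k b → e p = 0) (hf : ∀ p, p.1 = signalZero k b → f p = 0)
    {φ η : ℝ}
    (hGe : ‖Matrix.toEuclideanLin (walkOp (U : Op (Signal k b)) U' t₀ H V) e
      - ((Real.cos φ : ℂ) • e + (Real.sin φ : ℂ) • f)‖ ≤ η)
    (hGf : ‖Matrix.toEuclideanLin (walkOp (U : Op (Signal k b)) U' t₀ H V) f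
      - (-(Real.sin φ : ℂ) • e + (Real.cos φ : ℂ) • f)‖ ≤ η)
    {a : (ι → Bool) → ℝ} (ha : ∀ x, x i = true → a x = 0) (ha1 : ∑ x, a x ^ 2 = 1) :
    stateNorm (runSteps t₀ H V (roundSteps ρ U U' m κ i) (assemble ρ (flagState e f a))
      - assemble ρ (flagState e f (stepAmp (fun x => if κ x then m * φ else 0) i a)))
      ≤ m * (2 * η) := by
  have hη : 0 ≤ η := (norm_nonneg _).trans hGe
  have hbound : (0 : ℝ) ≤ m * (2 * η) := by positivity
  set G := Matrix.toEuclideanLin (walkOp (U : Op (Signal k b)) U' t₀ H V) with hG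
  have hGn : ∀ x, ‖G x‖ ≤ ‖x‖ := fun x =>
    (norm_toEuclideanLin_of_mem_unitary (walkOp_mem_unitaryGroup U.2 U'.2 t₀ hH hV) x).le
  rw [runSteps_roundSteps, ← recordState_rotatedState he hf _ i ha,
    ← unitary_recordStep_mulVec ρ i t₀ H V, ← unitary_recordStep_mulVec ρ i t₀ H V,
    ← Matrix.mulVec_sub, stateNorm_mulVec (unitary_mem_unitaryGroup t₀ hH hV _), assemble_sub,
    ← abs_of_nonneg (stateNorm_nonneg _), ← abs_of_nonneg hbound, ← sq_le_sq,
    stateNorm_assemble_sq]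
  have hpow_e := pow_rotation G hGn hGe hGf m 0
  have hpow_f := pow_rotation G hGn hGe hGf m (Real.pi / 2)
  simp only [Real.cos_zero, Real.sin_zero, Complex.ofReal_one, Complex.ofReal_zero, one_smul,
    zero_smul, add_zero, zero_add] at hpow_e
  rw [add_comm (Real.pi / 2), Real.cos_add_pi_div_two, Real.sin_add_pi_div_two] at hpow_f
  simp only [Real.cos_pi_div_two, Real.sin_pi_div_two, Complex.ofReal_one, Complex.ofReal_zero,
    one_smul, zero_smul, zero_add, Complex.ofReal_neg] at hpow_f
  have hterm : ∀ x, ‖((fun x => if κ x then (G ^ m) (flagState e f a x) else flagState e f a x)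
      - rotatedState e f (fun x => if κ x then m * φ else 0) a) x‖ ^ 2
      ≤ a x ^ 2 * (m * (2 * η)) ^ 2 := by
    intro x
    have hle : ‖((fun x => if κ x then (G ^ m) (flagState e f a x) else flagState e f a x)
      - rotatedState e f (fun x => if κ x then m * φ else 0) a) x‖ ≤ |a x| * (m * (2 * η)) := by
      rw [Pi.sub_apply]
      unfold flagState rotatedState
      dsimp only
      cases hκ : κ x
      · simp only [Bool.false_eq_true, if_false, Real.sin_zero, Real.cos_zero, Complex.ofReal_zero,
          Complex.ofReal_one, neg_zero, zero_smul, one_smul, zero_add, add_zero, sub_self,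
          norm_zero]
        positivity
      · simp only [if_true, map_smul, ← smul_sub, norm_smul, Complex.norm_real, Real.norm_eq_abs]
        refine mul_le_mul_of_nonneg_left ?_ (abs_nonneg _)
        cases parity x
        · simpa using hpow_e
        · simpa using hpow_f
    calc _ ≤ (|a x| * (m * (2 * η))) ^ 2 := pow_le_pow_left₀ (norm_nonneg _) hle 2
      _ = _ := by rw [mul_pow, sq_abs]
  refine (Finset.sum_le_sum fun x _ => hterm x).trans ?_
  rw [← Finset.sum_mul, ha1, one_mul]

/-- The steps of all the rounds listed in `l`; round `i` uses the walk operator `m i` times,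
controlled by `κ i`. -/
def programSteps (ρ : Reg w ≃ (ι → Bool) × Bool) (U U' : Matrix.unitaryGroup (Signal k b) ℂ)
    (m : ι → ℕ) (κ : ι → (ι → Bool) → Bool) (l : List ι) : List (Step w k b) :=
  l.flatMap fun i => roundSteps ρ U U' (m i) (κ i) i

/-- The angles by which the rounds rotate the flag. -/
def roundAngle (φ : ℝ) (m : ι → ℕ) (κ : ι → (ι → Bool) → Bool) (i : ι) (x : ι → Bool) : ℝ :=
  if κ i x then m i * φ else 0

/-- The errors of the rounds add up. -/
lemma program_error (ρ : Reg w ≃ (ι → Bool) × Bool)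
    (U U' : Matrix.unitaryGroup (Signal k b) ℂ) (m : ι → ℕ) (κ : ι → (ι → Bool) → Bool) (t₀ : ℝ)
    {H : Op (Reg n)} (hH : H.IsHermitian) {V : Op (Reg b × Reg n)}
    (hV : V ∈ Matrix.unitaryGroup (Reg b × Reg n) ℂ)
    {e f : EuclideanSpace ℂ (Signal k b × Reg n)}
    (he : ∀ p, p.1 ≠ signalZero k b → e p = 0) (hf : ∀ p, p.1 = signalZero k b → f p = 0)
    {φ η : ℝ}
    (hGe : ‖Matrix.toEuclideanLin (walkOp (U : Op (Signal k b)) U' t₀ H V) e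
      - ((Real.cos φ : ℂ) • e + (Real.sin φ : ℂ) • f)‖ ≤ η)
    (hGf : ‖Matrix.toEuclideanLin (walkOp (U : Op (Signal k b)) U' t₀ H V) f
      - (-(Real.sin φ : ℂ) • e + (Real.cos φ : ℂ) • f)‖ ≤ η)
    (l : List ι) (hl : l.Nodup) :
    stateNorm (runSteps t₀ H V (programSteps ρ U U' m κ l)
        (assemble ρ (flagState e f (recordAmp (roundAngle φ m κ) [])))
      - assemble ρ (flagState e f (recordAmp (roundAngle φ m κ) l)))
      ≤ (l.map m).sum * (2 * η) := by
  induction l using List.reverseRecOn with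
  | nil => simp [programSteps, runSteps_nil, stateNorm]
  | append_singleton l i ih =>
    have hl' := hl
    rw [List.nodup_append] at hl'
    have hi : i ∉ l := fun h => hl'.2.2 i h i (by simp) rfl
    have h1 := ih hl'.1
    have h2 := round_error ρ U U' (m i) (κ i) i t₀ hH hV he hf hGe hGf
      (a := recordAmp (roundAngle φ m κ) l)
      (fun x hx => recordAmp_eq_zero _ l hi hx) (sum_recordAmp_sq _ l hl'.1)
    rw [programSteps, List.flatMap_append, runSteps_append, List.flatMap_singleton]
    refine (stateNorm_sub_le _ (runSteps t₀ H V (roundSteps ρ U U' (m i) (κ i) i)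
      (assemble ρ (flagState e f (recordAmp (roundAngle φ m κ) l)))) _).trans ?_
    rw [stateNorm_runSteps_sub t₀ hH hV, recordAmp_concat]
    refine (add_le_add h1 h2).trans (le_of_eq ?_)
    simp
    ring

lemma calls_walkSteps (ρ : Reg w ≃ (ι → Bool) × Bool)
    (U U' : Matrix.unitaryGroup (Signal k b) ℂ) (κ : (ι → Bool) → Bool) :
    ((walkSteps ρ U U' κ).map Step.calls).sum = 2 := rfl

lemma calls_programSteps (ρ : Reg w ≃ (ι → Bool) × Bool)
    (U U' : Matrix.unitaryGroup (Signal k b) ℂ) (m : ι → ℕ) (κ : ι → (ι → Bool) → Bool)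
    (l : List ι) : ((programSteps ρ U U' m κ l).map Step.calls).sum = 2 * (l.map m).sum := by
  have hrec : ∀ i : ι, Step.calls (recordStep ρ i : Step w k b) = 0 := fun _ => rfl
  induction l with
  | nil => rfl
  | cons i l ih =>
    have h : ((roundSteps ρ U U' (m i) (κ i) i).map Step.calls).sum = 2 * m i := by
      rw [roundSteps, List.map_append, List.sum_append, List.map_flatten, List.map_replicate,
        List.sum_flatten, List.map_replicate, calls_walkSteps, List.sum_replicate]
      simp [hrec, mul_comm]
    rw [programSteps, List.flatMap_cons, List.map_append, List.sum_append, h,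
      show l.flatMap _ = programSteps ρ U U' m κ l from rfl, ih, List.map_cons, List.sum_cons]
    ring

lemma sum_time_eq (t₀ : ℝ) (l : List (Step w k b)) :
    (l.map (Step.time t₀)).sum = (l.map Step.calls).sum * (2 * (t₀ * 2 ^ k)) := by
  induction l with
  | nil => simp
  | cons s l ih =>
    rw [List.map_cons, List.sum_cons, ih, List.map_cons, List.sum_cons]
    cases s <;> simp [Step.time, Step.calls]
    ring

end Rounds

/-! ### The outcome and the returned state -/

section Outcome

variable {w k b n : ℕ} {ι : Type} [Fintype ι] [DecidableEq ι]

/-- A reduced state is close to a pure state `ψ` if the global state vector is close to a product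
`g ⊗ ψ`. -/
lemma traceDist_reduced_le {S : Type} [Fintype S] (Ψ Ξ : S → EuclideanSpace ℂ (Reg n))
    (g : S → ℂ) {ψ : EuclideanSpace ℂ (Reg n)} (hψ : ‖ψ‖ = 1) (hΨ : ∀ a, Ψ a = g a • ψ + Ξ a)
    (hΨ1 : ∑ a, ‖Ψ a‖ ^ 2 ≤ 1) {q ν : ℝ} (hq : 0 ≤ q) (hν : 0 ≤ ν)
    (hg : ∑ a, ‖g a‖ ^ 2 = 1 - q) (hΞ : ∑ a, ‖Ξ a‖ ^ 2 ≤ ν ^ 2) (M : Op (Reg n))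
    (hM : ∀ i j, M i j = ∑ a, Ψ a i * star (Ψ a j)) :
    traceDist M (pureState ψ) ≤ ν + q / 2 := by
  have hgC : (∑ a, g a * star (g a)) = 1 - (q : ℂ) := by
    have : ∀ a, g a * star (g a) = ((‖g a‖ ^ 2 : ℝ) : ℂ) := fun a => by
      rw [Complex.star_def, Complex.mul_conj, Complex.normSq_eq_norm_sq]
    simp_rw [this]
    rw [← Complex.ofReal_sum, hg]
    push_cast
    rfl
  have hact : ∀ v, Matrix.toEuclideanLin (M - pureState ψ) v
      = ∑ a : S ⊕ S ⊕ Unit,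
        inner ℂ (Sum.elim Ψ (Sum.elim Ξ fun _ => ψ) a) v •
          Sum.elim Ξ (Sum.elim (fun a => g a • ψ) fun _ => -(q : ℂ) • ψ) a := by
    intro v
    have hMv : Matrix.toEuclideanLin M v = ∑ a, inner ℂ (Ψ a) v • Ψ a := by
      ext i
      rw [ofLp_toEuclideanLin]
      simp only [Matrix.mulVec, dotProduct, hM, WithLp.ofLp_sum, WithLp.ofLp_smul,
        Finset.sum_apply, Pi.smul_apply, smul_eq_mul, Finset.sum_mul, PiLp.inner_apply,
        RCLike.inner_apply]
      rw [Finset.sum_comm]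
      refine Finset.sum_congr rfl fun a _ => Finset.sum_congr rfl fun j _ => ?_
      rw [Complex.star_def]
      ring
    have hPv : Matrix.toEuclideanLin (pureState ψ) v = inner ℂ ψ v • ψ := by
      ext i
      rw [ofLp_toEuclideanLin]
      simp only [Matrix.mulVec, dotProduct, pureState, Matrix.of_apply, WithLp.ofLp_smul,
        Pi.smul_apply, smul_eq_mul, Finset.sum_mul, PiLp.inner_apply, RCLike.inner_apply]
      refine Finset.sum_congr rfl fun j _ => ?_
      rw [Complex.star_def]
      ring
    have hterm : ∀ a, inner ℂ (Ψ a) v • Ψ a = inner ℂ (Ψ a) v • Ξ a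
        + inner ℂ (Ξ a) v • (g a • ψ) + (g a * star (g a)) • (inner ℂ ψ v • ψ) := by
      intro a
      have h1 : inner ℂ (Ψ a) v = star (g a) * inner ℂ ψ v + inner ℂ (Ξ a) v := by
        rw [hΨ, inner_add_left, inner_smul_left, Complex.star_def]
      have h2 : inner ℂ (Ψ a) v • Ψ a
          = inner ℂ (Ψ a) v • Ξ a + inner ℂ (Ψ a) v • (g a • ψ) := by
        rw [← smul_add, add_comm (Ξ a), ← hΨ]
      have h3 : inner ℂ (Ψ a) v • (g a • ψ)
          = inner ℂ (Ξ a) v • (g a • ψ) + (g a * star (g a)) • (inner ℂ ψ v • ψ) := by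
        rw [h1]
        module
      rw [h2, h3, add_assoc]
    rw [map_sub, LinearMap.sub_apply, hMv, hPv, Fintype.sum_sum_type, Fintype.sum_sum_type,
      Finset.sum_congr rfl fun a _ => hterm a]
    simp only [Sum.elim_inl, Sum.elim_inr, Finset.sum_add_distrib, ← Finset.sum_smul, hgC,
      Finset.univ_unique, Finset.sum_singleton]
    module
  have htr := traceNorm_le_of_eq_sum _ _ _ hact
  rw [Fintype.sum_sum_type, Fintype.sum_sum_type] at htr
  simp only [Sum.elim_inl, Sum.elim_inr, Finset.univ_unique, Finset.sum_singleton, norm_smul, hψ,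
    mul_one, norm_neg, Complex.norm_real, Real.norm_of_nonneg hq] at htr
  have hcs : ∀ x y : S → ℝ, ∑ a, x a ^ 2 ≤ ν ^ 2 → ∑ a, y a ^ 2 ≤ 1 →
      ∑ a, x a * y a ≤ ν := by
    intro x y hx hy
    refine (Real.sum_mul_le_sqrt_mul_sqrt _ _ _).trans ?_
    have h1 : √(∑ a, x a ^ 2) ≤ ν := Real.sqrt_le_iff.2 ⟨hν, hx⟩
    have h2 : √(∑ a, y a ^ 2) ≤ 1 := Real.sqrt_le_one.2 hy
    calc _ ≤ ν * 1 := mul_le_mul h1 h2 (Real.sqrt_nonneg _) hν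
      _ = ν := mul_one ν
  have h1 := hcs (fun a => ‖Ξ a‖) (fun a => ‖Ψ a‖) hΞ hΨ1
  have h2 := hcs (fun a => ‖Ξ a‖) (fun a => ‖g a‖) hΞ (by rw [hg]; linarith)
  simp only [mul_comm ‖Ξ _‖ ‖g _‖] at h2
  unfold traceDist
  linarith

/-- The weight of a set of records in a state close to a `flagState`. -/
lemma sum_filter_le_of_close (ρ : Reg w ≃ (ι → Bool) × Bool)
    {e f : EuclideanSpace ℂ (Signal k b × Reg n)} (he : ‖e‖ ≤ 2) (hf : ‖f‖ ≤ 2)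
    {a : (ι → Bool) → ℝ} (Ψ : Anc w k b × Reg n → ℂ) {τ B : ℝ} (hB : 0 ≤ B)
    (hτ : stateNorm (Ψ - assemble ρ (flagState e f a)) ≤ τ) (Z : (ι → Bool) → Prop)
    [DecidablePred Z] (hZ : ∑ x with Z x, a x ^ 2 ≤ B ^ 2) :
    ∑ p with Z (ρ p.1.1).1, ‖Ψ p‖ ^ 2 ≤ (2 * B + τ) ^ 2 := by
  let r : (Anc w k b × Reg n → ℂ) → (Anc w k b × Reg n → ℂ) :=
    fun φ p => if Z (ρ p.1.1).1 then φ p else 0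
  have hr : ∀ φ, stateNorm (r φ) ^ 2 = ∑ p with Z (ρ p.1.1).1, ‖φ p‖ ^ 2 := by
    intro φ
    rw [stateNorm_sq, Finset.sum_filter]
    refine Finset.sum_congr rfl fun p _ => ?_
    simp only [r]
    split_ifs <;> simp
  have h1 : stateNorm (r Ψ - r (assemble ρ (flagState e f a))) ≤ τ := by
    refine le_trans ?_ hτ
    have h2 : r Ψ - r (assemble ρ (flagState e f a)) = r (Ψ - assemble ρ (flagState e f a)) := by
      ext p
      simp only [r, Pi.sub_apply]
      split_ifs <;> simp
    rw [h2]
    refine (pow_le_pow_iff_left₀ (stateNorm_nonneg _) (stateNorm_nonneg _) two_ne_zero).1 ?_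
    rw [hr, stateNorm_sq]
    exact Finset.sum_le_sum_of_subset_of_nonneg (Finset.filter_subset _ _)
      fun _ _ _ => sq_nonneg _
  have h3 : stateNorm (r (assemble ρ (flagState e f a)) - 0) ≤ 2 * B := by
    rw [sub_zero]
    refine (pow_le_pow_iff_left₀ (stateNorm_nonneg _) (by positivity) two_ne_zero).1 ?_
    have h4 : r (assemble ρ (flagState e f a))
        = assemble ρ fun x => if Z x then flagState e f a x else 0 := by
      ext p
      by_cases h : Z (ρ p.1.1).1 <;> simp [r, assemble, fullEquiv, ancEquiv, h]
    rw [h4, stateNorm_assemble_sq, mul_pow]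
    have h5 : ∀ x, ‖(if Z x then flagState e f a x else 0)‖ ^ 2
        ≤ 2 ^ 2 * (if Z x then a x ^ 2 else 0) := by
      intro x
      split_ifs
      · rw [flagState, norm_smul, mul_pow, Complex.norm_real, Real.norm_eq_abs, sq_abs, mul_comm]
        refine mul_le_mul_of_nonneg_right (pow_le_pow_left₀ (norm_nonneg _) ?_ 2) (sq_nonneg _)
        split_ifs
        · exact hf
        · exact he
      · simp
    refine (Finset.sum_le_sum fun x _ => h5 x).trans ?_
    rw [← Finset.mul_sum, ← Finset.sum_filter]
    exact mul_le_mul_of_nonneg_left hZ (by norm_num)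
  rw [← hr]
  refine pow_le_pow_left₀ (stateNorm_nonneg _) ?_ 2
  have h6 := stateNorm_sub_le (r Ψ) (r (assemble ρ (flagState e f a))) 0
  rw [sub_zero (r Ψ)] at h6
  linarith

/-- The returned state is close to the ground state if the flag is almost surely lowered. -/
lemma traceDist_of_close (ρ : Reg w ≃ (ι → Bool) × Bool) {ψ : EuclideanSpace ℂ (Reg n)}
    (hψ : ‖ψ‖ = 1) {f : EuclideanSpace ℂ (Signal k b × Reg n)} (hf : ‖f‖ ≤ 2)
    {a : (ι → Bool) → ℝ} (ha : ∑ x, a x ^ 2 = 1) (Ψ : Anc w k b × Reg n → ℂ)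
    (hΨ : stateNorm Ψ = 1) {τ B : ℝ} (hB : 0 ≤ B)
    (hτ : stateNorm (Ψ - assemble ρ (flagState (embed k b ψ) f a)) ≤ τ)
    (hZ : ∑ x with parity x = true, a x ^ 2 ≤ B ^ 2) (M : Op (Reg n))
    (hM : ∀ i j, M i j = ∑ c, Ψ (c, i) * star (Ψ (c, j))) :
    traceDist M (pureState ψ) ≤ (2 * B + τ) + B ^ 2 / 2 := by
  have hτ0 : 0 ≤ τ := (stateNorm_nonneg _).trans hτ
  set g : Anc w k b → ℂ := fun c => if (ancEquiv ρ c).1 = signalZero k b then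
    (if parity (ancEquiv ρ c).2 then 0 else (a (ancEquiv ρ c).2 : ℂ)) else 0 with hg
  have hgood : ∀ c i, assemble ρ (flagState (embed k b ψ) 0 a) (c, i) = g c * ψ i := by
    intro c i
    simp only [assemble, flagState, fullEquiv, Equiv.coe_fn_mk, hg]
    by_cases h1 : parity (ancEquiv ρ c).2 = true <;>
      by_cases h2 : (ancEquiv ρ c).1 = signalZero k b <;> simp [h1, h2, embed_apply]
  have hslice : ∀ φ : Anc w k b × Reg n → ℂ,
      ∑ c, ‖(WithLp.toLp 2 fun i => φ (c, i) : EuclideanSpace ℂ (Reg n))‖ ^ 2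
        = stateNorm φ ^ 2 := by
    intro φ
    rw [stateNorm_sq, Fintype.sum_prod_type fun p : Anc w k b × Reg n => ‖φ p‖ ^ 2]
    exact Finset.sum_congr rfl fun c _ => by rw [EuclideanSpace.norm_sq_eq]
  have hdiff : stateNorm (Ψ - assemble ρ (flagState (embed k b ψ) 0 a)) ≤ 2 * B + τ := by
    have h1 : stateNorm (assemble ρ (flagState (embed k b ψ) f a)
        - assemble ρ (flagState (embed k b ψ) 0 a)) ≤ 2 * B := by
      refine (pow_le_pow_iff_left₀ (stateNorm_nonneg _) (by positivity) two_ne_zero).1 ?_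
      rw [assemble_sub, stateNorm_assemble_sq, mul_pow]
      have h5 : ∀ x, ‖(flagState (embed k b ψ) f a - flagState (embed k b ψ) 0 a) x‖ ^ 2
          ≤ 2 ^ 2 * (if parity x = true then a x ^ 2 else 0) := by
        intro x
        rw [Pi.sub_apply, flagState, flagState, ← smul_sub]
        split_ifs
        · rw [sub_zero, norm_smul, mul_pow, Complex.norm_real, Real.norm_eq_abs, sq_abs, mul_comm]
          exact mul_le_mul_of_nonneg_right (pow_le_pow_left₀ (norm_nonneg _) hf 2) (sq_nonneg _)
        · simp
      refine (Finset.sum_le_sum fun x _ => h5 x).trans ?_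
      rw [← Finset.mul_sum, ← Finset.sum_filter]
      exact mul_le_mul_of_nonneg_left hZ (by norm_num)
    have h2 := stateNorm_sub_le Ψ (assemble ρ (flagState (embed k b ψ) f a))
      (assemble ρ (flagState (embed k b ψ) 0 a))
    linarith
  have hgsum : ∑ c, ‖g c‖ ^ 2 = 1 - ∑ x with parity x = true, a x ^ 2 := by
    rw [← Equiv.sum_comp (ancEquiv (k := k) (b := b) ρ).symm, Fintype.sum_prod_type_right,
      eq_sub_iff_add_eq, Finset.sum_filter, ← ha, ← Finset.sum_add_distrib]
    refine Finset.sum_congr rfl fun x _ => ?_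
    rw [Finset.sum_eq_single (signalZero k b) (fun q _ hq => by simp [hg, hq]) (by simp)]
    by_cases h : parity x = true <;> simp [hg, h]
  have hq0 : 0 ≤ ∑ x with parity x = true, a x ^ 2 := Finset.sum_nonneg fun _ _ => sq_nonneg _
  refine (traceDist_reduced_le (fun c => WithLp.toLp 2 fun i => Ψ (c, i))
    (fun c => WithLp.toLp 2 fun i => (Ψ - assemble ρ (flagState (embed k b ψ) 0 a)) (c, i))
    g hψ ?_ ?_ hq0 (ν := 2 * B + τ) (by positivity) hgsum ?_ M hM).trans ?_
  · intro c
    ext i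
    simp [hgood]
  · rw [hslice, hΨ, one_pow]
  · rw [hslice]
    exact pow_le_pow_left₀ (stateNorm_nonneg _) hdiff 2
  · linarith

end Outcome

/-! ### The schedule of the rounds and the estimator -/

section Schedule

/-- The bits of the record. For every power `2 ^ j` or `2 ^ j + 1` with `j ≤ J`, labelled by `j` and
a Boolean, there are `N (J - j + 1)` measurement rounds, so that the longer and more expensive
rounds are repeated less often; `R` rounds to lower the flag follow. -/
abbrev RecordBit (J N R : ℕ) : Type :=
  (Σ g : Fin (J + 1) × Bool, Fin (N * (J - g.1 + 1))) ⊕ Fin R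

variable {J N R : ℕ}

/-- The power of the walk operator used in a round. -/
def roundPower : RecordBit J N R → ℕ
  | .inl s => 2 ^ (s.1.1 : ℕ) + s.1.2.toNat
  | .inr _ => 1

/-- Measurement rounds are unconditional; the final rounds act only if the flag is raised. -/
def roundControl : RecordBit J N R → (RecordBit J N R → Bool) → Bool
  | .inl _, _ => true
  | .inr _, x => parity x

/-- The measurement rounds in some order. -/
def measureRounds (J N R : ℕ) : List (RecordBit J N R) := Finset.univ.toList.map Sum.inl

/-- The final rounds in some order. -/
def resetRounds (J N R : ℕ) : List (RecordBit J N R) := Finset.univ.toList.map Sum.inr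

lemma nodup_rounds (J N R : ℕ) : (measureRounds J N R ++ resetRounds J N R).Nodup := by
  rw [List.nodup_append]
  refine ⟨(Finset.nodup_toList _).map Sum.inl_injective,
    (Finset.nodup_toList _).map Sum.inr_injective, ?_⟩
  intro a ha b hb
  simp only [measureRounds, resetRounds, List.mem_map] at ha hb
  obtain ⟨a', -, rfl⟩ := ha
  obtain ⟨b', -, rfl⟩ := hb
  exact Sum.inl_ne_inr

lemma mem_rounds (i : RecordBit J N R) : i ∈ measureRounds J N R ++ resetRounds J N R := by
  simp only [measureRounds, resetRounds, List.mem_append, List.mem_map, Finset.mem_toList,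
    Finset.mem_univ, true_and]
  rcases i with s | r
  · exact Or.inl ⟨s, rfl⟩
  · exact Or.inr ⟨r, rfl⟩

lemma sum_levels (J : ℕ) : ∑ j ∈ Finset.range (J + 1), (J - j + 1) * 2 ^ j ≤ 4 * 2 ^ J := by
  have h : ∑ j ∈ Finset.range (J + 1), (J - j + 1) * 2 ^ j + J + 3 = 4 * 2 ^ J := by
    induction J with
    | zero => simp
    | succ J ih =>
      rw [Finset.sum_range_succ]
      have h1 : ∑ j ∈ Finset.range (J + 1), (J + 1 - j + 1) * 2 ^ j
          = ∑ j ∈ Finset.range (J + 1), (J - j + 1) * 2 ^ j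
            + ∑ j ∈ Finset.range (J + 1), 2 ^ j := by
        rw [← Finset.sum_add_distrib]
        refine Finset.sum_congr rfl fun j hj => ?_
        have : J + 1 - j = J - j + 1 := by
          have := Finset.mem_range.1 hj
          omega
        rw [this]; ring
      have h2 : ∑ j ∈ Finset.range (J + 1), 2 ^ j + 1 = 2 ^ (J + 1) := by
        have := Nat.geomSum_eq (le_refl 2) (J + 1)
        have h3 : 1 ≤ 2 ^ (J + 1) := Nat.one_le_two_pow
        simp at this
        omega
      rw [h1]
      simp only [Nat.sub_self, zero_add, one_mul]
      rw [pow_succ] at h2 ⊢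
      omega
  omega

/-- The repetitions and the powers balance: the total number of uses of the walk operator is
proportional to the largest power. -/
lemma sum_roundPower_le (J N R : ℕ) :
    ((measureRounds J N R ++ resetRounds J N R).map roundPower).sum ≤ 12 * N * 2 ^ J + R := by
  have h1 : ((measureRounds J N R).map roundPower).sum
      = ∑ g : Fin (J + 1) × Bool, N * (J - g.1 + 1) * (2 ^ (g.1 : ℕ) + g.2.toNat) := by
    rw [measureRounds, List.map_map, Finset.sum_map_toList, Fintype.sum_sigma]
    refine Finset.sum_congr rfl fun g _ => ?_
    change ∑ _i : Fin (N * (J - g.1 + 1)), (2 ^ (g.1 : ℕ) + g.2.toNat) = _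
    rw [Finset.sum_const, Finset.card_univ, Fintype.card_fin, smul_eq_mul]
  have h2 : ((resetRounds J N R).map roundPower).sum = R := by
    rw [resetRounds, List.map_map, Finset.sum_map_toList]
    change ∑ _i : Fin R, 1 = R
    simp
  rw [List.map_append, List.sum_append, h1, h2]
  refine Nat.add_le_add_right ?_ R
  rw [Fintype.sum_prod_type]
  have h3 : ∀ j : Fin (J + 1), ∑ b : Bool, N * (J - j + 1) * (2 ^ (j : ℕ) + b.toNat)
      ≤ 3 * N * ((J - j + 1) * 2 ^ (j : ℕ)) := by
    intro j
    have : 1 ≤ 2 ^ (j : ℕ) := Nat.one_le_two_pow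
    rw [Fintype.sum_bool, ← mul_add]
    calc N * (J - j + 1) * (2 ^ (j : ℕ) + Bool.toNat true + (2 ^ (j : ℕ) + Bool.toNat false))
        ≤ N * (J - j + 1) * (3 * 2 ^ (j : ℕ)) := Nat.mul_le_mul_left _ (by simp; omega)
      _ = _ := by ring
  refine (Finset.sum_le_sum fun j _ => h3 j).trans ?_
  rw [← Finset.mul_sum, Fin.sum_univ_eq_sum_range (fun j => (J - j + 1) * 2 ^ j)]
  calc 3 * N * _ ≤ 3 * N * (4 * 2 ^ J) := Nat.mul_le_mul_left _ (sum_levels J)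
    _ = _ := by ring

/-- The measurement rounds with a given power. -/
def roundGroup (J N R : ℕ) (g : Fin (J + 1) × Bool) : Finset (RecordBit J N R) :=
  Finset.univ.map ⟨fun i : Fin (N * (J - g.1 + 1)) => Sum.inl ⟨g, i⟩, fun i j h => by
    simpa using h⟩

lemma card_roundGroup (g : Fin (J + 1) × Bool) :
    (roundGroup J N R g).card = N * (J - g.1 + 1) := by
  simp [roundGroup]

/-- The probability that the flag changes in a measurement round, if the expectation value is
`a`. -/
def flipProb (a : ℝ) (g : Fin (J + 1) × Bool) : ℝ :=
  Real.sin (((2 ^ (g.1 : ℕ) + g.2.toNat : ℕ) : ℝ) * (2 * angle a)) ^ 2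

/-- The record is consistent with the expectation value `a`: all frequencies of flag changes are
close to their means. -/
def Consistent (x : RecordBit J N R → Bool) (a : ℝ) : Prop :=
  ∀ g, |∑ i ∈ roundGroup J N R g, ((x i).toNat : ℝ) - flipProb a g * (roundGroup J N R g).card|
    ≤ 1 / 104 * (roundGroup J N R g).card

open Classical in
/-- Any value in `[-1, 1]` with which the record is consistent, if there is one. -/
def estimator (x : RecordBit J N R → Bool) : ℝ :=
  if h : ∃ a, |a| ≤ 1 ∧ Consistent x a then h.choose else 0

lemma estimator_close (hN : 0 < N) {x : RecordBit J N R → Bool} {a : ℝ} (ha : |a| ≤ 1)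
    (hx : Consistent x a) : |estimator x - a| ≤ 1 / 2 ^ J := by
  have h : ∃ a, |a| ≤ 1 ∧ Consistent x a := ⟨a, ha, hx⟩
  rw [estimator, dif_pos h]
  obtain ⟨h1, h2⟩ := h.choose_spec
  refine decode h1 ha J fun j hj b => ?_
  set g : Fin (J + 1) × Bool := (⟨j, by omega⟩, b) with hg
  have hc : (0 : ℝ) < (roundGroup J N R g).card := by
    rw [card_roundGroup]
    exact_mod_cast Nat.mul_pos hN (Nat.succ_pos _)
  have h3 := abs_le.1 (h2 g)
  have h4 := abs_le.1 (hx g)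
  change |flipProb h.choose g - flipProb a g| ≤ 1 / 52
  refine abs_le.2 ⟨le_of_mul_le_mul_right ?_ hc, le_of_mul_le_mul_right ?_ hc⟩ <;> linarith

lemma roundAngle_inl (φ : ℝ) (s : Σ g : Fin (J + 1) × Bool, Fin (N * (J - g.1 + 1)))
    (x : RecordBit J N R → Bool) :
    roundAngle φ roundPower roundControl (Sum.inl s) x
      = ((2 ^ (s.1.1 : ℕ) + s.1.2.toNat : ℕ) : ℝ) * φ := rfl

lemma sum_pow_levels_le {z : ℝ} (hz0 : 0 ≤ z) (hz : z ≤ 1 / 2) (J : ℕ) :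
    ∑ j ∈ Finset.range (J + 1), z ^ (J - j + 1) ≤ 2 * z := by
  rw [← Finset.sum_range_reflect]
  have h1 : ∀ j ∈ Finset.range (J + 1), z ^ (J - (J + 1 - 1 - j) + 1) ≤ z * (1 / 2) ^ j := by
    intro j hj
    have : J - (J + 1 - 1 - j) + 1 = j + 1 := by
      have := Finset.mem_range.1 hj
      omega
    rw [this, pow_succ, mul_comm]
    exact mul_le_mul_of_nonneg_left (pow_le_pow_left₀ hz0 hz j) hz0
  refine (Finset.sum_le_sum h1).trans ?_
  rw [← Finset.mul_sum, mul_comm]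
  refine mul_le_mul_of_nonneg_right ?_ hz0
  rw [geom_sum_eq (by norm_num)]
  have : (0 : ℝ) < (1 / 2) ^ (J + 1) := by positivity
  rw [div_le_iff_of_neg (by norm_num)]
  linarith

open Classical in
/-- The record is almost surely consistent with the true expectation value. -/
lemma sum_not_consistent_le (a : ℝ) {z : ℝ} (hz : z ≤ 1 / 2)
    (hN : Real.exp (-((1 / 104) ^ 2 / 4 * N)) ≤ z) :
    ∑ x with ¬ Consistent x a,
        recordAmp (roundAngle (2 * angle a) roundPower roundControl)
          (measureRounds J N R ++ resetRounds J N R) x ^ 2 ≤ 8 * z := by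
  set A := recordAmp (roundAngle (2 * angle a) roundPower roundControl)
          (measureRounds J N R ++ resetRounds J N R) with hA
  let Z : (Fin (J + 1) × Bool) × Bool → Finset (RecordBit J N R → Bool) := fun s =>
    Finset.univ.filter fun x => 1 / 104 * ((roundGroup J N R s.1).card : ℝ)
      < (if s.2 then 1 else -1) * (∑ i ∈ roundGroup J N R s.1, ((x i).toNat : ℝ)
        - flipProb a s.1 * (roundGroup J N R s.1).card)
  have hz0 : 0 ≤ z := (Real.exp_nonneg _).trans hN
  have htail : ∀ s, ∑ x ∈ Z s, A x ^ 2 ≤ z ^ (J - s.1.1 + 1) := by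
    intro s
    refine (record_tail_le _ (roundGroup J N R s.1) (flipProb a s.1) (1 / 104)
      (if s.2 then 1 else -1) (by norm_num) (by norm_num) ?_ ?_ _ (nodup_rounds J N R)
      fun i _ => mem_rounds i).trans ?_
    · cases s.2 <;> simp
    · intro i hi x
      obtain ⟨i', -, rfl⟩ := Finset.mem_map.1 hi
      change Real.sin (roundAngle (2 * angle a) roundPower roundControl (Sum.inl ⟨s.1, i'⟩) x) ^ 2
        = flipProb a s.1
      rw [roundAngle_inl, flipProb]
    · rw [card_roundGroup, Nat.cast_mul, ← mul_assoc, ← neg_mul,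
        mul_comm _ ((J - s.1.1 + 1 : ℕ) : ℝ), Real.exp_nat_mul]
      exact pow_le_pow_left₀ (Real.exp_nonneg _) hN _
  have hmem : ∀ x, ¬ Consistent x a → ∃ s, x ∈ Z s := by
    intro x hx
    unfold Consistent at hx
    push Not at hx
    obtain ⟨g, hg⟩ := hx
    rcases lt_abs.1 hg with h | h
    · exact ⟨(g, true), Finset.mem_filter.2 ⟨Finset.mem_univ _, by simpa using h⟩⟩
    · refine ⟨(g, false), Finset.mem_filter.2 ⟨Finset.mem_univ _, ?_⟩⟩
      simp only [Bool.false_eq_true, if_false]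
      linarith
  calc _ ≤ ∑ s, ∑ x ∈ Z s, A x ^ 2 := by
        have h1 : ∀ s, ∑ x ∈ Z s, A x ^ 2 = ∑ x, if x ∈ Z s then A x ^ 2 else 0 := fun s => by
          rw [← Finset.sum_filter, Finset.filter_mem_eq_inter, Finset.univ_inter]
        simp_rw [h1]
        rw [Finset.sum_comm, Finset.sum_filter]
        refine Finset.sum_le_sum fun x _ => ?_
        have h2 : ∀ s, 0 ≤ if x ∈ Z s then A x ^ 2 else 0 := fun s => by
          split_ifs
          · exact sq_nonneg _
          · exact le_rfl
        by_cases hx : Consistent x a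
        · rw [if_neg (not_not_intro hx)]
          exact Finset.sum_nonneg fun s _ => h2 s
        · rw [if_pos hx]
          obtain ⟨s, hs⟩ := hmem x hx
          have h3 := Finset.single_le_sum (fun s _ => h2 s) (Finset.mem_univ s)
          rwa [if_pos hs] at h3
    _ ≤ ∑ s : (Fin (J + 1) × Bool) × Bool, z ^ (J - s.1.1 + 1) :=
        Finset.sum_le_sum fun s _ => htail s
    _ = 4 * ∑ j ∈ Finset.range (J + 1), z ^ (J - j + 1) := by
        rw [← Fin.sum_univ_eq_sum_range (fun j => z ^ (J - j + 1))]
        simp only [Fintype.sum_prod_type, Finset.sum_const, Finset.card_univ, Fintype.card_bool,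
          Finset.mul_sum]
        refine Finset.sum_congr rfl fun j _ => ?_
        ring
    _ ≤ 8 * z := by
        have := sum_pow_levels_le hz0 hz J
        linarith

end Schedule

/-! ### The protocol -/

section Tomography

variable {n b w k J N R : ℕ}

/-- An encoding of the record and of the selector in the workspace, with initial label `0`. -/
lemma exists_workspace (ι : Type) [Fintype ι] [DecidableEq ι] :
    ∃ ρ : Reg (Fintype.card ι + 1) ≃ (ι → Bool) × Bool, ρ 0 = (fun _ => false, false) := by
  have hcard : Fintype.card (Reg (Fintype.card ι + 1)) = Fintype.card ((ι → Bool) × Bool) := by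
    simp [pow_succ]
  let ρ₀ := Fintype.equivOfCardEq hcard
  exact ⟨ρ₀.trans (Equiv.swap (ρ₀ 0) (fun _ => false, false)), by simp⟩

/-- The measurement protocol: the measurement rounds, the rounds that lower the flag, and the
estimate computed from the record. -/
def tomography (t₀ : ℝ) (ht₀ : 0 < t₀) (ρ : Reg w ≃ (RecordBit J N R → Bool) × Bool)
    (U U' : Matrix.unitaryGroup (Signal k b) ℂ) : Protocol b where
  w := w
  k := k
  t₀ := t₀
  t₀_pos := ht₀
  steps := programSteps ρ U U' roundPower roundControl (measureRounds J N R ++ resetRounds J N R)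
  estimate := fun r => estimator (ρ r).1

lemma calls_tomography_le (t₀ : ℝ) (ht₀ : 0 < t₀)
    (ρ : Reg w ≃ (RecordBit J N R → Bool) × Bool) (U U' : Matrix.unitaryGroup (Signal k b) ℂ) :
    (tomography t₀ ht₀ ρ U U').calls ≤ 2 * (12 * N * 2 ^ J + R) := by
  change ((programSteps ρ U U' roundPower roundControl
    (measureRounds J N R ++ resetRounds J N R)).map Step.calls).sum ≤ _
  rw [calls_programSteps]
  exact Nat.mul_le_mul_left _ (sum_roundPower_le J N R)

lemma time_tomography (t₀ : ℝ) (ht₀ : 0 < t₀)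
    (ρ : Reg w ≃ (RecordBit J N R → Bool) × Bool) (U U' : Matrix.unitaryGroup (Signal k b) ℂ) :
    (tomography t₀ ht₀ ρ U U').time
      = (tomography t₀ ht₀ ρ U U').calls * (2 * (t₀ * 2 ^ k)) :=
  sum_time_eq t₀ _

/-- The initial state of a protocol is the system state with empty record and lowered flag. -/
lemma initial_eq_assemble {I : Type} [Fintype I] [DecidableEq I] {ρ : Reg w ≃ (I → Bool) × Bool}
    (hρ : ρ 0 = (fun _ => false, false)) (ψ : EuclideanSpace ℂ (Reg n))
    (f : EuclideanSpace ℂ (Signal k b × Reg n)) (ϑ : I → (I → Bool) → ℝ) :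
    (fun p : Anc w k b × Reg n => if p.1 = (0, 0, 0) then ψ p.2 else 0)
      = assemble ρ (flagState (embed k b ψ) f (recordAmp ϑ [])) := by
  ext ⟨⟨r, t, β⟩, i⟩
  have hr : r = 0 ↔ (ρ r).1 = (fun _ => false) ∧ (ρ r).2 = false := by
    rw [← Equiv.apply_eq_iff_eq ρ, hρ, Prod.ext_iff]
  simp only [assemble, fullEquiv_mk, flagState, recordAmp, List.foldl_nil]
  by_cases hx : (ρ r).1 = fun _ => false
  · simp only [Prod.mk.injEq, hr, hx, true_and, if_true, parity_false, Bool.false_eq_true,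
      if_false, Complex.ofReal_one, one_smul, embed_apply, signalZero]
  · simp [hr, hx]

/-- Correctness of the protocol, in terms of the accuracy `η` of the filter, a bound `B ^ 2` on the
failure probabilities of the idealized record, and the resulting total error `τ`. -/
lemma tomography_correct {t₀ : ℝ} (ht₀ : 0 < t₀)
    {ρ : Reg w ≃ (RecordBit J N R → Bool) × Bool} (hρ : ρ 0 = (fun _ => false, false))
    {U U' : Matrix.unitaryGroup (Signal k b) ℂ} {c : Reg (k + 1) → ℝ}
    (hc : ∀ j, 0 ≤ c j) (hc1 : ∑ j, c j = 1)
    (hU : ∀ q, (U : Op (Signal k b)) q (signalZero k b) = signalState k b walkIn c q)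
    (hU' : ∀ q, (U' : Op (Signal k b)) q (signalZero k b) = signalState k b walkOut c q)
    {H A : Op (Reg n)} (hH : H.IsHermitian) (hA : A.IsHermitian) (hA1 : ‖A‖ ≤ 1)
    {V : Op (Reg b × Reg n)} (hV : IsBlockEncoding V A) {ψ : EuclideanSpace ℂ (Reg n)}
    (hψ : ‖ψ‖ = 1) {η : ℝ}
    (hη : ‖(∑ j, (c j : ℂ) • Matrix.toEuclideanLin (evolution H (timeValue k t₀ j) * A *
      evolution H (-timeValue k t₀ j)) ψ) - (expectation A ψ : ℂ) • ψ‖ ≤ η)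
    (hN : 0 < N) {z B τ ε : ℝ} (hz : z ≤ 1 / 2)
    (hNz : Real.exp (-((1 / 104) ^ 2 / 4 * N)) ≤ z) (hB : 0 ≤ B) (hzB : 8 * z ≤ B ^ 2)
    (hR : (93 / 100 : ℝ) ^ R ≤ B ^ 2)
    (hτ : ((12 * N * 2 ^ J + R : ℕ) : ℝ) * (2 * (16 * η)) ≤ τ) (hε : 1 / 2 ^ J ≤ ε) :
    1 - (2 * B + τ) ^ 2
      ≤ (tomography t₀ ht₀ ρ U U').probWithin H V ψ (expectation A ψ) ε ∧
    traceDist ((tomography t₀ ht₀ ρ U U').returned H V ψ) (pureState ψ)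
      ≤ (2 * B + τ) + B ^ 2 / 2 := by
  classical
  have ha : |expectation A ψ| ≤ 1 := abs_expectation_le_one hA1 hψ
  set a := expectation A ψ with ha_def
  have hη0 : 0 ≤ η := (norm_nonneg _).trans hη
  obtain ⟨f, hf2, hPf, hGe, hGf⟩ := walkOp_rotation U.2 U'.2 hc hc1 hU hU' t₀ hH hA hV hψ ha hη
  set e := embed k b ψ with he_def
  have he : ∀ p, p.1 ≠ signalZero k b → e p = 0 := fun p hp => by
    rw [he_def, embed_apply, if_neg hp]
  have hf : ∀ p, p.1 = signalZero k b → f p = 0 := fun p hp => by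
    have h1 : signalProj k b n f p = f p := by rw [signalProj_apply, if_pos hp]
    rw [← h1, hPf]
    rfl
  set l := measureRounds J N R ++ resetRounds J N R with hl
  set amp := recordAmp (roundAngle (2 * angle a) roundPower roundControl) l with hamp
  set P := tomography t₀ ht₀ ρ U U' with hP
  set Ψ : Anc w k b × Reg n → ℂ := P.final H V ψ with hΨ
  have hinit : P.initial ψ = assemble ρ (flagState e f
      (recordAmp (roundAngle (2 * angle a) roundPower roundControl) [])) :=
    initial_eq_assemble hρ ψ f _
  have hrun : Ψ = runSteps t₀ H V (programSteps ρ U U' roundPower roundControl l)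
      (assemble ρ (flagState e f
        (recordAmp (roundAngle (2 * angle a) roundPower roundControl) []))) := by
    rw [← hinit]; rfl
  have hclose : stateNorm (Ψ - assemble ρ (flagState e f amp)) ≤ τ := by
    rw [hrun]
    refine (program_error ρ U U' roundPower roundControl t₀ hH hV.1 he hf hGe hGf l
      (nodup_rounds J N R)).trans (le_trans ?_ hτ)
    refine mul_le_mul_of_nonneg_right ?_ (by positivity)
    exact_mod_cast sum_roundPower_le J N R
  have hΨ1 : stateNorm Ψ = 1 := by
    rw [hrun, stateNorm_runSteps t₀ hH hV.1]
    refine (pow_left_inj₀ (stateNorm_nonneg _) zero_le_one two_ne_zero).1 ?_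
    rw [stateNorm_assemble_sq, Finset.sum_eq_single (fun _ => false)]
    · simp [flagState, recordAmp, he_def, norm_embed, hψ]
    · intro x _ hx
      simp [flagState, recordAmp, hx]
    · simp
  have hamp1 : ∑ x, amp x ^ 2 = 1 := sum_recordAmp_sq _ _ (nodup_rounds J N R)
  have hreset : ∑ x with parity x = true, amp x ^ 2 ≤ B ^ 2 := by
    refine (sum_recordAmp_parity_le _ (2 * angle a) (measureRounds J N R) (resetRounds J N R)
      (nodup_rounds J N R) ?_).trans (le_trans ?_ hR)
    · intro i hi x
      obtain ⟨r, -, rfl⟩ := List.mem_map.1 hi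
      simp [roundAngle, roundPower, roundControl]
    · have : (resetRounds J N R).length = R := by simp [resetRounds]
      rw [this]
      exact pow_le_pow_left₀ (sq_nonneg _) (cos_two_angle_sq_le ha) R
  have hcons : ∑ x with ¬ Consistent x a, amp x ^ 2 ≤ B ^ 2 :=
    (sum_not_consistent_le a hz hNz).trans hzB
  have he2 : ‖e‖ ≤ 2 := by rw [he_def, norm_embed, hψ]; norm_num
  constructor
  · have hbad := sum_filter_le_of_close ρ he2 hf2 Ψ hB hclose (fun x => ¬ Consistent x a) hcons
    have htotal : ∑ p, ‖Ψ p‖ ^ 2 = 1 := by rw [← stateNorm_sq, hΨ1, one_pow]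
    have hsplit : ∑ p, ‖Ψ p‖ ^ 2 ≤ P.probWithin H V ψ a ε
        + ∑ p with ¬ Consistent (ρ p.1.1).1 a, ‖Ψ p‖ ^ 2 := by
      rw [Finset.sum_filter, Protocol.probWithin]
      change _ ≤ ∑ p : Anc w k b × Reg n,
        (if |estimator (ρ p.1.1).1 - a| ≤ ε then ‖Ψ p‖ ^ 2 else 0) + _
      rw [← Finset.sum_add_distrib]
      refine Finset.sum_le_sum fun p _ => ?_
      by_cases h : Consistent (ρ p.1.1).1 a
      · rw [if_pos ((estimator_close hN ha h).trans hε), if_neg (not_not_intro h), add_zero]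
      · rw [if_pos h]
        have : 0 ≤ (if |estimator (ρ p.1.1).1 - a| ≤ ε then ‖Ψ p‖ ^ 2 else 0) := by
          split_ifs
          · exact sq_nonneg _
          · exact le_rfl
        linarith
    linarith
  · exact traceDist_of_close ρ hψ hf2 hamp1 Ψ hΨ1 hB hclose hreset _ fun i j => rfl

end Tomography

/-! ### The choice of the parameters -/

section Parameters

lemma exists_preparation {k b : ℕ} {c : Reg (k + 1) → ℝ} (hc : ∀ j, 0 ≤ c j)
    (hc1 : ∑ j, c j = 1) {α : Bool → ℝ} (hα : α false ^ 2 + α true ^ 2 = 1) :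
    ∃ U : Matrix.unitaryGroup (Signal k b) ℂ,
      ∀ q, (U : Op (Signal k b)) q (signalZero k b) = signalState k b α c q := by
  obtain ⟨U, hU, h⟩ := exists_unitary_column (signalZero k b) (signalState k b α c)
    (sum_norm_signalState hα hc hc1)
  exact ⟨⟨U, hU⟩, h⟩

lemma exists_two_pow {x : ℝ} (hx : 1 ≤ x) :
    ∃ q : ℕ, x < 2 ^ (q + 1) ∧ (2 : ℝ) ^ (q + 1) ≤ 2 * x := by
  obtain ⟨q, h1, h2⟩ := exists_nat_pow_near hx (by norm_num : (1 : ℝ) < 2)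
  exact ⟨q, h2, by rw [pow_succ]; linarith⟩

/-- A filter of accuracy `η` for all instances with the given gap and commutator bound. Only the
time step and the size of the register depend on `L`; the largest time does not. -/
lemma exists_accurate_filter {Δ η : ℝ} (L : ℝ) (hΔ : 0 < Δ) (hη : 0 < η) (q : ℕ)
    (hq : Real.log (2 / η) ≤ 2 ^ (q + 1) * Real.log 2) :
    ∃ (k : ℕ) (t₀ : ℝ), 0 < t₀ ∧ 2 * (t₀ * 2 ^ k) = 2 * Real.pi * 2 ^ (q + 1) / Δ ∧
      ∃ c : Reg (k + 1) → ℝ, (∀ j, 0 ≤ c j) ∧ ∑ j, c j = 1 ∧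
        ∀ (n : ℕ) (H A : Op (Reg n)) (ψ : EuclideanSpace ℂ (Reg n)), H.IsHermitian →
          A.IsHermitian → ‖A‖ ≤ 1 → ‖A * H - H * A‖ ≤ L → IsGappedGroundState H Δ ψ →
          ‖(∑ j, (c j : ℂ) • Matrix.toEuclideanLin (evolution H (timeValue k t₀ j) * A *
            evolution H (-timeValue k t₀ j)) ψ) - (expectation A ψ : ℂ) • ψ‖ ≤ η := by
  -- `2 ^ p` is the number of times per factor of the filter, so large that `t₀ L ≤ η / 2`
  obtain ⟨p, hp⟩ := pow_unbounded_of_one_lt (2 * Real.pi * |L| / Δ / (η / 2))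
    (by norm_num : (1 : ℝ) < 2)
  obtain ⟨c, hc, hc1, hfilter⟩ := exists_timeFilter hΔ (p := p) (q := q + 1) (k := p + q)
    (by ring)
  set t₀ := 2 * Real.pi / (Δ * 2 ^ p) with ht₀
  have ht₀pos : 0 < t₀ := by positivity
  refine ⟨p + q, t₀, ht₀pos, ?_, c, hc, hc1, ?_⟩
  · rw [ht₀, pow_add, pow_succ]
    field_simp
  · intro n H A ψ hH hA hA1 hL hψ
    have h1 := norm_filtered_sub_le hH hA hA1 hL hψ c (timeValue (p + q) t₀) hc1
      (by positivity) hfilter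
    have h2 : (1 / 2 : ℝ) ^ 2 ^ (q + 1) ≤ η / 2 := by
      have h3 : (1 / 2 : ℝ) ^ 2 ^ (q + 1) = Real.exp (-(2 ^ (q + 1) * Real.log 2)) := by
        rw [Real.exp_neg, show (2 : ℝ) ^ (q + 1) = ((2 ^ (q + 1) : ℕ) : ℝ) by push_cast; rfl,
          Real.exp_nat_mul, Real.exp_log two_pos, one_div, inv_pow]
      have h4 : η / 2 = Real.exp (-Real.log (2 / η)) := by
        rw [Real.exp_neg, Real.exp_log (by positivity), inv_div]
      rw [h3, h4]
      exact Real.exp_le_exp.2 (neg_le_neg hq)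
    have h5 : (1 / 4 : ℝ) ^ 2 ^ (q + 1) ≤ (η / 2) ^ 2 := by
      calc (1 / 4 : ℝ) ^ 2 ^ (q + 1) = ((1 / 2 : ℝ) ^ 2 ^ (q + 1)) ^ 2 := by
            rw [← pow_mul, mul_comm, pow_mul]; norm_num
        _ ≤ _ := pow_le_pow_left₀ (by positivity) h2 2
    have h6 : (t₀ * L) ^ 2 ≤ (η / 2) ^ 2 := by
      rw [sq_le_sq, abs_mul, abs_of_pos ht₀pos, abs_of_pos (by positivity : 0 < η / 2), ht₀]
      rw [div_lt_iff₀ (by positivity), div_lt_iff₀ hΔ] at hp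
      rw [div_mul_eq_mul_div, div_le_iff₀ (by positivity)]
      linarith
    refine (pow_le_pow_iff_left₀ (norm_nonneg _) hη.le two_ne_zero).1 (h1.trans ?_)
    nlinarith [sq_nonneg η]

lemma exp_neg_two_log {δ : ℝ} (hδ : 0 < δ) (m : ℕ) :
    Real.exp (-(2 * Real.log (1 / δ) + m * Real.log 2)) = δ ^ 2 / 2 ^ m := by
  rw [neg_add, Real.exp_add, ← mul_neg, ← Real.log_inv, one_div, inv_inv, Real.exp_neg,
    Real.exp_nat_mul, Real.exp_log two_pos, show (2 : ℝ) = ((2 : ℕ) : ℝ) by norm_num,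
    Real.exp_nat_mul, Real.exp_log hδ]
  rfl

/-- The largest power `2 ^ J`, the numbers of repetitions `N` and `R`, and the exponent `q` that
determines the largest time, for failure probabilities of order `δ ^ 2` and a filter of accuracy
`δ ^ 2 ε / 2 ^ 32`. -/
lemma exists_constants {ε δ : ℝ} (hε : 0 < ε) (hε1 : ε ≤ 1) (hδ : 0 < δ) (hδ2 : δ ≤ 1 / 2) :
    ∃ J N R q : ℕ, 0 < N ∧ 1 / 2 ^ J ≤ ε ∧
      Real.exp (-((1 / 104) ^ 2 / 4 * N)) ≤ δ ^ 2 / 2048 ∧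
      (93 / 100 : ℝ) ^ R ≤ (δ / 16) ^ 2 ∧
      ((12 * N * 2 ^ J + R : ℕ) : ℝ) ≤ 14000000 * (Real.log (1 / δ) / ε) ∧
      ((12 * N * 2 ^ J + R : ℕ) : ℝ) * (2 * (16 * (δ ^ 2 * ε / 2 ^ 32))) ≤ δ / 8 ∧
      Real.log (2 / (δ ^ 2 * ε / 2 ^ 32)) ≤ 2 ^ (q + 1) * Real.log 2 ∧
      (2 : ℝ) ^ (q + 1) ≤ 140 * (Real.log (1 / δ) + Real.log (1 / ε)) := by
  have hlog2 : (1 / 2 : ℝ) ≤ Real.log 2 := by linarith [Real.log_two_gt_d9]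
  set l := Real.log (1 / δ) with hl
  have hl2 : Real.log 2 ≤ l := by
    refine Real.log_le_log two_pos ?_
    rw [le_div_iff₀ hδ]; linarith
  have hl0 : 0 < l := by linarith
  have hlδ : l * δ ≤ 1 := by
    have := Real.log_le_self (by positivity : 0 ≤ 1 / δ)
    rwa [← hl, le_div_iff₀ hδ] at this
  have hm : 0 ≤ Real.log (1 / ε) := Real.log_nonneg (by rw [le_div_iff₀ hε]; linarith)
  obtain ⟨J, hJ1, hJ2⟩ := exists_two_pow (x := 1 / ε) (by rw [le_div_iff₀ hε]; linarith)
  obtain ⟨q, hq1, hq2⟩ := exists_two_pow (x := 70 * (l + Real.log (1 / ε))) (by linarith)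
  -- `562432 = 13 * (4 * 104 ^ 2)`, where `13 l ≥ 2 l + log 2048`; likewise `143 ≥ 10 / 0.07`, where
  -- `10 l ≥ 2 l + log 256` and `93 / 100 ≤ exp (-0.07)`
  set N := ⌈562432 * l⌉₊ with hN
  set R := ⌈143 * l⌉₊ with hR
  have hN1 : 562432 * l ≤ N := Nat.le_ceil _
  have hN2 : (N : ℝ) ≤ 562434 * l := by
    have := Nat.ceil_lt_add_one (by positivity : 0 ≤ 562432 * l)
    linarith
  have hR1 : 143 * l ≤ R := Nat.le_ceil _
  have hR2 : (R : ℝ) ≤ 145 * l := by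
    have := Nat.ceil_lt_add_one (by positivity : 0 ≤ 143 * l)
    linarith
  have htotal : ((12 * N * 2 ^ (J + 1) + R : ℕ) : ℝ) ≤ 14000000 * (l / ε) := by
    have h1 : (N : ℝ) * 2 ^ (J + 1) ≤ 562434 * l * (2 * (1 / ε)) :=
      mul_le_mul hN2 hJ2 (by positivity) (by positivity)
    have h2 : l ≤ l / ε := by
      rw [le_div_iff₀ hε]
      exact mul_le_of_le_one_right hl0.le hε1
    have h3 : 562434 * l * (2 * (1 / ε)) = 1124868 * (l / ε) := by ring
    push_cast
    linarith
  refine ⟨J + 1, N, R, q, Nat.ceil_pos.2 (by positivity), ?_, ?_, ?_, htotal, ?_, ?_, by linarith⟩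
  · rw [div_le_iff₀ (by positivity)]
    rw [div_lt_iff₀ hε] at hJ1
    linarith
  · calc Real.exp (-((1 / 104) ^ 2 / 4 * N))
        ≤ Real.exp (-(2 * Real.log (1 / δ) + (11 : ℕ) * Real.log 2)) := by
          refine Real.exp_le_exp.2 ?_
          push_cast
          linarith
      _ = δ ^ 2 / 2048 := by rw [exp_neg_two_log hδ]; norm_num
  · have h := exp_neg_two_log hδ 8
    have h1 : (93 / 100 : ℝ) ≤ Real.exp (-(7 / 100)) := by
      linarith [Real.add_one_le_exp (-(7 / 100) : ℝ)]
    calc (93 / 100 : ℝ) ^ R ≤ Real.exp (-(7 / 100)) ^ R := pow_le_pow_left₀ (by norm_num) h1 R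
      _ = Real.exp (R * -(7 / 100)) := (Real.exp_nat_mul _ _).symm
      _ ≤ Real.exp (-(2 * Real.log (1 / δ) + (8 : ℕ) * Real.log 2)) := by
        refine Real.exp_le_exp.2 ?_
        push_cast
        linarith
      _ = (δ / 16) ^ 2 := by rw [h]; ring
  · calc ((12 * N * 2 ^ (J + 1) + R : ℕ) : ℝ) * (2 * (16 * (δ ^ 2 * ε / 2 ^ 32)))
        ≤ 14000000 * (l / ε) * (2 * (16 * (δ ^ 2 * ε / 2 ^ 32))) :=
          mul_le_mul_of_nonneg_right htotal (by positivity)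
      _ = 14000000 * 32 / 2 ^ 32 * (l * δ) * δ := by field_simp; norm_num
      _ ≤ 14000000 * 32 / 2 ^ 32 * 1 * δ := by gcongr
      _ ≤ δ / 8 := by linarith
  · have h1 : Real.log (2 / (δ ^ 2 * ε / 2 ^ 32))
        = 2 * l + Real.log (1 / ε) + 33 * Real.log 2 := by
      have h2 : 2 / (δ ^ 2 * ε / 2 ^ 32) = (1 / δ) ^ 2 * (1 / ε) * 2 ^ 33 := by
        field_simp
      rw [h2, Real.log_mul (by positivity) (by positivity),
        Real.log_mul (by positivity) (by positivity), Real.log_pow, Real.log_pow, ← hl]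
      norm_num
    rw [h1]
    have h3 : 70 * (l + Real.log (1 / ε)) * (1 / 2) ≤ 2 ^ (q + 1) * Real.log 2 :=
      mul_le_mul hq1.le hlog2 (by norm_num) (by positivity)
    linarith

end Parameters

end CatalyticTomography

end

theorem mainTheorem1 :
    ∃ C : ℝ, 0 < C ∧
      ∀ (n b : ℕ) (Δ L ε δ : ℝ), 0 < Δ → 0 < ε → ε ≤ 1 → 0 < δ → δ ≤ 1 / 2 →
        ∃ P : CatalyticTomography.Protocol b,
          P.time ≤ C * (Real.log (1 / δ) * (Real.log (1 / δ) + Real.log (1 / ε)) / (Δ * ε)) ∧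
          (P.calls : ℝ) ≤ C * (Real.log (1 / δ) / ε) ∧
          ∀ (H A : CatalyticTomography.Op (CatalyticTomography.Reg n))
            (V : CatalyticTomography.Op (CatalyticTomography.Reg b × CatalyticTomography.Reg n))
            (ψ : EuclideanSpace ℂ (CatalyticTomography.Reg n)),
            H.IsHermitian → A.IsHermitian → ‖A‖ ≤ 1 → ‖A * H - H * A‖ ≤ L →
            CatalyticTomography.IsGappedGroundState H Δ ψ →
            CatalyticTomography.IsBlockEncoding V A →
            1 - δ ≤ P.probWithin H V ψ (CatalyticTomography.expectation A ψ) ε ∧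
            CatalyticTomography.traceDist (P.returned H V ψ)
              (CatalyticTomography.pureState ψ) ≤ δ := by
  classical
  refine ⟨30000000000, by norm_num, fun n b Δ L ε δ hΔ hε hε1 hδ hδ2 => ?_⟩
  obtain ⟨J, N, R, q, hN, hJ, hNz, hR, hcalls, hτ, hq, hq2⟩ :=
    CatalyticTomography.exists_constants hε hε1 hδ hδ2
  obtain ⟨k, t₀, ht₀, htime, c, hc, hc1, hfilter⟩ :=
    CatalyticTomography.exists_accurate_filter L hΔ (by positivity : 0 < δ ^ 2 * ε / 2 ^ 32) q hq
  obtain ⟨U, hU⟩ := CatalyticTomography.exists_preparation (b := b) hc hc1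
    (α := CatalyticTomography.walkIn) (by norm_num [CatalyticTomography.walkIn])
  obtain ⟨U', hU'⟩ := CatalyticTomography.exists_preparation (b := b) hc hc1
    (α := CatalyticTomography.walkOut) (by norm_num [CatalyticTomography.walkOut])
  obtain ⟨ρ, hρ⟩ :=
    CatalyticTomography.exists_workspace (CatalyticTomography.RecordBit J N R)
  have hcalls2 : ((CatalyticTomography.tomography t₀ ht₀ ρ U U').calls : ℝ)
      ≤ 28000000 * (Real.log (1 / δ) / ε) := by
    have h := CatalyticTomography.calls_tomography_le t₀ ht₀ ρ U U'
    have h' : ((CatalyticTomography.tomography t₀ ht₀ ρ U U').calls : ℝ)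
      ≤ 2 * ((12 * N * 2 ^ J + R : ℕ) : ℝ) := by exact_mod_cast h
    linarith
  have hlog : 0 ≤ Real.log (1 / δ) :=
    Real.log_nonneg (by rw [le_div_iff₀ hδ]; linarith)
  have hlogε : 0 ≤ Real.log (1 / ε) :=
    Real.log_nonneg (by rw [le_div_iff₀ hε]; linarith)
  refine ⟨CatalyticTomography.tomography t₀ ht₀ ρ U U', ?_, hcalls2.trans ?_, ?_⟩
  · rw [CatalyticTomography.time_tomography, htime]
    have hπ : 2 * Real.pi * 2 ^ (q + 1) / Δ
        ≤ 7 * (140 * (Real.log (1 / δ) + Real.log (1 / ε))) / Δ := by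
      refine div_le_div_of_nonneg_right (mul_le_mul ?_ hq2 (by positivity) (by norm_num)) hΔ.le
      linarith [Real.pi_lt_d2]
    refine (mul_le_mul hcalls2 hπ (by positivity) (by positivity)).trans ?_
    have h : 28000000 * (Real.log (1 / δ) / ε)
          * (7 * (140 * (Real.log (1 / δ) + Real.log (1 / ε))) / Δ)
        = 27440000000
          * (Real.log (1 / δ) * (Real.log (1 / δ) + Real.log (1 / ε)) / (Δ * ε)) := by
      field_simp
      ring
    rw [h]
    exact mul_le_mul_of_nonneg_right (by norm_num) (by positivity)
  · exact mul_le_mul_of_nonneg_right (by norm_num) (by positivity)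
  · intro H A V ψ hH hA hA1 hL hψ hV
    obtain ⟨h1, h2⟩ := CatalyticTomography.tomography_correct ht₀ hρ hc hc1 hU hU' hH hA hA1 hV
      hψ.norm_eq_one (hfilter n H A ψ hH hA hA1 hL hψ) hN (z := δ ^ 2 / 2048) (B := δ / 16)
      (by nlinarith) hNz (by positivity) (by nlinarith) hR hτ hJ
    -- the total error `2 B + τ` is at most `δ / 4`
    constructor
    · nlinarith
    · nlinarith
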